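/- **Setting.** Fix an integer $D\ge 1$. Let $S^D$ be the space of real symmetric $D\times D$ matrices with inner product $a\cdot b=\mathrm{tr}(ab)$ and norm $|\cdot|$, $S^D_+$ the cone of positive semidefinite matrices, and write $a\ge b$ if $a-b\in S^D_+$. Let $\mathcal H=L^2([0,1);S^D)$ and let $\mathcal C\subset\mathcal H$ be the cone of (classes of) square-integrable, right-continuous with left limits, increasing paths $\mu:[0,1)\to S^D_+$. For a cone $C$ in a Hilbert space $E$, $C^*=\{x\in E:\langle x,y\rangle\ge 0\ \forall y\in C\}$; a function $g$ on a set $S\subset E$ is *$K$-increasing* if $g(x)\ge g(x')$ whenever $x,x'\in S$ and $x-x'\in K$. A function $g:S^D_+\to\mathbb R$ is *proper* if $g$ and all the functions $a\mapsto g(a+b)-g(a)$, $b\in S^D_+$, are $S^D_+$-increasing. *Viscosity solutions.* For $S\subset E$, a function $\phi:(0,\infty)\times S\to\mathbb R$ is smooth if it has a continuous differential $(\partial_t\phi,\nabla\phi)$ with values in $\mathbb R\times E$ such that, at each $(t,x)\in(0,\infty)\times S$, $\phi(s,y)-\phi(t,x)=\partial_t\phi(t,x)(s-t)+\langle\nabla\phi(t,x),y-x\rangle+O(|s-t|^2+|y-x|^2)$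 as $(s,y)\to(t,x)$ in $(0,\infty)\times S$. A continuous $f:[0,\infty)\times S\to\mathbb R$ is a viscosity subsolution (supersolution) of $\partial_t f-\mathsf H(\nabla f)=0$ on $[0,\infty)\times S$ if $(\partial_t\phi-\mathsf H(\nabla\phi))(t,x)\le 0$ (resp. $\ge 0$) for every smooth $\phi$ and every $(t,x)\in(0,\infty)\times S$ at which $f-\phi$ has a local maximum (resp. minimum) relative to $(0,\infty)\times S$. *The equation.* Let $\xi:\mathbb R^{D\times D}\to\mathbb R$. A *regularization* of $\xi$ is a Lipschitz proper function $\bar\xi:S^D_+\to\mathbb R$ with $\bar\xi=\xi$ on $\{a\in S^D_+:|a|\le1\}$, and which is convex if $\xi$ is convex on $S^D_+$. Put $\mathsf H_{\bar\xi}(\kappa)=\inf\{\int_0^1\bar\xi(\mu(s))\,ds:\mu\in\mathcal C\cap(\kappa+\mathcal C^*)\}$ for $\kappa\in\mathcal H$. A function $f:[0,\infty)\times\mathcal C\to\mathbb R$ is a viscosity subsolution (supersolution) of $$\partial_t f-\int\xi(\nabla f)=0\quad\text{on }[0,\infty)\times\mathcal C\tag{1}$$ if for some regularization $\bar\xi$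 it is one of $\partial_t f-\mathsf H_{\bar\xi}(\nabla f)=0$ on $[0,\infty)\times\mathcal C$; it is a viscosity solution of (1) if it is both a subsolution and a supersolution of (1). *Limits of Neumann solutions.* For $n\ge1$ let $\mathcal H^n=(S^D)^n$ with $\langle x,y\rangle=\frac1n\sum_{k=1}^n x_k\cdot y_k$ and $\mathcal C^n=\{x\in\mathcal H^n:0\le x_1\le\dots\le x_n\}$. Let $p_n\kappa=\big(n\int_{(k-1)/n}^{k/n}\kappa(s)\,ds\big)_{k\le n}$ for $\kappa\in\mathcal H$ and $l_nx=\sum_{k=1}^n x_k\mathbf 1_{[(k-1)/n,k/n)}$ for $x\in\mathcal H^n$. For a regularization $\bar\xi$ let $\mathsf F_n(b)=\inf\{\frac1n\sum_{k=1}^n\bar\xi(a_k):a\in\mathcal C^n\cap(b+(\mathcal C^n)^*)\}$ for $b\in\mathcal H^n$. Given $\psi:\mathcal C\to\mathbb R$, let $f_n:[0,\infty)\times\mathcal C^n\to\mathbb R$ be the Lipschitz viscosity solution of the Neumann problem $$\partial_t f_n-\mathsf F_n(\nabla f_n)=0\ \text{ in }(0,\infty)\times\mathrm{int}\,\mathcal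 C^n,\qquad \mathbf n\cdot\nabla f_n=0\ \text{ on }(0,\infty)\times\partial\mathcal C^n,\qquad f_n(0,\cdot)=\psi\circ l_n .$$ Here a continuous $u$ is a viscosity subsolution if, whenever $\phi$ is smooth on $(0,\infty)\times\mathcal C^n$ and $u-\phi$ has a local maximum at $(t,x)\in(0,\infty)\times\mathcal C^n$: if $x\in\mathrm{int}\,\mathcal C^n$, then $(\partial_t\phi-\mathsf F_n(\nabla\phi))(t,x)\le0$; if $x\in\partial\mathcal C^n$, then either this inequality holds or $\nu\cdot\nabla\phi(t,x)\le0$ for some unit outer normal $\nu$ of $\mathcal C^n$ at $x$ (that is, $|\nu|=1$ and $\langle\nu,y-x\rangle\le0$ for all $y\in\mathcal C^n$). Supersolutions are defined with local minima and $\ge$, and solutions are functions that are both. The *limit solution* of (1) with initial condition $\psi$ is the pointwise limit, as $n\to\infty$, of the functions $(t,\mu)\mapsto f_n(t,p_n\mu)$ on $[0,\infty)\times\mathcal C$. **Proposition.** Suppose that $\xi:\mathbb R^{D\times D}\to\mathbb R$ is locally Lipschitz with proper restriction to $S^D_+$, and that $\psi:\mathcal C\to\mathbb R$ is $\mathcal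 C^*$-increasing and satisfies $|\psi(\mu)-\psi(\nu)|\le\int_0^1|\mu(s)-\nu(s)|\,ds$ for all $\mu,\nu\in\mathcal C$. Then (1) has a unique Lipschitz viscosity solution $f$ with $f(0,\cdot)=\psi$. Moreover, for every regularization $\bar\xi$ of $\xi$, the functions $f_n$ exist and are unique, the limit solution of (1) with initial condition $\psi$ exists, and it is equal to $f$ on $[0,\infty)\times\mathcal C$. -/

import Mathlib

open Set Filter Topology MeasureTheory Asymptotics

namespace SpinHJ

/-! ### Hamilton-Jacobi equations on subsets of a Hilbert space -/

section General

variable {E : Type*} [NormedAddCommGroup E] [InnerProductSpace ℝ E]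

/-- `g` is increasing over `S` in the directions of the cone `K`. -/
def IncreasingAlong (K S : Set E) (g : E → ℝ) : Prop :=
  ∀ x ∈ S, ∀ y ∈ S, x - y ∈ K → g y ≤ g x

/-- The dual cone `{x | ⟪x, y⟫ ≥ 0 for all y ∈ C}`. -/
def dualCone (C : Set E) : Set E := {x | ∀ y ∈ C, 0 ≤ inner ℝ x y}

/-- `φ : (0,∞) × S → ℝ` is smooth, with time derivative `φt` and spatial gradient `φx`: at every
point the first-order expansion relative to `(0,∞) × S` holds with a quadratic remainder, and the
differential is continuous. When `S` is a convex cone with dense span, or an open set, `φ`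
determines `(φt, φx)` on `(0,∞) × S`. -/
structure IsSmoothTest (S : Set E) (φ φt : ℝ × E → ℝ) (φx : ℝ × E → E) : Prop where
  expansion : ∀ p ∈ Ioi (0 : ℝ) ×ˢ S,
    (fun q : ℝ × E =>
      φ q - φ p - (φt p * (q.1 - p.1) + inner ℝ (φx p) (q.2 - p.2)))
      =O[𝓝[Ioi (0 : ℝ) ×ˢ S] p] (fun q : ℝ × E => |q.1 - p.1| ^ 2 + ‖q.2 - p.2‖ ^ 2)
  continuousOn : ContinuousOn (fun p => (φt p, φx p)) (Ioi (0 : ℝ) ×ˢ S)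

/-- Viscosity subsolutions of `∂ₜ f - H(∇ f) = 0` on `[0,∞) × S`. -/
def IsViscSub (S : Set E) (H : E → ℝ) (f : ℝ × E → ℝ) : Prop :=
  ContinuousOn f (Ici (0 : ℝ) ×ˢ S) ∧
  ∀ p ∈ Ioi (0 : ℝ) ×ˢ S, ∀ (φ φt : ℝ × E → ℝ) (φx : ℝ × E → E), IsSmoothTest S φ φt φx →
    IsLocalMaxOn (fun q => f q - φ q) (Ioi (0 : ℝ) ×ˢ S) p → φt p - H (φx p) ≤ 0

/-- Viscosity supersolutions of `∂ₜ f - H(∇ f) = 0` on `[0,∞) × S`. -/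
def IsViscSuper (S : Set E) (H : E → ℝ) (f : ℝ × E → ℝ) : Prop :=
  ContinuousOn f (Ici (0 : ℝ) ×ˢ S) ∧
  ∀ p ∈ Ioi (0 : ℝ) ×ˢ S, ∀ (φ φt : ℝ × E → ℝ) (φx : ℝ × E → E), IsSmoothTest S φ φt φx →
    IsLocalMinOn (fun q => f q - φ q) (Ioi (0 : ℝ) ×ˢ S) p → 0 ≤ φt p - H (φx p)

/-- The unit outer normals to the convex set `C` at `x`. -/
def outerNormals (C : Set E) (x : E) : Set E :=
  {ν | ‖ν‖ = 1 ∧ ∀ y ∈ C, inner ℝ ν (y - x) ≤ 0}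

/-- Viscosity subsolutions of the Neumann problem `∂ₜ f - F(∇ f) = 0` in `(0,∞) × int C`,
`n · ∇ f = 0` on `(0,∞) × ∂C`. -/
def IsNeumannSub (C : Set E) (F : E → ℝ) (f : ℝ × E → ℝ) : Prop :=
  ContinuousOn f (Ici (0 : ℝ) ×ˢ C) ∧
  ∀ p ∈ Ioi (0 : ℝ) ×ˢ C, ∀ (φ φt : ℝ × E → ℝ) (φx : ℝ × E → E), IsSmoothTest C φ φt φx →
    IsLocalMaxOn (fun q => f q - φ q) (Ioi (0 : ℝ) ×ˢ C) p →
      (p.2 ∈ interior C → φt p - F (φx p) ≤ 0) ∧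
      (p.2 ∈ frontier C →
        (∃ ν ∈ outerNormals C p.2, inner ℝ ν (φx p) ≤ 0) ∨ φt p - F (φx p) ≤ 0)

/-- Viscosity supersolutions of the Neumann problem `∂ₜ f - F(∇ f) = 0` in `(0,∞) × int C`,
`n · ∇ f = 0` on `(0,∞) × ∂C`. -/
def IsNeumannSuper (C : Set E) (F : E → ℝ) (f : ℝ × E → ℝ) : Prop :=
  ContinuousOn f (Ici (0 : ℝ) ×ˢ C) ∧
  ∀ p ∈ Ioi (0 : ℝ) ×ˢ C, ∀ (φ φt : ℝ × E → ℝ) (φx : ℝ × E → E), IsSmoothTest C φ φt φx →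
    IsLocalMinOn (fun q => f q - φ q) (Ioi (0 : ℝ) ×ˢ C) p →
      (p.2 ∈ interior C → 0 ≤ φt p - F (φx p)) ∧
      (p.2 ∈ frontier C →
        (∃ ν ∈ outerNormals C p.2, 0 ≤ inner ℝ ν (φx p)) ∨ 0 ≤ φt p - F (φx p))

/-- `f` is Lipschitz on `[0,∞) × S`. -/
def IsLipOn (S : Set E) (f : ℝ × E → ℝ) : Prop :=
  ∃ L : NNReal, LipschitzOnWith L f (Ici (0 : ℝ) ×ˢ S)

end General

/-! ### Symmetric matrices -/

/-- The space of real `D × D` matrices, with the Euclidean (Frobenius) structure. -/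
abbrev Mat (D : ℕ) : Type := EuclideanSpace ℝ (Fin D × Fin D)

/-- The subspace of symmetric matrices. -/
def symSubmodule (D : ℕ) : Submodule ℝ (Mat D) where
  carrier := {a | ∀ i k, a (i, k) = a (k, i)}
  add_mem' := by
    intro a b ha hb i k
    simp [ha i k, hb i k]
  zero_mem' := by
    intro i k
    simp
  smul_mem' := by
    intro c a ha i k
    simp [ha i k]

/-- Symmetric matrices; the inner product is `∑ aᵢₖ bᵢₖ = tr (a b)`. -/
abbrev SymMat (D : ℕ) : Type := ↥(symSubmodule D)

/-- The cone of positive semidefinite matrices. -/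
def psd (D : ℕ) : Set (SymMat D) :=
  {a | (Matrix.of fun i k => (a : Mat D) (i, k)).PosSemidef}

/-- `g` (on positive semidefinite matrices) is proper: `g` and all its increments
`a ↦ g (a + b) - g a`, `b` positive semidefinite, are increasing. -/
def IsProperFn (D : ℕ) (g : SymMat D → ℝ) : Prop :=
  IncreasingAlong (psd D) (psd D) g ∧
  ∀ b ∈ psd D, IncreasingAlong (psd D) (psd D) (fun a => g (a + b) - g a)

/-- `ξb` (only its values on positive semidefinite matrices matter) is a regularization of `ξ`. -/
structure IsRegularization {D : ℕ} (ξ : Mat D → ℝ) (ξb : SymMat D → ℝ) : Prop where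
  coincide : ∀ a ∈ psd D, ‖a‖ ≤ 1 → ξb a = ξ a
  lipschitz : ∃ L : NNReal, LipschitzOnWith L ξb (psd D)
  proper : IsProperFn D ξb
  convex : ConvexOn ℝ (psd D) (fun a => ξ a) → ConvexOn ℝ (psd D) ξb

/-! ### The infinite-dimensional equation -/

/-- The Hilbert space `L²([0,1); S^D)`. -/
abbrev PathSpace (D : ℕ) : Type :=
  Lp (SymMat D) 2 ((volume : Measure ℝ).restrict (Ico (0 : ℝ) 1))

/-- The cone of classes of square-integrable, increasing, right-continuous with left limits paths
`[0,1) → S^D₊`. -/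
def pathCone (D : ℕ) : Set (PathSpace D) :=
  {κ | ∃ μ : ℝ → SymMat D,
    (∀ s ∈ Ico (0 : ℝ) 1, μ s ∈ psd D) ∧
    (∀ s ∈ Ico (0 : ℝ) 1, ∀ t ∈ Ico (0 : ℝ) 1, s ≤ t → μ t - μ s ∈ psd D) ∧
    (∀ t ∈ Ico (0 : ℝ) 1, ContinuousWithinAt μ (Ici t) t) ∧
    (∀ t ∈ Ioo (0 : ℝ) 1, ∃ l, Tendsto μ (𝓝[<] t) (𝓝 l)) ∧
    κ =ᵐ[(volume : Measure ℝ).restrict (Ico (0 : ℝ) 1)] μ}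

/-- The nonlinearity `κ ↦ inf {∫₀¹ ξb(μ(s)) ds | μ ∈ C ∩ (κ + C^*)}`. -/
noncomputable def pathNonlin {D : ℕ} (ξb : SymMat D → ℝ) (κ : PathSpace D) : ℝ :=
  sInf ((fun μ : PathSpace D => ∫ s in Ico (0 : ℝ) 1, ξb (μ s)) ''
    {μ | μ ∈ pathCone D ∧ μ - κ ∈ dualCone (pathCone D)})

/-- `f` is a viscosity solution of `∂ₜ f - ∫ ξ(∇ f) = 0` on `[0,∞) × C`: it is a subsolution for
some regularization of `ξ`, and a supersolution for some regularization of `ξ`. -/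
def IsViscSol {D : ℕ} (ξ : Mat D → ℝ) (f : ℝ × PathSpace D → ℝ) : Prop :=
  (∃ ξb : SymMat D → ℝ, IsRegularization ξ ξb ∧ IsViscSub (pathCone D) (pathNonlin ξb) f) ∧
  (∃ ξb : SymMat D → ℝ, IsRegularization ξ ξb ∧ IsViscSuper (pathCone D) (pathNonlin ξb) f)

/-- Lipschitz viscosity solutions with initial condition `ψ`. -/
def IsLipViscSol {D : ℕ} (ξ : Mat D → ℝ) (ψ : PathSpace D → ℝ) (f : ℝ × PathSpace D → ℝ) : Prop :=
  IsViscSol ξ f ∧ IsLipOn (pathCone D) f ∧ ∀ μ ∈ pathCone D, f (0, μ) = ψ μ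

/-! ### Finite-dimensional approximations along the uniform partitions -/

/-- The space `(S^D)^n` attached to the uniform partition of `[0,1)` into `n` intervals. -/
def StepSpace (D : ℕ) (n : ℕ+) : Type := Fin n → SymMat D

noncomputable instance (D : ℕ) (n : ℕ+) : AddCommGroup (StepSpace D n) :=
  inferInstanceAs (AddCommGroup (Fin n → SymMat D))

noncomputable instance (D : ℕ) (n : ℕ+) : Module ℝ (StepSpace D n) :=
  inferInstanceAs (Module ℝ (Fin n → SymMat D))

/-- The inner product `⟪x, y⟫ = ∑ₖ (1/n) xₖ · yₖ`. -/
@[reducible]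
noncomputable def stepCore (D : ℕ) (n : ℕ+) : InnerProductSpace.Core ℝ (StepSpace D n) where
  inner x y := ∑ k : Fin n, (1 / (n : ℝ)) * inner ℝ (x k) (y k)
  conj_inner_symm x y := by
    simp [real_inner_comm]
  re_inner_nonneg x := by
    simp only [RCLike.re_to_real]
    exact Finset.sum_nonneg fun k _ => mul_nonneg (by positivity) real_inner_self_nonneg
  add_left x y z := by
    rw [← Finset.sum_add_distrib]
    refine Finset.sum_congr rfl fun k _ => ?_
    rw [← mul_add, ← inner_add_left]
    rfl
  smul_left x y r := by
    rw [Finset.mul_sum]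
    refine Finset.sum_congr rfl fun k _ => ?_
    have h : inner ℝ ((r • x) k) (y k) = r * inner ℝ (x k) (y k) :=
      real_inner_smul_left (x k) (y k) r
    rw [h]
    simp only [conj_trivial]
    ring
  definite x hx := by
    funext k
    have hn : (0 : ℝ) < 1 / (n : ℝ) := by
      have : (0 : ℝ) < (n : ℝ) := by exact_mod_cast n.pos
      positivity
    have h0 := (Finset.sum_eq_zero_iff_of_nonneg
      (fun k _ => mul_nonneg hn.le (real_inner_self_nonneg (x := x k)))).1 hx k (Finset.mem_univ k)
    rcases mul_eq_zero.1 h0 with h | h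
    · exact absurd h hn.ne'
    · exact inner_self_eq_zero.1 h

noncomputable instance (D : ℕ) (n : ℕ+) : NormedAddCommGroup (StepSpace D n) :=
  (stepCore D n).toNormedAddCommGroup

noncomputable instance (D : ℕ) (n : ℕ+) : InnerProductSpace ℝ (StepSpace D n) :=
  InnerProductSpace.ofCore (stepCore D n).toCore

/-- The cone `{0 ≤ x₁ ≤ ⋯ ≤ xₙ}`. -/
def stepCone (D : ℕ) (n : ℕ+) : Set (StepSpace D n) :=
  {x | (∀ k, x k ∈ psd D) ∧ ∀ i k, i ≤ k → x k - x i ∈ psd D}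

/-- The `k`-th interval `[k/n, (k+1)/n)` of the uniform partition, `0 ≤ k < n`. -/
def cell (n : ℕ+) (k : Fin n) : Set ℝ :=
  Ico (((k : ℕ) : ℝ) / (n : ℝ)) ((((k : ℕ) : ℝ) + 1) / (n : ℝ))

/-- Projection: the averages of `κ` over the intervals of the partition. -/
noncomputable def stepProj {D : ℕ} (n : ℕ+) (κ : PathSpace D) : StepSpace D n :=
  fun k => (n : ℝ) • ∫ s in cell n k, κ s

/-- Lift: the step function with the values `x`. -/
noncomputable def stepLift {D : ℕ} (n : ℕ+) (x : StepSpace D n) : PathSpace D :=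
  ∑ k : Fin n, indicatorConstLp 2 (s := cell n k) measurableSet_Ico (measure_ne_top _ _) (x k)

/-- The nonlinearity `b ↦ inf {∑ₖ (1/n) ξb(aₖ) | a ∈ Cⁿ ∩ (b + (Cⁿ)^*)}`. -/
noncomputable def stepNonlin {D : ℕ} (ξb : SymMat D → ℝ) (n : ℕ+) (b : StepSpace D n) : ℝ :=
  sInf ((fun a : StepSpace D n => ∑ k : Fin n, (1 / (n : ℝ)) * ξb (a k)) ''
    {a | a ∈ stepCone D n ∧ a - b ∈ dualCone (stepCone D n)})

/-- Lipschitz viscosity solutions of the Neumann problem on `Cⁿ` with nonlinearity `stepNonlin`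
and initial condition the projection of `ψ`. -/
def IsNeumannSol {D : ℕ} (ξb : SymMat D → ℝ) (ψ : PathSpace D → ℝ) (n : ℕ+)
    (u : ℝ × StepSpace D n → ℝ) : Prop :=
  IsNeumannSub (stepCone D n) (stepNonlin ξb n) u ∧
  IsNeumannSuper (stepCone D n) (stepNonlin ξb n) u ∧
  IsLipOn (stepCone D n) u ∧
  ∀ x ∈ stepCone D n, u (0, x) = ψ (stepLift n x)

/-- `f` is the pointwise limit on `[0,∞) × C` of the lifts `(t, μ) ↦ uₙ (t, pₙ μ)` of the
finite-dimensional Neumann solutions `uₙ`. -/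
def IsNeumannLimit {D : ℕ} (ξb : SymMat D → ℝ) (ψ : PathSpace D → ℝ)
    (f : ℝ × PathSpace D → ℝ) : Prop :=
  ∃ u : (n : ℕ+) → ℝ × StepSpace D n → ℝ, (∀ n, IsNeumannSol ξb ψ n (u n)) ∧
    ∀ t : ℝ, 0 ≤ t → ∀ μ ∈ pathCone D,
      Tendsto (fun n : ℕ+ => u n (t, stepProj n μ)) atTop (𝓝 (f (t, μ)))

end SpinHJ

open SpinHJ

/-! The proof rests on one property of the nonlinearity `H = pathNonlin ξb` and of its
finite-dimensional analogues (`IsConeFunctional.isGame`): for all `q, q'` there is `z` in the cone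
`C` with `‖z‖ ≤ L` and `H q - H q' ≤ ⟪z, q - q'⟫`. Information thus travels only along directions of
`C`, and a trajectory started in `C` never leaves it. This is why no boundary condition is needed.

Existence. The property makes the equation the Isaacs equation of a differential game: at each step
one player picks a gradient `q`, the other answers with a velocity `z ∈ C`, and the running gain is
`H q - ⟪z, q⟫`. In finite dimension, limits of the discrete-time values satisfy the viscosity
inequalities up to the boundary (`IsApprox.le_of_isLocalMaxOn`), so they solve the equation on the
closed cone and, a fortiori, the Neumann problem.

Uniqueness. Variables are doubled on a closed convex set, a smooth variational principle replacing
compactness (`add_nonpos_of_isSubAdm`). In the Neumann case the quadratic penalties are centred at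
points of the cone, one of them at an interior point, so the test gradients have positive product
with every outer normal and the boundary alternative never occurs.

From steps to paths. Averaging `pₙ` is adjoint to the lift `lₙ`, maps moves to moves, and `H ∘ lₙ`
is the nonlinearity on step functions (`pathNonlin_stepLift`). Strategies can therefore be
transferred. The first player gives the lower bound of the path value by the lower step value. The
second gives the upper bound by the upper step value, with error of order `n^(-1/2)`, the `L¹`
distance between an increasing path and its averages. The lower and upper step values agree by
comparison. The initial conditions are ordered because `μ - lₙ pₙ μ ∈ C^*`, which is Chebyshev's
inequality on each cell. The path value is then the limit of the Neumann solutions, and the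
viscosity inequalities pass to this limit (`le_of_isLocalMaxOn_of_approx`).

Independence of the regularization. The initial condition on step functions extends to the whole
space as a function that is `C^*`-increasing and 1-Lipschitz for the `L¹` norm. The game commutes
with translations, so its value inherits both properties. Gradients of test functions touching it
then lie in the cone with coordinates of norm at most 1, where only `ξ` itself is seen
(`stepValue_congr`). Hence a sub- and a supersolution for different regularizations can be compared
with the same function. -/

namespace SpinHJ

/-! ### Closed convex cones and nonlinearities with increments along the cone -/

section Cones

variable {E : Type*} [NormedAddCommGroup E] [InnerProductSpace ℝ E]

/-- Closed convex cones. -/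
structure IsClosedCone (C : Set E) : Prop where
  closed : IsClosed C
  zero_mem : (0 : E) ∈ C
  add_mem : ∀ x ∈ C, ∀ y ∈ C, x + y ∈ C
  smul_mem : ∀ a : ℝ, 0 ≤ a → ∀ x ∈ C, a • x ∈ C

theorem IsClosedCone.convex {C : Set E} (hC : IsClosedCone C) : Convex ℝ C := by
  intro x hx y hy a b ha hb _
  exact hC.add_mem _ (hC.smul_mem a ha x hx) _ (hC.smul_mem b hb y hy)

theorem dualCone_add {C : Set E} {x y : E} (hx : x ∈ dualCone C) (hy : y ∈ dualCone C) :
    x + y ∈ dualCone C := fun z hz => by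
  rw [inner_add_left]; exact add_nonneg (hx z hz) (hy z hz)

theorem dualCone_smul {C : Set E} {x : E} (hx : x ∈ dualCone C) {a : ℝ} (ha : 0 ≤ a) :
    a • x ∈ dualCone C := fun z hz => by
  rw [real_inner_smul_left]; exact mul_nonneg ha (hx z hz)

theorem dualCone_zero (C : Set E) : (0 : E) ∈ dualCone C := fun z _ => by simp

/-- Moreau's decomposition. -/
theorem IsClosedCone.exists_proj [CompleteSpace E] {C : Set E} (hC : IsClosedCone C) (w : E) :
    ∃ r ∈ C, r - w ∈ dualCone C ∧ inner ℝ r (r - w) = 0 := by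
  obtain ⟨v, hv, hmin⟩ :=
    exists_norm_eq_iInf_of_complete_convex ⟨0, hC.zero_mem⟩ hC.closed.isComplete hC.convex w
  rw [norm_eq_iInf_iff_real_inner_le_zero hC.convex hv] at hmin
  -- The variational inequality of the projection, tested at `v + y`, gives membership in the dual
  -- cone; tested at `0`, it gives orthogonality.
  have h1 : v - w ∈ dualCone C := fun y hy => by
    have := hmin (v + y) (hC.add_mem v hv y hy)
    rw [add_sub_cancel_left, ← neg_sub, inner_neg_left] at this
    linarith
  refine ⟨v, hv, h1, ?_⟩
  have h2 := hmin 0 hC.zero_mem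
  have h3 := h1 v hv
  rw [zero_sub, ← neg_sub, inner_neg_neg] at h2
  rw [real_inner_comm]
  linarith

/-- Bipolar theorem. The remainder `r - w` of Moreau's decomposition lies in the dual cone and is
orthogonal to `r`, so pairing it with `w` gives `-‖r - w‖ ^ 2 ≥ 0`. -/
theorem IsClosedCone.mem_of_forall_dualCone [CompleteSpace E] {C : Set E} (hC : IsClosedCone C)
    {w : E} (hw : ∀ c ∈ dualCone C, 0 ≤ inner ℝ w c) : w ∈ C := by
  obtain ⟨r, hr, hd, h0⟩ := hC.exists_proj w
  have h1 := hw _ hd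
  have h2 : inner ℝ (r - w) (r - w) ≤ 0 := by
    rw [inner_sub_left, h0]; linarith
  have h3 : r - w = 0 := by
    rw [real_inner_self_eq_norm_sq] at h2
    exact norm_eq_zero.1 (pow_eq_zero_iff two_ne_zero |>.1 (le_antisymm h2 (sq_nonneg _)))
  rwa [← sub_eq_zero.1 h3]

/-- The lower extension of `G`, a function on the cone `C`, to the whole space. -/
noncomputable def coneExt (C : Set E) (G : E → ℝ) (κ : E) : ℝ :=
  sInf (G '' {μ | μ ∈ C ∧ μ - κ ∈ dualCone C})

/-- The properties of the functionals `μ ↦ ∫ ξ(μ)` which matter for their extension. -/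
structure IsConeFunctional (C : Set E) (G : E → ℝ) (L : NNReal) : Prop where
  selfDual : C ⊆ dualCone C
  lipschitz : LipschitzOnWith L G C
  increasing : IncreasingAlong (dualCone C) C G

variable {C : Set E} {G : E → ℝ} {L : NNReal}

theorem IsConeFunctional.le_of_mem (hG : IsConeFunctional C G L) (hC : IsClosedCone C)
    {μ : E} (hμ : μ ∈ C) : G 0 ≤ G μ :=
  hG.increasing μ hμ 0 hC.zero_mem (by simpa using hG.selfDual hμ)

theorem IsConeFunctional.bddBelow (hG : IsConeFunctional C G L) (hC : IsClosedCone C) (κ : E) :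
    BddBelow (G '' {μ | μ ∈ C ∧ μ - κ ∈ dualCone C}) := by
  refine ⟨G 0, ?_⟩
  rintro _ ⟨μ, hμ, rfl⟩
  exact hG.le_of_mem hC hμ.1

theorem IsConeFunctional.coneExt_le (hG : IsConeFunctional C G L) (hC : IsClosedCone C)
    {κ μ : E} (hμ : μ ∈ C) (h : μ - κ ∈ dualCone C) : coneExt C G κ ≤ G μ :=
  csInf_le (hG.bddBelow hC κ) ⟨μ, ⟨hμ, h⟩, rfl⟩

theorem le_coneExt [CompleteSpace E] (hC : IsClosedCone C) {κ : E} {c : ℝ}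
    (h : ∀ μ ∈ C, μ - κ ∈ dualCone C → c ≤ G μ) : c ≤ coneExt C G κ := by
  obtain ⟨r, hr, hd, -⟩ := hC.exists_proj κ
  refine le_csInf ⟨_, r, ⟨hr, hd⟩, rfl⟩ ?_
  rintro _ ⟨μ, hμ, rfl⟩
  exact h μ hμ.1 hμ.2

theorem IsConeFunctional.coneExt_eq [CompleteSpace E] (hG : IsConeFunctional C G L)
    (hC : IsClosedCone C) {κ : E} (hκ : κ ∈ C) : coneExt C G κ = G κ := by
  apply le_antisymm
  · exact hG.coneExt_le hC hκ (by simpa using dualCone_zero C)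
  · exact le_coneExt hC fun μ hμ h => hG.increasing μ hμ κ hκ h

/-- The main property of the nonlinearity: its increments are controlled by directions in `Z`. -/
structure IsGame (F : E → ℝ) (Z : Set E) (L : NNReal) : Prop where
  bound : ∀ z ∈ Z, ‖z‖ ≤ L
  key : ∀ q q', ∃ z ∈ Z, F q - F q' ≤ inner ℝ z (q - q')

/-- With `r` the projection of `q - q'` on the cone, `μ + r` is a competitor for `q` whenever `μ` is
one for `q'`, and it costs at most `L * ‖r‖` more. Since `⟪r, q - q'⟫ = ‖r‖ ^ 2`, this excess is the
product of `q - q'` with the vector of norm `L` in the direction of `r`. -/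
theorem IsConeFunctional.isGame [CompleteSpace E] (hG : IsConeFunctional C G L)
    (hC : IsClosedCone C) : IsGame (coneExt C G) (C ∩ {z | ‖z‖ ≤ L}) L := by
  refine ⟨fun z hz => hz.2, fun q q' => ?_⟩
  obtain ⟨r, hr, hd, h0⟩ := hC.exists_proj (q - q')
  have h1 : inner ℝ r (q - q') = ‖r‖ ^ 2 := by
    rw [inner_sub_right, sub_eq_zero] at h0
    rw [← h0, real_inner_self_eq_norm_sq]
  have h2 : coneExt C G q - L * ‖r‖ ≤ coneExt C G q' := by
    refine le_coneExt hC fun μ hμ hμq => ?_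
    have h3 := hG.coneExt_le hC (κ := q) (hC.add_mem μ hμ r hr) (by
      have := dualCone_add hμq hd
      convert this using 1
      abel)
    have h4 := hG.lipschitz.dist_le_mul _ (hC.add_mem μ hμ r hr) _ hμ
    rw [Real.dist_eq, dist_eq_norm, add_sub_cancel_left] at h4
    linarith [le_abs_self (G (μ + r) - G μ)]
  by_cases hr0 : ‖r‖ = 0
  · refine ⟨0, ⟨hC.zero_mem, by simp⟩, ?_⟩
    rw [hr0] at h2
    simp only [inner_zero_left]
    linarith
  · refine ⟨(L / ‖r‖) • r, ⟨hC.smul_mem _ (by positivity) r hr, ?_⟩, ?_⟩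
    · simp only [mem_ofPred_eq, norm_smul, norm_div, norm_norm]
      rw [div_mul_cancel₀ _ hr0]; simp
    · rw [real_inner_smul_left, h1]
      have : (L : ℝ) / ‖r‖ * ‖r‖ ^ 2 = L * ‖r‖ := by field_simp
      linarith

theorem IsGame.abs_apply_sub_le {F : E → ℝ} {Z : Set E} (h : IsGame F Z L) (q q' : E) :
    |F q - F q'| ≤ L * ‖q - q'‖ := by
  have key : ∀ q q', F q - F q' ≤ L * ‖q - q'‖ := fun q q' => by
    obtain ⟨z, hz, h1⟩ := h.key q q'
    exact h1.trans ((real_inner_le_norm _ _).trans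
      (mul_le_mul_of_nonneg_right (h.bound z hz) (norm_nonneg _)))
  rw [abs_sub_le_iff]
  exact ⟨key q q', by rw [norm_sub_rev]; exact key q' q⟩

/-- The nonlinearity of the equation satisfied by `-f` when `f` solves the one of `F`. -/
def reflect (F : E → ℝ) (q : E) : ℝ := -F (-q)

theorem reflect_reflect (F : E → ℝ) : reflect (reflect F) = F := by
  funext q; simp [reflect]

/-- The same directions serve after reflection; results on subsolutions thus transfer to
supersolutions. -/
theorem IsGame.reflected {F : E → ℝ} {Z : Set E} (h : IsGame F Z L) : IsGame (reflect F) Z L := by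
  refine ⟨h.bound, fun q q' => ?_⟩
  obtain ⟨z, hz, h1⟩ := h.key (-q') (-q)
  refine ⟨z, hz, ?_⟩
  rw [neg_sub_neg] at h1
  simp only [reflect]
  linarith

end Cones

/-! ### A smooth variational principle -/

section Variational

variable {W : Type*} [NormedAddCommGroup W] [InnerProductSpace ℝ W]

theorem convex_comb_sq (y a x : W) (t : ℝ) :
    (1 - t) * ‖y - a‖ ^ 2 + t * ‖y - x‖ ^ 2
      = ‖y - (a + t • (x - a))‖ ^ 2 + t * (1 - t) * ‖x - a‖ ^ 2 := by
  have h1 : y - x = (y - a) - (x - a) := by abel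
  have h2 : y - (a + t • (x - a)) = (y - a) - t • (x - a) := by abel
  rw [h1, h2, norm_sub_sq_real (y - a) (x - a), norm_sub_sq_real (y - a) (t • (x - a)),
    real_inner_smul_right, norm_smul, mul_pow, Real.norm_eq_abs, sq_abs]
  ring

/-- A smooth variational principle: up to a small quadratic perturbation, a continuous function
which is bounded above on a closed convex set attains its maximum. -/
theorem exists_max_sub_sq [CompleteSpace W] {X : Set W} (hXc : IsClosed X) (hX : Convex ℝ X)
    (hne : X.Nonempty) {G : W → ℝ} (hG : ContinuousOn G X) {B : ℝ} (hB : ∀ x ∈ X, G x ≤ B)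
    {η : ℝ} (hη : 0 < η) :
    ∃ a ∈ X, ∃ x ∈ X, ‖x - a‖ ≤ 1 ∧
      (∀ y ∈ X, G y - η * ‖y - a‖ ^ 2 ≤ G x - η * ‖x - a‖ ^ 2) ∧ ∀ y ∈ X, G y ≤ G x + 2 * η := by
  have near : ∀ (f : W → ℝ) (ε : ℝ), 0 < ε → (∀ y ∈ X, f y ≤ B) →
      ∃ x ∈ X, ∀ y ∈ X, f y ≤ f x + ε := by
    intro f ε hε hf
    have hbdd : BddAbove (f '' X) := ⟨B, by rintro _ ⟨y, hy, rfl⟩; exact hf y hy⟩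
    obtain ⟨_, ⟨x, hx, rfl⟩, h⟩ := exists_lt_of_lt_csSup (hne.image f)
      (show sSup (f '' X) - ε < sSup (f '' X) by linarith)
    exact ⟨x, hx, fun y hy => by linarith [le_csSup hbdd ⟨y, hy, rfl⟩]⟩
  obtain ⟨a0, ha0, hmax0⟩ := near G (η / 64) (by positivity) hB
  -- The penalty weights `lam k` increase from `η / 2` to `η` with increments `del k`. The
  -- tolerances `eps k` are small enough that near-maximizers of consecutive penalized functions are
  -- within `(1 / 8) * (1 / 2) ^ k`.
  set lam : ℕ → ℝ := fun k => η * (1 - (1 / 2) ^ (k + 1)) with hlam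
  set del : ℕ → ℝ := fun k => η * (1 / 2) ^ (k + 2) with hdel
  set eps : ℕ → ℝ := fun k => η / 512 * (1 / 8) ^ k with heps
  have hpow : ∀ k : ℕ, (0 : ℝ) < (1 / 2) ^ k := fun k => by positivity
  have hpow1 : ∀ k : ℕ, ((1 : ℝ) / 2) ^ k ≤ 1 := fun k => pow_le_one₀ (by norm_num) (by norm_num)
  have hlam_nonneg : ∀ k, η / 2 ≤ lam k := fun k => by
    have : ((1 : ℝ) / 2) ^ (k + 1) ≤ 1 / 2 := by
      rw [pow_succ]; nlinarith [hpow1 k]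
    simp only [hlam]; nlinarith
  have hlam_le : ∀ k, lam k ≤ η := fun k => by
    simp only [hlam]; nlinarith [hpow (k + 1)]
  have hdel_pos : ∀ k, 0 < del k := fun k => by simp only [hdel]; positivity
  have heps_pos : ∀ k, 0 < eps k := fun k => by simp only [heps]; positivity
  have hlam_succ : ∀ k, lam (k + 1) = lam k + del k := fun k => by
    simp only [hlam, hdel]; ring
  have hnear : ∀ (k : ℕ) (a : W), ∃ x ∈ X, ∀ y ∈ X,
      G y - lam k * ‖y - a‖ ^ 2 ≤ G x - lam k * ‖x - a‖ ^ 2 + eps k := fun k a =>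
    near (fun y => G y - lam k * ‖y - a‖ ^ 2) (eps k) (heps_pos k) fun y hy => by
      have : 0 ≤ lam k * ‖y - a‖ ^ 2 := mul_nonneg (by linarith [hlam_nonneg k]) (by positivity)
      linarith [hB y hy]
  choose nm hnmX hnm using hnear
  -- The next centre is the barycentre of `a k` and `x k` with weights `lam k` and `del k`. Adding
  -- the penalty `del k * ‖y - x k‖ ^ 2` then produces again a single quadratic, up to a constant.
  set th : ℕ → ℝ := fun k => del k / lam (k + 1) with hth
  let a : ℕ → W := fun k => Nat.rec a0 (fun k b => b + th k • (nm k b - b)) k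
  have ha_succ : ∀ k, a (k + 1) = a k + th k • (nm k (a k) - a k) := fun k => rfl
  set x : ℕ → W := fun k => nm k (a k) with hx
  have hlam_pos : ∀ k, 0 < lam k := fun k => by linarith [hlam_nonneg k]
  have hth0 : ∀ k, 0 ≤ th k := fun k => div_nonneg (hdel_pos k).le (hlam_pos _).le
  have hth1 : ∀ k, th k ≤ 1 := fun k => by
    rw [hth]; exact div_le_one_of_le₀ (by rw [hlam_succ]; linarith [hlam_pos k]) (hlam_pos _).le
  have hxX : ∀ k, x k ∈ X := fun k => hnmX k _
  have haX : ∀ k, a k ∈ X := by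
    intro k
    induction k with
    | zero => exact ha0
    | succ k ih =>
      rw [ha_succ]
      exact hX.add_smul_sub_mem ih (hxX k) ⟨hth0 k, hth1 k⟩
  have hident : ∀ k y, lam k * ‖y - a k‖ ^ 2 + del k * ‖y - x k‖ ^ 2
      = lam (k + 1) * ‖y - a (k + 1)‖ ^ 2
        + lam (k + 1) * (th k * (1 - th k) * ‖x k - a k‖ ^ 2) := fun k y => by
    have h := convex_comb_sq y (a k) (x k) (th k)
    rw [ha_succ, ← mul_add, ← h]
    have h1 : lam (k + 1) * th k = del k := by
      rw [hth]; field_simp [(hlam_pos (k + 1)).ne']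
    have h2 : lam (k + 1) * (1 - th k) = lam k := by
      rw [mul_sub, h1, hlam_succ]; ring
    rw [mul_add, ← mul_assoc, ← mul_assoc, h1, h2]
  -- Near-maximality of `x k` tested at `x (k + 1)`, added to near-maximality of `x (k + 1)` tested
  -- at `x k`, leaves only the increment of the penalty.
  have hstep : ∀ k, ‖x (k + 1) - x k‖ ≤ (1 / 8) * (1 / 2) ^ k := fun k => by
    have h1 := hnm (k + 1) (a (k + 1)) (x k) (hxX k)
    have h2 := hnm k (a k) (x (k + 1)) (hxX (k + 1))
    have h3 := hident k (x k)
    have h4 := hident k (x (k + 1))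
    change _ ≤ G (x (k + 1)) - lam (k + 1) * ‖x (k + 1) - a (k + 1)‖ ^ 2 + _ at h1
    change _ ≤ G (x k) - lam k * ‖x k - a k‖ ^ 2 + _ at h2
    simp only [sub_self, norm_zero] at h3
    have h5 : del k * ‖x (k + 1) - x k‖ ^ 2 ≤ eps k + eps (k + 1) := by linarith
    have h6 : eps k + eps (k + 1) ≤ del k * ((1 / 8) * (1 / 2) ^ k) ^ 2 := by
      simp only [heps, hdel]
      have e8 : ((1 : ℝ) / 8) ^ k = (1 / 2) ^ k * ((1 / 2) ^ k) ^ 2 := by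
        rw [show (1 : ℝ) / 8 = (1 / 2) ^ 3 by norm_num, ← pow_mul, ← pow_mul, ← pow_add]
        congr 1; ring
      rw [pow_succ (1 / 8 : ℝ) k, e8, pow_add]
      have := mul_pos hη (mul_pos (hpow k) (pow_pos (hpow k) 2))
      nlinarith
    have h7 : ‖x (k + 1) - x k‖ ^ 2 ≤ ((1 / 8) * (1 / 2) ^ k) ^ 2 :=
      le_of_mul_le_mul_left (h5.trans h6) (hdel_pos k)
    exact le_of_sq_le_sq h7 (by positivity)
  have hx0 : ‖x 0 - a0‖ ≤ 1 / 4 := by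
    have h1 := hnm 0 a0 a0 ha0
    have h2 := hmax0 (x 0) (hxX 0)
    change _ ≤ G (x 0) - lam 0 * ‖x 0 - a0‖ ^ 2 + _ at h1
    simp only [sub_self, norm_zero] at h1
    have h3 : lam 0 = η / 2 := by simp only [hlam]; ring
    have h4 : eps 0 = η / 512 := by simp only [heps]; ring
    rw [h3, h4] at h1
    have h5 : η * ‖x 0 - a0‖ ^ 2 ≤ η * (1 / 4) ^ 2 := by nlinarith
    exact le_of_sq_le_sq (le_of_mul_le_mul_left h5 hη) (by norm_num)
  have hxk : ∀ k, ‖x k - a0‖ ≤ 1 / 2 - (1 / 4) * (1 / 2) ^ k := by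
    intro k
    induction k with
    | zero => simpa using hx0.trans (by norm_num)
    | succ k ih =>
      have := norm_add_le (x (k + 1) - x k) (x k - a0)
      rw [sub_add_sub_cancel] at this
      rw [pow_succ]
      linarith [hstep k]
  have hxk' : ∀ k, ‖x k - a0‖ ≤ 1 / 2 := fun k => by linarith [hxk k, hpow k]
  have hak : ∀ k, ‖a k - a0‖ ≤ 1 / 2 := by
    intro k
    induction k with
    | zero => simp [a]
    | succ k ih =>
      have := (convex_closedBall a0 (1 / 2)).add_smul_sub_mem
        (mem_closedBall_iff_norm.2 ih) (mem_closedBall_iff_norm.2 (hxk' k)) ⟨hth0 k, hth1 k⟩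
      rw [ha_succ]
      exact mem_closedBall_iff_norm.1 this
  have hxa : ∀ k, ‖x k - a k‖ ≤ 1 := fun k => by
    have := norm_sub_le (x k - a0) (a k - a0)
    rw [sub_sub_sub_cancel_right] at this
    linarith [hxk' k, hak k]
  have hxC : CauchySeq x := cauchySeq_of_le_geometric (1 / 2) (1 / 8) (by norm_num) fun k => by
    rw [dist_comm, dist_eq_norm]; exact hstep k
  have haC : CauchySeq a := cauchySeq_of_le_geometric (1 / 2) 1 (by norm_num) fun k => by
    rw [dist_comm, dist_eq_norm, ha_succ, add_sub_cancel_left, norm_smul, Real.norm_eq_abs,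
      abs_of_nonneg (hth0 k), one_mul]
    refine (mul_le_mul_of_nonneg_left (hxa k) (hth0 k)).trans ?_
    rw [mul_one, hth, div_le_iff₀ (hlam_pos _)]
    simp only [hdel]
    rw [pow_add]
    nlinarith [hlam_nonneg (k + 1), hpow k]
  obtain ⟨xl, hxl⟩ := cauchySeq_tendsto_of_complete hxC
  obtain ⟨al, hal⟩ := cauchySeq_tendsto_of_complete haC
  have hxlX : xl ∈ X := hXc.mem_of_tendsto hxl (Eventually.of_forall hxX)
  have halX : al ∈ X := hXc.mem_of_tendsto hal (Eventually.of_forall haX)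
  have hlamt : Tendsto lam atTop (𝓝 η) := by
    have h : Tendsto (fun k : ℕ => ((1 : ℝ) / 2) ^ (k + 1)) atTop (𝓝 0) :=
      (tendsto_pow_atTop_nhds_zero_of_lt_one (by norm_num) (by norm_num)).comp (tendsto_add_atTop_nat 1)
    have h' := (h.const_sub 1).const_mul η
    rwa [sub_zero, mul_one] at h'
  have hepst : Tendsto eps atTop (𝓝 0) := by
    have h := (tendsto_pow_atTop_nhds_zero_of_lt_one (r := (1 : ℝ) / 8)
      (by norm_num) (by norm_num)).const_mul (η / 512)
    rwa [mul_zero] at h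
  have hGx : Tendsto (fun k => G (x k)) atTop (𝓝 (G xl)) :=
    (hG xl hxlX).tendsto.comp (tendsto_nhdsWithin_iff.2 ⟨hxl, Eventually.of_forall hxX⟩)
  have hmax : ∀ y ∈ X, G y - η * ‖y - al‖ ^ 2 ≤ G xl - η * ‖xl - al‖ ^ 2 := by
    intro y hy
    have h1 : Tendsto (fun k => G y - lam k * ‖y - a k‖ ^ 2) atTop
        (𝓝 (G y - η * ‖y - al‖ ^ 2)) :=
      (hlamt.mul ((hal.const_sub y).norm.pow 2)).const_sub _
    have h2 : Tendsto (fun k => G (x k) - lam k * ‖x k - a k‖ ^ 2 + eps k) atTop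
        (𝓝 (G xl - η * ‖xl - al‖ ^ 2 + 0)) :=
      (hGx.sub (hlamt.mul ((hxl.sub hal).norm.pow 2))).add hepst
    rw [add_zero] at h2
    exact le_of_tendsto_of_tendsto' h1 h2 fun k => hnm k (a k) y hy
  refine ⟨al, halX, xl, hxlX, ?_, hmax, fun y hy => ?_⟩
  · exact le_of_tendsto (hxl.sub hal).norm (Eventually.of_forall hxa)
  · have h1 := hmax a0 ha0
    have h2 : ‖a0 - al‖ ≤ 1 / 2 := by
      rw [norm_sub_rev]
      exact le_of_tendsto (hal.sub_const a0).norm (Eventually.of_forall hak)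
    have h3 := hmax0 y hy
    have h4 : ‖a0 - al‖ ^ 2 ≤ 1 := by nlinarith [norm_nonneg (a0 - al)]
    nlinarith [mul_nonneg hη.le (sq_nonneg ‖xl - al‖), mul_le_mul_of_nonneg_left h4 hη.le]

end Variational

/-! ### Doubling of variables -/

section Comparison

variable {E : Type*} [NormedAddCommGroup E] [InnerProductSpace ℝ E]

/-- Quadratic polynomials are smooth test functions. -/
theorem isSmoothTest_quadratic (S : Set E) (α b c : ℝ) (g : E) :
    IsSmoothTest S (fun q => α * q.1 ^ 2 + b * q.1 + (c * ‖q.2‖ ^ 2 + inner ℝ g q.2))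
      (fun q => 2 * α * q.1 + b) (fun q => (2 * c) • q.2 + g) := by
  refine ⟨fun p _ => ?_, by fun_prop⟩
  refine IsBigO.of_bound (|α| + |c|) (Eventually.of_forall fun q => ?_)
  have h1 : ‖q.2‖ ^ 2 = ‖p.2‖ ^ 2 + 2 * inner ℝ p.2 (q.2 - p.2) + ‖q.2 - p.2‖ ^ 2 := by
    have h := norm_add_sq_real p.2 (q.2 - p.2)
    rwa [add_sub_cancel] at h
  have h2 : α * q.1 ^ 2 + b * q.1 + (c * ‖q.2‖ ^ 2 + inner ℝ g q.2)
      - (α * p.1 ^ 2 + b * p.1 + (c * ‖p.2‖ ^ 2 + inner ℝ g p.2))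
      - ((2 * α * p.1 + b) * (q.1 - p.1) + inner ℝ ((2 * c) • p.2 + g) (q.2 - p.2))
      = α * |q.1 - p.1| ^ 2 + c * ‖q.2 - p.2‖ ^ 2 := by
    rw [inner_add_left, real_inner_smul_left, h1, inner_sub_right g, sq_abs]
    ring
  rw [h2, Real.norm_eq_abs, Real.norm_eq_abs, abs_of_nonneg (by positivity : 0 ≤ |q.1 - p.1| ^ 2 + ‖q.2 - p.2‖ ^ 2)]
  refine (abs_add_le _ _).trans ?_
  rw [abs_mul, abs_mul, abs_of_nonneg (sq_nonneg |q.1 - p.1|), abs_of_nonneg (sq_nonneg ‖q.2 - p.2‖)]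
  nlinarith [abs_nonneg α, abs_nonneg c, sq_nonneg |q.1 - p.1|, sq_nonneg ‖q.2 - p.2‖,
    mul_nonneg (abs_nonneg α) (sq_nonneg ‖q.2 - p.2‖), mul_nonneg (abs_nonneg c) (sq_nonneg |q.1 - p.1|)]

/-- Subsolutions tested only at points where the gradient of the test function is admissible. -/
def IsSubAdm (S : Set E) (N : E → E → Prop) (F : E → ℝ) (u : ℝ × E → ℝ) : Prop :=
  ∀ p ∈ Ioi (0 : ℝ) ×ˢ S, ∀ (φ φt : ℝ × E → ℝ) (φx : ℝ × E → E), IsSmoothTest S φ φt φx →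
    IsLocalMaxOn (fun q => u q - φ q) (Ioi (0 : ℝ) ×ˢ S) p → N p.2 (φx p) → φt p ≤ F (φx p)

theorem IsSmoothTest.neg {S : Set E} {φ φt : ℝ × E → ℝ} {φx : ℝ × E → E}
    (h : IsSmoothTest S φ φt φx) :
    IsSmoothTest S (fun q => -φ q) (fun q => -φt q) (fun q => -φx q) := by
  refine ⟨fun p hp => ?_, ?_⟩
  · refine ((h.expansion p hp).neg_left).congr_left fun q => ?_
    rw [inner_neg_left]; ring
  · exact h.continuousOn.neg

theorem IsViscSub.isSubAdm {S : Set E} {F : E → ℝ} {u : ℝ × E → ℝ} (h : IsViscSub S F u)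
    (N : E → E → Prop) : IsSubAdm S N F u := fun p hp φ φt φx hφ hm _ => by
  linarith [h.2 p hp φ φt φx hφ hm]

theorem IsViscSuper.isSubAdm_neg {S : Set E} {F : E → ℝ} {u : ℝ × E → ℝ} (h : IsViscSuper S F u)
    (N : E → E → Prop) : IsSubAdm S N (reflect F) (fun q => -u q) := fun p hp φ φt φx hφ hm _ => by
  have := h.2 p hp _ _ _ hφ.neg (by
    refine hm.neg.mono fun q hq => ?_
    linarith)
  simp only [reflect]
  linarith

/-- All penalties of the comparison argument are quadratic, so their sum is one admissible test
function. The parameter `k` couples the doubled variables, `γ` penalizes large times, `β` localizes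
in space, and `η` comes from the variational principle. -/
theorem IsSubAdm.sub_of_isMax {S : Set E} {N : E → E → Prop} {F : E → ℝ} {u : ℝ × E → ℝ}
    (h : IsSubAdm S N F u) {k γ β η s a₁ : ℝ} {y e a₂ : E} {p : ℝ × E}
    (hp : p ∈ Ioi (0 : ℝ) ×ˢ S)
    (hmax : ∀ q ∈ Ioi (0 : ℝ) ×ˢ S,
      u q - (k * ((q.1 - s) ^ 2 + ‖q.2 - y‖ ^ 2) + γ * (q.1 + q.1 ^ 2) + β * ‖q.2 - e‖ ^ 2
        + η * ((q.1 - a₁) ^ 2 + ‖q.2 - a₂‖ ^ 2))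
      ≤ u p - (k * ((p.1 - s) ^ 2 + ‖p.2 - y‖ ^ 2) + γ * (p.1 + p.1 ^ 2) + β * ‖p.2 - e‖ ^ 2
        + η * ((p.1 - a₁) ^ 2 + ‖p.2 - a₂‖ ^ 2)))
    (hN : N p.2 ((2 * k) • (p.2 - y) + (2 * η) • (p.2 - a₂) + (2 * β) • (p.2 - e))) :
    2 * k * (p.1 - s) + γ * (1 + 2 * p.1) + 2 * η * (p.1 - a₁)
      ≤ F ((2 * k) • (p.2 - y) + (2 * η) • (p.2 - a₂) + (2 * β) • (p.2 - e)) := by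
  set g : E := -((2 * k) • y + (2 * η) • a₂ + (2 * β) • e) with hg
  have hgrad : ∀ x : E, (2 * k) • (x - y) + (2 * η) • (x - a₂) + (2 * β) • (x - e)
      = (2 * (k + β + η)) • x + g := fun x => by
    rw [hg]; module
  have hval : ∀ q : ℝ × E, k * ((q.1 - s) ^ 2 + ‖q.2 - y‖ ^ 2) + γ * (q.1 + q.1 ^ 2)
      + β * ‖q.2 - e‖ ^ 2 + η * ((q.1 - a₁) ^ 2 + ‖q.2 - a₂‖ ^ 2)
      = ((k + γ + η) * q.1 ^ 2 + (γ - 2 * k * s - 2 * η * a₁) * q.1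
        + ((k + β + η) * ‖q.2‖ ^ 2 + inner ℝ g q.2))
        + (k * (s ^ 2 + ‖y‖ ^ 2) + β * ‖e‖ ^ 2 + η * (a₁ ^ 2 + ‖a₂‖ ^ 2)) := fun q => by
    rw [hg, norm_sub_sq_real, norm_sub_sq_real, norm_sub_sq_real, inner_neg_left, inner_add_left,
      inner_add_left, real_inner_smul_left, real_inner_smul_left, real_inner_smul_left,
      real_inner_comm q.2 y, real_inner_comm q.2 a₂, real_inner_comm q.2 e]
    ring
  have htest := h p hp _ _ _ (isSmoothTest_quadratic S (k + γ + η)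
    (γ - 2 * k * s - 2 * η * a₁) (k + β + η) g) ?_ ?_
  · rw [hgrad]
    refine le_trans (le_of_eq ?_) htest
    ring
  · refine IsMaxOn.localize fun q hq => ?_
    have := hmax q hq
    rw [hval, hval] at this
    simp only [mem_ofPred_eq]
    linarith
  · rw [hgrad] at hN
    exact hN

theorem abs_sub_le_of_lipschitzOnWith {M : NNReal} {u : ℝ × E → ℝ} {T : Set (ℝ × E)}
    (h : LipschitzOnWith M u T) {p q : ℝ × E} (hp : p ∈ T) (hq : q ∈ T) :
    |u p - u q| ≤ M * (|p.1 - q.1| + ‖p.2 - q.2‖) := by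
  have h1 := h.dist_le_mul p hp q hq
  rw [Real.dist_eq, Prod.dist_eq, Real.dist_eq, dist_eq_norm] at h1
  refine h1.trans (mul_le_mul_of_nonneg_left ?_ M.2)
  exact max_le (by linarith [norm_nonneg (p.2 - q.2)]) (by linarith [abs_nonneg (p.1 - q.1)])

/-- The smooth variational principle on `([0,∞) × S)²`. -/
theorem exists_max_sub_sq_prod [CompleteSpace E] {S : Set E} (hSc : IsClosed S) (hS : Convex ℝ S)
    (hne : S.Nonempty) {Φ : ℝ → E → ℝ → E → ℝ}
    (hΦ : ContinuousOn (fun p : (ℝ × E) × ℝ × E => Φ p.1.1 p.1.2 p.2.1 p.2.2)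
      ((Ici (0 : ℝ) ×ˢ S) ×ˢ Ici (0 : ℝ) ×ˢ S)) {B : ℝ}
    (hB : ∀ t x s y, 0 ≤ t → x ∈ S → 0 ≤ s → y ∈ S → Φ t x s y ≤ B) {η : ℝ} (hη : 0 < η) :
    ∃ a₁ a₂ a₃ a₄ t x s y, a₂ ∈ S ∧ a₄ ∈ S ∧ 0 ≤ t ∧ x ∈ S ∧ 0 ≤ s ∧ y ∈ S ∧
      -1 ≤ t - a₁ ∧ ‖x - a₂‖ ≤ 1 ∧ -1 ≤ s - a₃ ∧ ‖y - a₄‖ ≤ 1 ∧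
      (∀ t' x' s' y', 0 ≤ t' → x' ∈ S → 0 ≤ s' → y' ∈ S →
        Φ t' x' s' y' - η * (((t' - a₁) ^ 2 + ‖x' - a₂‖ ^ 2) + ((s' - a₃) ^ 2 + ‖y' - a₄‖ ^ 2))
        ≤ Φ t x s y - η * (((t - a₁) ^ 2 + ‖x - a₂‖ ^ 2) + ((s - a₃) ^ 2 + ‖y - a₄‖ ^ 2))) ∧
      ∀ t' x' s' y', 0 ≤ t' → x' ∈ S → 0 ≤ s' → y' ∈ S →
        Φ t' x' s' y' ≤ Φ t x s y + 2 * η := by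
  -- The `L²` product turns the sum of the four squares into a squared Hilbert norm.
  let W := WithLp 2 (WithLp 2 (ℝ × E) × WithLp 2 (ℝ × E))
  let X : Set W := {p | (0 ≤ p.fst.fst ∧ p.fst.snd ∈ S) ∧ (0 ≤ p.snd.fst ∧ p.snd.snd ∈ S)}
  have c1 : Continuous fun p : W => p.fst.fst := by fun_prop
  have c2 : Continuous fun p : W => p.fst.snd := by fun_prop
  have c3 : Continuous fun p : W => p.snd.fst := by fun_prop
  have c4 : Continuous fun p : W => p.snd.snd := by fun_prop
  have hXc : IsClosed X :=
    ((isClosed_Ici.preimage c1).inter (hSc.preimage c2)).inter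
      ((isClosed_Ici.preimage c3).inter (hSc.preimage c4))
  have hXconv : Convex ℝ X := by
    intro p hp q hq a b ha hb hab
    refine ⟨⟨?_, hS hp.1.2 hq.1.2 ha hb hab⟩, ?_, hS hp.2.2 hq.2.2 ha hb hab⟩
    · exact add_nonneg (mul_nonneg ha hp.1.1) (mul_nonneg hb hq.1.1)
    · exact add_nonneg (mul_nonneg ha hp.2.1) (mul_nonneg hb hq.2.1)
  obtain ⟨z, hz⟩ := hne
  obtain ⟨a, haX, p, hpX, hpa, hmax, hval⟩ := exists_max_sub_sq hXc hXconv
    ⟨WithLp.toLp 2 (WithLp.toLp 2 (0, z), WithLp.toLp 2 (0, z)), ⟨le_rfl, hz⟩, le_rfl, hz⟩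
    (G := fun p : W => Φ p.fst.fst p.fst.snd p.snd.fst p.snd.snd)
    (hΦ.comp ((c1.prodMk c2).prodMk (c3.prodMk c4)).continuousOn
      fun p hp => ⟨⟨hp.1.1, hp.1.2⟩, hp.2.1, hp.2.2⟩)
    (fun p hp => hB _ _ _ _ hp.1.1 hp.1.2 hp.2.1 hp.2.2) hη
  have hnorm : ∀ q : W, ‖q‖ ^ 2 = (q.fst.fst ^ 2 + ‖q.fst.snd‖ ^ 2)
      + (q.snd.fst ^ 2 + ‖q.snd.snd‖ ^ 2) := fun q => by
    rw [WithLp.prod_norm_sq_eq_of_L2, WithLp.prod_norm_sq_eq_of_L2, WithLp.prod_norm_sq_eq_of_L2,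
      Real.norm_eq_abs, Real.norm_eq_abs, sq_abs, sq_abs]
  have hpa2 : ((p.fst.fst - a.fst.fst) ^ 2 + ‖p.fst.snd - a.fst.snd‖ ^ 2)
      + ((p.snd.fst - a.snd.fst) ^ 2 + ‖p.snd.snd - a.snd.snd‖ ^ 2) ≤ 1 := by
    have e1 := hnorm (p - a)
    have e2 : ‖p - a‖ ^ 2 ≤ 1 := pow_le_one₀ (norm_nonneg _) hpa
    rw [e1] at e2
    exact e2
  have q1 := sq_nonneg (p.fst.fst - a.fst.fst)
  have q2 := sq_nonneg ‖p.fst.snd - a.fst.snd‖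
  have q3 := sq_nonneg (p.snd.fst - a.snd.fst)
  have q4 := sq_nonneg ‖p.snd.snd - a.snd.snd‖
  have habs : ∀ r : ℝ, r ^ 2 ≤ 1 → -1 ≤ r := fun r hr => by nlinarith
  have hle1 : ∀ r : ℝ, r ^ 2 ≤ 1 → r ≤ 1 := fun r hr => by nlinarith
  refine ⟨a.fst.fst, a.fst.snd, a.snd.fst, a.snd.snd, p.fst.fst, p.fst.snd, p.snd.fst, p.snd.snd,
    haX.1.2, haX.2.2, hpX.1.1, hpX.1.2, hpX.2.1, hpX.2.2, habs _ (by linarith), hle1 _ (by linarith),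
    habs _ (by linarith), hle1 _ (by linarith), ?_, ?_⟩
  · intro t' x' s' y' ht' hx' hs' hy'
    have e1 := hmax (WithLp.toLp 2 (WithLp.toLp 2 (t', x'), WithLp.toLp 2 (s', y')))
      ⟨⟨ht', hx'⟩, hs', hy'⟩
    rw [hnorm, hnorm] at e1
    exact e1
  · intro t' x' s' y' ht' hx' hs' hy'
    exact hval (WithLp.toLp 2 (WithLp.toLp 2 (t', x'), WithLp.toLp 2 (s', y')))
      ⟨⟨ht', hx'⟩, hs', hy'⟩

/-- Comparison principle. -/
theorem add_nonpos_of_isSubAdm [CompleteSpace E] {S : Set E} (hSc : IsClosed S) (hS : Convex ℝ S)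
    {N : E → E → Prop} {e : E} (he : e ∈ S)
    (hN : ∀ x ∈ S, ∀ y₁ ∈ S, ∀ y₂ ∈ S, ∀ a₁ a₂ b : ℝ, 0 ≤ a₁ → 0 ≤ a₂ → 0 < b →
      N x (a₁ • (x - y₁) + a₂ • (x - y₂) + b • (x - e)))
    {F : E → ℝ} {L : NNReal} (hF : ∀ q q', |F q - F q'| ≤ L * ‖q - q'‖)
    {u w : ℝ × E → ℝ} {M : NNReal}
    (hu : LipschitzOnWith M u (Ici (0 : ℝ) ×ˢ S)) (hw : LipschitzOnWith M w (Ici (0 : ℝ) ×ˢ S))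
    (hus : IsSubAdm S N F u) (hws : IsSubAdm S N (reflect F) w)
    (h0 : ∀ x ∈ S, u (0, x) + w (0, x) ≤ 0) :
    ∀ p ∈ Ici (0 : ℝ) ×ˢ S, u p + w p ≤ 0 := by
  by_contra! hcon
  obtain ⟨⟨tb, xb⟩, ⟨htb, hxb⟩, hpos⟩ := hcon
  simp only [mem_Ici] at htb hxb
  obtain ⟨σ, hσ⟩ : ∃ σ, u (tb, xb) + w (tb, xb) = 4 * σ := ⟨(u (tb, xb) + w (tb, xb)) / 4, by ring⟩
  have hσ0 : 0 < σ := by linarith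
  have hM0 : (0 : ℝ) ≤ M := M.2
  have hL0 : (0 : ℝ) ≤ L := L.2
  have memS : ∀ {t : ℝ} {x : E}, 0 ≤ t → x ∈ S → ((t, x) : ℝ × E) ∈ Ici (0 : ℝ) ×ˢ S :=
    fun ht hx => ⟨ht, hx⟩
  have huL : ∀ {t s : ℝ} {x y : E}, 0 ≤ t → 0 ≤ s → x ∈ S → y ∈ S →
      u (t, x) - u (s, y) ≤ M * (|t - s| + ‖x - y‖) := fun ht hs hx hy =>
    (le_abs_self _).trans (abs_sub_le_of_lipschitzOnWith hu (memS ht hx) (memS hs hy))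
  have hwL : ∀ {t s : ℝ} {x y : E}, 0 ≤ t → 0 ≤ s → x ∈ S → y ∈ S →
      w (t, x) - w (s, y) ≤ M * (|t - s| + ‖x - y‖) := fun ht hs hx hy =>
    (le_abs_self _).trans (abs_sub_le_of_lipschitzOnWith hw (memS ht hx) (memS hs hy))
  obtain ⟨γ, hγ, hγσ⟩ : ∃ γ : ℝ, 0 < γ ∧ γ * (tb + tb ^ 2) ≤ σ := by
    refine ⟨σ / (tb + tb ^ 2 + 1), by positivity, ?_⟩
    rw [div_mul_eq_mul_div, div_le_iff₀ (by positivity)]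
    nlinarith
  -- `M ^ 2 / (2 * A)` is the maximum of `M * (a + b) - A * (a ^ 2 + b ^ 2)`. The coupling `A` only
  -- has to bring it below `σ` and then stays fixed: `F` depends on the gradient alone, so `A` need
  -- not tend to infinity.
  set A : ℝ := ((M : ℝ) ^ 2 + 1) / σ with hA
  have hA0 : 0 < A := by positivity
  have hAσ : (M : ℝ) ^ 2 / (2 * A) < σ := by
    rw [div_lt_iff₀ (by positivity), hA]
    have : σ * (2 * (((M : ℝ) ^ 2 + 1) / σ)) = 2 * ((M : ℝ) ^ 2 + 1) := by field_simp
    rw [this]; nlinarith [sq_nonneg (M : ℝ)]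
  have hAM : ∀ a b : ℝ, 0 ≤ b → M * (|a| + b) - A * (a ^ 2 + b ^ 2) ≤ (M : ℝ) ^ 2 / (2 * A) := by
    intro a b hb
    rw [le_div_iff₀ (by positivity), ← sq_abs a]
    nlinarith [sq_nonneg (2 * A * |a| - M), sq_nonneg (2 * A * b - M), abs_nonneg a,
      sq_nonneg (|a| - b), sq_nonneg (A * |a| - A * b), sq_nonneg (A * (|a| + b) - M)]
  -- `τ` bounds the parasitic gradient terms; their effect through `F`, at most `6 * L * τ`, must
  -- not absorb the strict gain `γ`.
  set τ : ℝ := γ / (16 * (L + 1)) with hτ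
  have hτ0 : 0 < τ := by positivity
  have hτL : (L + 1) * τ = γ / 16 := by rw [hτ]; field_simp
  set B : ℝ := (M : ℝ) ^ 2 / γ + σ with hB
  have hB0 : 0 < B := by positivity
  obtain ⟨β, hβ, hβB, hβσ⟩ : ∃ β : ℝ, 0 < β ∧ β * B ≤ τ ^ 2 ∧ β * (2 * ‖xb - e‖ ^ 2) ≤ σ := by
    refine ⟨min (τ ^ 2 / B) (σ / (2 * ‖xb - e‖ ^ 2 + 1)), lt_min (by positivity) (by positivity),
      ?_, ?_⟩
    · calc _ ≤ τ ^ 2 / B * B := mul_le_mul_of_nonneg_right (min_le_left _ _) hB0.le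
        _ = τ ^ 2 := by field_simp
    · calc _ ≤ σ / (2 * ‖xb - e‖ ^ 2 + 1) * (2 * ‖xb - e‖ ^ 2) :=
            mul_le_mul_of_nonneg_right (min_le_right _ _) (by positivity)
        _ ≤ σ := by
          rw [div_mul_eq_mul_div, div_le_iff₀ (by positivity)]
          nlinarith
  obtain ⟨η, hη, hητ, hησ⟩ : ∃ η : ℝ, 0 < η ∧ η ≤ τ / 2 ∧ η ≤ σ / 4 :=
    ⟨min (τ / 2) (σ / 4), by positivity, min_le_left _ _, min_le_right _ _⟩
  let Φ : ℝ → E → ℝ → E → ℝ := fun t x s y => u (t, x) + w (s, y)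
    - A * ((t - s) ^ 2 + ‖x - y‖ ^ 2) - γ * (t + t ^ 2) - β * (‖x - e‖ ^ 2 + ‖y - e‖ ^ 2)
  have hΦc : ContinuousOn (fun p : (ℝ × E) × ℝ × E => Φ p.1.1 p.1.2 p.2.1 p.2.2)
      ((Ici (0 : ℝ) ×ˢ S) ×ˢ Ici (0 : ℝ) ×ˢ S) := by
    have d1 : ContinuousOn (fun p : (ℝ × E) × ℝ × E => u (p.1.1, p.1.2))
        ((Ici (0 : ℝ) ×ˢ S) ×ˢ Ici (0 : ℝ) ×ˢ S) :=
      hu.continuousOn.comp continuous_fst.continuousOn fun p hp => hp.1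
    have d2 : ContinuousOn (fun p : (ℝ × E) × ℝ × E => w (p.2.1, p.2.2))
        ((Ici (0 : ℝ) ×ˢ S) ×ˢ Ici (0 : ℝ) ×ˢ S) :=
      hw.continuousOn.comp continuous_snd.continuousOn fun p hp => hp.2
    refine (((d1.add d2).sub ?_).sub ?_).sub ?_
    all_goals exact Continuous.continuousOn (by fun_prop)
  have hdiag : ∀ t x s y, 0 ≤ t → x ∈ S → 0 ≤ s → y ∈ S → u (t, x) + w (s, y)
      ≤ 2 * M * t + M * (|t - s| + ‖x - y‖) := by
    intro t x s y ht hx hs hy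
    have e1 := huL ht le_rfl hx hx
    have e2 := hwL ht le_rfl hx hx
    have e3 := hwL hs ht hy hx
    rw [sub_self, norm_zero, add_zero, sub_zero, abs_of_nonneg ht] at e1 e2
    rw [abs_sub_comm, norm_sub_rev] at e3
    linarith [h0 _ hx]
  have hquad : ∀ t : ℝ, 2 * M * t - γ * (t ^ 2) ≤ (M : ℝ) ^ 2 / γ := fun t => by
    rw [le_div_iff₀ hγ]; nlinarith [sq_nonneg (γ * t - M)]
  have hΦB : ∀ t x s y, 0 ≤ t → x ∈ S → 0 ≤ s → y ∈ S →
      Φ t x s y ≤ B - β * (‖x - e‖ ^ 2 + ‖y - e‖ ^ 2) := by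
    intro t x s y ht hx hs hy
    have e1 := hdiag t x s y ht hx hs hy
    have e2 := hAM (t - s) ‖x - y‖ (norm_nonneg _)
    have e3 := hquad t
    have e4 := mul_nonneg hγ.le ht
    simp only [Φ, hB]
    linarith
  obtain ⟨a₁, a₂, a₃, a₄, t, x, s, y, ha₂, ha₄, pt, hpx, ps, hpy, b1, b2, b3, b4, hmax, hval⟩ :=
    exists_max_sub_sq_prod hSc hS ⟨e, he⟩ hΦc (B := B) (fun t x s y ht hx hs hy =>
      (hΦB t x s y ht hx hs hy).trans (by
      have : 0 ≤ β * (‖x - e‖ ^ 2 + ‖y - e‖ ^ 2) := by positivity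
      linarith)) hη
  have hΦpe : ∀ t x s y, Φ t x s y = u (t, x) + w (s, y) - A * ((t - s) ^ 2 + ‖x - y‖ ^ 2)
      - γ * (t + t ^ 2) - β * (‖x - e‖ ^ 2 + ‖y - e‖ ^ 2) := fun _ _ _ _ => rfl
  have hΦp : σ < Φ t x s y := by
    have e1 := hval tb xb tb xb htb hxb htb hxb
    rw [hΦpe tb xb, hσ] at e1
    simp only [sub_self, norm_zero] at e1
    linarith
  have hΦpB := hΦB t x s y pt hpx ps hpy
  have hAMp := hAM (t - s) ‖x - y‖ (norm_nonneg _)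
  have hpen : 0 ≤ β * (‖x - e‖ ^ 2 + ‖y - e‖ ^ 2) := by positivity
  have hpent : 0 ≤ γ * (t + t ^ 2) := by positivity
  clear_value A τ B Φ
  -- At a vanishing time the initial inequality and the Lipschitz bounds give `Φ ≤ M ^ 2 / (2 * A) <
  -- σ`.
  have ht0 : 0 < t := by
    rcases pt.eq_or_lt with h | h
    · exfalso
      have e1 := hdiag t x s y pt hpx ps hpy
      have e2 := hΦpe t x s y
      rw [← h] at e1 e2 hAMp hpent
      rw [← h] at hΦp
      linarith
    · exact h
  have hs0 : 0 < s := by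
    rcases ps.eq_or_lt with h | h
    · exfalso
      have e1 := huL pt le_rfl hpx hpy
      have e2 := h0 y hpy
      have e3 := hΦpe t x s y
      rw [← h] at e3 hAMp hΦp
      linarith
    · exact h
  have hsmall : ∀ z : E, β * ‖z - e‖ ^ 2 ≤ B → 2 * β * ‖z - e‖ ≤ 2 * τ := by
    intro z hz
    have e1 : (β * ‖z - e‖) ^ 2 ≤ τ ^ 2 := by
      calc (β * ‖z - e‖) ^ 2 = β * (β * ‖z - e‖ ^ 2) := by ring
        _ ≤ β * B := mul_le_mul_of_nonneg_left hz hβ.le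
        _ ≤ τ ^ 2 := hβB
    have := le_of_sq_le_sq e1 hτ0.le
    linarith
  have hxe := hsmall x (by linarith [mul_nonneg hβ.le (sq_nonneg ‖y - e‖), mul_add β (‖x - e‖ ^ 2) (‖y - e‖ ^ 2)])
  have hye := hsmall y (by linarith [mul_nonneg hβ.le (sq_nonneg ‖x - e‖), mul_add β (‖x - e‖ ^ 2) (‖y - e‖ ^ 2)])
  -- The test gradient combines `x - y`, `x - a₂` and `x - e` with positive coefficients, and the
  -- base points lie in `S`; this is the form declared admissible by `hN`.
  have hsubu := hus.sub_of_isMax (p := (t, x)) (k := A) (γ := γ) (β := β) (η := η) (s := s)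
    (a₁ := a₁) (y := y) (e := e) (a₂ := a₂) ⟨ht0, hpx⟩ (fun q hq => by
      have e1 := hmax q.1 q.2 s y (le_of_lt hq.1) hq.2 ps hpy
      rw [hΦpe, hΦpe] at e1
      simp only [Prod.mk.eta] at e1 ⊢
      linarith)
    (hN _ hpx _ hpy _ ha₂ _ _ _ (by positivity) (by positivity) (by positivity))
  have hsubw := hws.sub_of_isMax (p := (s, y)) (k := A) (γ := 0) (β := β) (η := η) (s := t)
    (a₁ := a₃) (y := x) (e := e) (a₂ := a₄) ⟨hs0, hpy⟩ (fun q hq => by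
      have e1 := hmax t x q.1 q.2 pt hpx (le_of_lt hq.1) hq.2
      rw [hΦpe, hΦpe] at e1
      simp only [Prod.mk.eta] at e1 ⊢
      rw [show (q.1 - t) ^ 2 = (t - q.1) ^ 2 by ring, show (s - t) ^ 2 = (t - s) ^ 2 by ring,
        norm_sub_rev q.2 x, norm_sub_rev y x]
      linarith)
    (hN _ hpy _ hpx _ ha₄ _ _ _ (by positivity) (by positivity) (by positivity))
  simp only [reflect] at hsubw
  set g₁ := (2 * A) • (x - y) + (2 * η) • (x - a₂) + (2 * β) • (x - e) with hg₁
  set g₂ := (2 * A) • (y - x) + (2 * η) • (y - a₄) + (2 * β) • (y - e) with hg₂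
  have hF12 := (le_abs_self _).trans (hF g₁ (-g₂))
  have hn : ∀ z a : E, ‖z - a‖ ≤ 1 → 2 * β * ‖z - e‖ ≤ 2 * τ →
      ‖(2 * η) • (z - a) + (2 * β) • (z - e)‖ ≤ 2 * η + 2 * τ := fun z a h1 h2 => by
    refine (norm_add_le _ _).trans (add_le_add ?_ ?_)
    · rw [norm_smul, Real.norm_eq_abs, abs_of_pos (by positivity)]
      exact mul_le_of_le_one_right (by positivity) h1
    · rw [norm_smul, Real.norm_eq_abs, abs_of_pos (by positivity)]; exact h2
  -- The coupling terms `(2 * A) • (x - y)` cancel.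
  have hg : ‖g₁ - -g₂‖ ≤ 2 * η + 2 * τ + (2 * η + 2 * τ) := by
    have : g₁ - -g₂ = ((2 * η) • (x - a₂) + (2 * β) • (x - e))
        + ((2 * η) • (y - a₄) + (2 * β) • (y - e)) := by
      rw [hg₁, hg₂]; module
    rw [this]
    exact (norm_add_le _ _).trans (add_le_add (hn x a₂ b2 hxe) (hn y a₄ b4 hye))
  have hfin : F g₁ - F (-g₂) ≤ L * (6 * τ) :=
    hF12.trans (mul_le_mul_of_nonneg_left (by linarith) hL0)
  simp only at hsubu hsubw
  have f1 := mul_nonneg hγ.le ht0.le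
  have f2 := mul_le_mul_of_nonneg_left b1 hη.le
  have f3 := mul_le_mul_of_nonneg_left b3 hη.le
  have f4 := mul_pos hγ ht0
  linarith [mul_add γ 1 (2 * t)]

end Comparison

/-! ### Discrete differential games and their values -/

section Game

variable {E : Type*} [NormedAddCommGroup E] [InnerProductSpace ℝ E]

/-- One step of a discrete differential game: the first player chooses `q`, the second one
answers with the direction `z ∈ Z`. -/
noncomputable def gameStep (F : E → ℝ) (Z : Set E) (h : ℝ) (u : E → ℝ) (x : E) : ℝ :=
  ⨆ q : E, ⨅ z : Z, (u (x + h • (z : E)) + h * (F q - inner ℝ (z : E) q))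

variable {F : E → ℝ} {Z : Set E} {L M : NNReal} {h : ℝ} {u v : E → ℝ}

theorem IsGame.nonempty (hF : IsGame F Z L) : Z.Nonempty :=
  let ⟨z, hz, _⟩ := hF.key 0 0; ⟨z, hz⟩

theorem IsGame.dist_move_le (hF : IsGame F Z L) (hu : LipschitzWith M u) (hh : 0 ≤ h) (x : E)
    {z : E} (hz : z ∈ Z) : |u (x + h • z) - u x| ≤ h * (M * L) := by
  have h1 := hu.dist_le_mul (x + h • z) x
  rw [Real.dist_eq, dist_eq_norm, add_sub_cancel_left, norm_smul, Real.norm_eq_abs,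
    abs_of_nonneg hh] at h1
  refine h1.trans ?_
  have := mul_le_mul_of_nonneg_left (hF.bound z hz) (mul_nonneg M.2 hh)
  simp only [NNReal.val_eq_coe] at this
  linarith

theorem IsGame.bddBelow_step (hF : IsGame F Z L) (hu : LipschitzWith M u) (hh : 0 ≤ h) (x q : E) :
    BddBelow (range fun z : Z => u (x + h • (z : E)) + h * (F q - inner ℝ (z : E) q)) := by
  refine ⟨u x - h * (M * L) + h * (F q - L * ‖q‖), ?_⟩
  rintro _ ⟨z, rfl⟩
  have h1 := (abs_le.1 (hF.dist_move_le hu hh x z.2)).1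
  have h2 : inner ℝ (z : E) q ≤ L * ‖q‖ := (real_inner_le_norm _ _).trans
    (mul_le_mul_of_nonneg_right (hF.bound z z.2) (norm_nonneg _))
  have h3 := mul_le_mul_of_nonneg_left h2 hh
  simp only [mul_sub]
  linarith

/-- The answer to `q` provided by `IsGame.key` against `q' = 0` has gain at most `F 0`, uniformly in
`q`. -/
theorem IsGame.bddAbove_step (hF : IsGame F Z L) (hu : LipschitzWith M u) (hh : 0 ≤ h) (x : E) :
    BddAbove (range fun q : E =>
      ⨅ z : Z, (u (x + h • (z : E)) + h * (F q - inner ℝ (z : E) q))) := by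
  refine ⟨u x + h * (M * L) + h * F 0, ?_⟩
  rintro _ ⟨q, rfl⟩
  obtain ⟨z, hz, hq⟩ := hF.key q 0
  refine (ciInf_le (hF.bddBelow_step hu hh x q) ⟨z, hz⟩).trans ?_
  have h1 := (abs_le.1 (hF.dist_move_le hu hh x hz)).2
  rw [sub_zero] at hq
  have h2 := mul_le_mul_of_nonneg_left (show F q - inner ℝ z q ≤ F 0 by linarith) hh
  simp only
  linarith

theorem IsGame.le_step (hF : IsGame F Z L) (hu : LipschitzWith M u) (hh : 0 ≤ h) {x : E} {c : ℝ}
    (q : E) (hc : ∀ z ∈ Z, c ≤ u (x + h • z) + h * (F q - inner ℝ z q)) :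
    c ≤ gameStep F Z h u x := by
  have := hF.nonempty.to_subtype
  exact (le_ciInf fun z : Z => hc z z.2).trans (le_ciSup (hF.bddAbove_step hu hh x) q)

theorem IsGame.step_le (hF : IsGame F Z L) (hu : LipschitzWith M u) (hh : 0 ≤ h) {x : E} {c : ℝ}
    (hc : ∀ q, ∃ z ∈ Z, u (x + h • z) + h * (F q - inner ℝ z q) ≤ c) :
    gameStep F Z h u x ≤ c :=
  ciSup_le fun q =>
    let ⟨z, hz, hq⟩ := hc q
    (ciInf_le (hF.bddBelow_step hu hh x q) ⟨z, hz⟩).trans hq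

theorem IsGame.exists_of_lt_step (hF : IsGame F Z L) (hu : LipschitzWith M u) (hh : 0 ≤ h) {x : E}
    {c : ℝ} (hc : c < gameStep F Z h u x) :
    ∃ q, ∀ z ∈ Z, c ≤ u (x + h • z) + h * (F q - inner ℝ z q) := by
  obtain ⟨q, hq⟩ := exists_lt_of_lt_ciSup hc
  exact ⟨q, fun z hz => hq.le.trans (ciInf_le (hF.bddBelow_step hu hh x q) ⟨z, hz⟩)⟩

theorem IsGame.exists_of_step_lt (hF : IsGame F Z L) (hu : LipschitzWith M u) (hh : 0 ≤ h) {x : E}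
    {c : ℝ} (hc : gameStep F Z h u x < c) (q : E) :
    ∃ z ∈ Z, u (x + h • z) + h * (F q - inner ℝ z q) ≤ c := by
  have := hF.nonempty.to_subtype
  obtain ⟨z, hz⟩ := exists_lt_of_ciInf_lt ((le_ciSup (hF.bddAbove_step hu hh x) q).trans_lt hc)
  exact ⟨z, z.2, hz.le⟩

/-- The first player can reuse the same `q`, and the gain does not depend on the position.
Monotonicity, invariance under translations and preservation of Lipschitz bounds all follow from
this. -/
theorem IsGame.step_le_step_add (hF : IsGame F Z L) (hu : LipschitzWith M u)
    (hv : LipschitzWith M v) (hh : 0 ≤ h) {x y : E} {c : ℝ}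
    (hc : ∀ z ∈ Z, u (x + h • z) ≤ v (y + h • z) + c) :
    gameStep F Z h u x ≤ gameStep F Z h v y + c := by
  refine le_of_forall_lt fun d hd => ?_
  obtain ⟨d', hd, hd'⟩ := exists_between hd
  obtain ⟨q, hq⟩ := hF.exists_of_lt_step hu hh hd'
  have := hF.le_step hv hh (x := y) (c := d' - c) q fun z hz => by linarith [hq z hz, hc z hz]
  linarith

theorem IsGame.lipschitz_step (hF : IsGame F Z L) (hu : LipschitzWith M u) (hh : 0 ≤ h) :
    LipschitzWith M (gameStep F Z h u) := by
  refine LipschitzWith.of_le_add_mul M fun x y => hF.step_le_step_add hu hu hh fun z _ => ?_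
  have h1 := hu.dist_le_mul (x + h • z) (y + h • z)
  rw [dist_add_right, Real.dist_eq] at h1
  linarith [le_abs_self (u (x + h • z) - u (y + h • z))]

theorem IsGame.abs_step_sub_le (hF : IsGame F Z L) (hu : LipschitzWith M u) (hh : 0 ≤ h) (x : E) :
    |gameStep F Z h u x - u x| ≤ h * (M * L + |F 0|) := by
  have f0 := mul_le_mul_of_nonneg_left (le_abs_self (F 0)) hh
  have f1 := mul_le_mul_of_nonneg_left (neg_abs_le (F 0)) hh
  rw [abs_sub_le_iff]
  constructor
  · rw [sub_le_iff_le_add]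
    refine hF.step_le hu hh fun q => ?_
    obtain ⟨z, hz, hq⟩ := hF.key q 0
    refine ⟨z, hz, ?_⟩
    have h1 := (abs_le.1 (hF.dist_move_le hu hh x hz)).2
    rw [sub_zero] at hq
    have h2 := mul_le_mul_of_nonneg_left (show F q - inner ℝ z q ≤ F 0 by linarith) hh
    linarith
  · rw [sub_le_comm]
    refine hF.le_step hu hh 0 fun z hz => ?_
    have h1 := (abs_le.1 (hF.dist_move_le hu hh x hz)).1
    rw [inner_zero_right, sub_zero]
    linarith

/-- Iterates of the game step. -/
noncomputable def gameIter (F : E → ℝ) (Z : Set E) (h : ℝ) (u : E → ℝ) (m : ℕ) : E → ℝ :=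
  (gameStep F Z h)^[m] u

theorem gameIter_zero : gameIter F Z h u 0 = u := rfl

theorem gameIter_succ (m : ℕ) : gameIter F Z h u (m + 1) = gameStep F Z h (gameIter F Z h u m) :=
  Function.iterate_succ_apply' _ _ _

theorem IsGame.lipschitz_iter (hF : IsGame F Z L) (hu : LipschitzWith M u) (hh : 0 ≤ h) (m : ℕ) :
    LipschitzWith M (gameIter F Z h u m) := by
  induction m with
  | zero => exact hu
  | succ m ih => rw [gameIter_succ]; exact hF.lipschitz_step ih hh

theorem IsGame.abs_iter_sub_le (hF : IsGame F Z L) (hu : LipschitzWith M u) (hh : 0 ≤ h) (m : ℕ)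
    (x : E) (j : ℕ) :
    |gameIter F Z h u (m + j) x - gameIter F Z h u m x| ≤ (M * L + |F 0|) * (j * h) := by
  induction j with
  | zero => simp
  | succ j ih =>
    have h1 := hF.abs_step_sub_le (hF.lipschitz_iter hu hh (m + j)) hh x
    rw [← gameIter_succ] at h1
    have h2 := abs_sub_le (gameIter F Z h u (m + j + 1) x) (gameIter F Z h u (m + j) x)
      (gameIter F Z h u m x)
    rw [← add_assoc]
    push_cast
    linarith

theorem IsGame.iter_le_add (hF : IsGame F Z L) (hu : LipschitzWith M u) (hh : 0 ≤ h) {w : E} {c : ℝ}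
    (hc : ∀ x, u (x + w) ≤ u x + c) (m : ℕ) (x : E) :
    gameIter F Z h u m (x + w) ≤ gameIter F Z h u m x + c := by
  induction m generalizing x with
  | zero => exact hc x
  | succ m ih =>
    rw [gameIter_succ]
    have hl := hF.lipschitz_iter hu hh m
    refine hF.step_le_step_add hl hl hh fun z _ => ?_
    rw [add_right_comm]
    exact ih _

/-- The time step of the `k`-th approximation. -/
noncomputable def meshSize (k : ℕ) : ℝ := 1 / ((k : ℝ) + 1)

theorem meshSize_pos (k : ℕ) : 0 < meshSize k := by unfold meshSize; positivity

theorem tendsto_meshSize : Tendsto meshSize (hyperfilter ℕ : Filter ℕ) (𝓝 0) :=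
  tendsto_one_div_add_atTop_nhds_zero_nat.mono_left Nat.hyperfilter_le_atTop

/-- The approximations are constant in time over the intervals of the grid of mesh
`meshSize k`. -/
noncomputable def gridIndex (k : ℕ) (t : ℝ) : ℕ := ⌊t * ((k : ℝ) + 1)⌋₊

theorem gridIndex_mul (k m : ℕ) : gridIndex k (m * meshSize k) = m := by
  have : (m : ℝ) * meshSize k * ((k : ℝ) + 1) = m := by
    unfold meshSize; field_simp
  rw [gridIndex, this, Nat.floor_natCast]

theorem gridIndex_mul_le {k : ℕ} {t : ℝ} (ht : 0 ≤ t) : gridIndex k t * meshSize k ≤ t := by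
  have hk : (0 : ℝ) < (k : ℝ) + 1 := by positivity
  have := Nat.floor_le (mul_nonneg ht hk.le)
  rw [meshSize, mul_one_div, div_le_iff₀ hk]
  exact this

theorem lt_gridIndex_mul (k : ℕ) (t : ℝ) : t < gridIndex k t * meshSize k + meshSize k := by
  have hk : (0 : ℝ) < (k : ℝ) + 1 := by positivity
  have := Nat.lt_floor_add_one (t * ((k : ℝ) + 1))
  rw [meshSize, mul_one_div, ← add_div, lt_div_iff₀ hk]
  exact this

theorem gridIndex_mono (k : ℕ) {s t : ℝ} (hst : s ≤ t) : gridIndex k s ≤ gridIndex k t :=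
  Nat.floor_mono (mul_le_mul_of_nonneg_right hst (by positivity))

/-- Discrete-time approximations of the value of the game. -/
noncomputable def gameApprox (F : E → ℝ) (Z : Set E) (u : E → ℝ) (k : ℕ) (p : ℝ × E) : ℝ :=
  gameIter F Z (meshSize k) u (gridIndex k p.1) p.2

/-- A time step changes the value by at most its length times `M * L + |F 0|`; rounding to the grid
adds at most one step. -/
theorem IsGame.abs_approx_sub_le (hF : IsGame F Z L) (hu : LipschitzWith M u) (k : ℕ) {p q : ℝ × E}
    (hp : 0 ≤ p.1) (hq : 0 ≤ q.1) :
    |gameApprox F Z u k p - gameApprox F Z u k q|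
      ≤ (M * L + |F 0|) * (|p.1 - q.1| + meshSize k) + M * ‖p.2 - q.2‖ := by
  have hK : 0 ≤ (M : ℝ) * L + |F 0| := by positivity
  have time : ∀ (s t : ℝ) (x : E), 0 ≤ s → s ≤ t →
      |gameApprox F Z u k (t, x) - gameApprox F Z u k (s, x)|
        ≤ (M * L + |F 0|) * (|t - s| + meshSize k) := by
    intro s t x hs hst
    obtain ⟨j, hj⟩ := Nat.exists_eq_add_of_le (gridIndex_mono k hst)
    have h1 := hF.abs_iter_sub_le hu (meshSize_pos k).le (gridIndex k s) x j
    rw [← hj] at h1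
    refine h1.trans (mul_le_mul_of_nonneg_left ?_ hK)
    have h2 := gridIndex_mul_le (k := k) (hs.trans hst)
    have h3 := lt_gridIndex_mul k s
    rw [hj] at h2
    push_cast at h2
    rw [abs_of_nonneg (by linarith)]
    linarith
  have space : |gameApprox F Z u k p - gameApprox F Z u k (p.1, q.2)| ≤ M * ‖p.2 - q.2‖ := by
    have := (hF.lipschitz_iter hu (meshSize_pos k).le (gridIndex k p.1)).dist_le_mul p.2 q.2
    rwa [Real.dist_eq, dist_eq_norm] at this
  have h1 : |gameApprox F Z u k (p.1, q.2) - gameApprox F Z u k q|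
      ≤ (M * L + |F 0|) * (|p.1 - q.1| + meshSize k) := by
    rcases le_total q.1 p.1 with hle | hle
    · exact time q.1 p.1 q.2 hq hle
    · rw [abs_sub_comm, abs_sub_comm p.1]; exact time p.1 q.1 q.2 hp hle
  have := abs_sub_le (gameApprox F Z u k p) (gameApprox F Z u k (p.1, q.2)) (gameApprox F Z u k q)
  linarith

/-- The value of the game, a limit of the discrete-time approximations. -/
noncomputable def gameValue (F : E → ℝ) (Z : Set E) (u : E → ℝ) (p : ℝ × E) : ℝ :=
  limUnder (hyperfilter ℕ : Filter ℕ) fun k => gameApprox F Z u k p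

/-- The approximations at `p` stay in a compact interval, where every ultrafilter converges. No
extraction is needed, and convergence of the whole sequence is never used. -/
theorem IsGame.tendsto_approx (hF : IsGame F Z L) (hu : LipschitzWith M u) {p : ℝ × E}
    (hp : 0 ≤ p.1) : Tendsto (fun k => gameApprox F Z u k p) (hyperfilter ℕ : Filter ℕ)
      (𝓝 (gameValue F Z u p)) := by
  refine tendsto_nhds_limUnder ?_
  have hK : 0 ≤ (M : ℝ) * L + |F 0| := by positivity
  have hb : ∀ k, gameApprox F Z u k p ∈ Icc (u p.2 - (M * L + |F 0|) * p.1)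
      (u p.2 + (M * L + |F 0|) * p.1) := fun k => by
    have h1 := hF.abs_iter_sub_le hu (meshSize_pos k).le 0 p.2 (gridIndex k p.1)
    rw [zero_add] at h1
    have h2 := mul_le_mul_of_nonneg_left (gridIndex_mul_le (k := k) hp) hK
    have h3 := abs_le.1 (h1.trans h2)
    rw [gameIter_zero] at h3
    exact ⟨by unfold gameApprox; linarith [h3.1], by unfold gameApprox; linarith [h3.2]⟩
  obtain ⟨c, -, hc⟩ := isCompact_Icc.ultrafilter_le_nhds
    ((hyperfilter ℕ).map fun k => gameApprox F Z u k p)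
    (le_principal_iff.2 (Filter.mem_map.2 (Eventually.of_forall hb)))
  exact ⟨c, hc⟩

theorem IsGame.value_zero (hF : IsGame F Z L) (hu : LipschitzWith M u) (x : E) :
    gameValue F Z u (0, x) = u x := by
  refine tendsto_nhds_unique (hF.tendsto_approx hu le_rfl) ?_
  have : ∀ k, gameApprox F Z u k (0, x) = u x := fun k => by
    simp [gameApprox, gridIndex, gameIter_zero]
  simp only [this]
  exact tendsto_const_nhds

theorem IsGame.abs_value_sub_le (hF : IsGame F Z L) (hu : LipschitzWith M u) {p q : ℝ × E}
    (hp : 0 ≤ p.1) (hq : 0 ≤ q.1) :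
    |gameValue F Z u p - gameValue F Z u q|
      ≤ (M * L + |F 0|) * |p.1 - q.1| + M * ‖p.2 - q.2‖ := by
  have h1 := ((hF.tendsto_approx hu hp).sub (hF.tendsto_approx hu hq)).abs
  have h2 := ((tendsto_meshSize.const_add |p.1 - q.1|).const_mul (M * L + |F 0|)).add_const
    (M * ‖p.2 - q.2‖)
  rw [add_zero] at h2
  exact le_of_tendsto_of_tendsto' h1 h2 fun k => hF.abs_approx_sub_le hu k hp hq

theorem IsGame.exists_lipschitzOnWith_value (hF : IsGame F Z L) (hu : LipschitzWith M u) :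
    ∃ K : NNReal, LipschitzOnWith K (gameValue F Z u) (Ici (0 : ℝ) ×ˢ univ) := by
  refine ⟨(M * L + Real.nnabs (F 0)) + M, LipschitzOnWith.of_dist_le_mul fun p hp q hq => ?_⟩
  rw [Real.dist_eq, Prod.dist_eq, Real.dist_eq, dist_eq_norm]
  refine (hF.abs_value_sub_le hu hp.1 hq.1).trans ?_
  push_cast
  rw [add_mul _ (M : ℝ)]
  have hK : 0 ≤ (M : ℝ) * L + |F 0| := by positivity
  exact add_le_add (mul_le_mul_of_nonneg_left (le_max_left _ _) hK)
    (mul_le_mul_of_nonneg_left (le_max_right _ _) M.2)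

/-- One-sided directional bounds on the initial condition propagate because the game is invariant
under translations. -/
theorem IsGame.value_le_add (hF : IsGame F Z L) (hu : LipschitzWith M u) {w : E} {c : ℝ}
    (hc : ∀ x, u (x + w) ≤ u x + c) {t : ℝ} (ht : 0 ≤ t) (x : E) :
    gameValue F Z u (t, x + w) ≤ gameValue F Z u (t, x) + c :=
  le_of_tendsto_of_tendsto' (hF.tendsto_approx hu (p := (t, x + w)) ht)
    ((hF.tendsto_approx hu (p := (t, x)) ht).add_const c)
    fun k => hF.iter_le_add hu (meshSize_pos k).le hc _ x

end Game

/-! ### Transfer of strategies between two games -/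

section TwoGames

variable {E E' : Type*} [NormedAddCommGroup E] [InnerProductSpace ℝ E]
  [NormedAddCommGroup E'] [InnerProductSpace ℝ E']

/-- A game is a restriction of another one, in the sense that its nonlinearity is the restriction
of the other one to a subspace. -/
structure IsSubgame (F : E → ℝ) (Z : Set E) (F' : E' → ℝ) (Z' : Set E') (l : E' → E)
    (p : E →ₗ[ℝ] E') : Prop where
  adjoint : ∀ z q, inner ℝ z (l q) = inner ℝ (p z) q
  mapsTo : ∀ z ∈ Z, p z ∈ Z'
  restrict : ∀ q, F (l q) = F' q

variable {F : E → ℝ} {Z : Set E} {F' : E' → ℝ} {Z' : Set E'} {l : E' → E} {p : E →ₗ[ℝ] E'}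
  {L L' M M' : NNReal} {u : E → ℝ} {v : E' → ℝ} {S : Set E}

/-- The first player of the large game plays `l q`, with `q` nearly optimal in the small game. Any
answer `z` has the same gain as `p z`, which is a legal answer in the small game. -/
theorem IsSubgame.value_le (hs : IsSubgame F Z F' Z' l p) (hF : IsGame F Z L)
    (hF' : IsGame F' Z' L') (hu : LipschitzWith M u) (hv : LipschitzWith M' v)
    (hS : ∀ x ∈ S, ∀ z ∈ Z, ∀ h : ℝ, 0 ≤ h → x + h • z ∈ S) (huv : ∀ x ∈ S, v (p x) ≤ u x)
    {t : ℝ} (ht : 0 ≤ t) {x : E} (hx : x ∈ S) :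
    gameValue F' Z' v (t, p x) ≤ gameValue F Z u (t, x) := by
  have iter : ∀ (h : ℝ), 0 ≤ h → ∀ (m : ℕ), ∀ x ∈ S,
      gameIter F' Z' h v m (p x) ≤ gameIter F Z h u m x := by
    intro h hh m
    induction m with
    | zero => exact huv
    | succ m ih =>
      intro x hx
      rw [gameIter_succ, gameIter_succ]
      refine le_of_forall_lt fun d hd => ?_
      obtain ⟨d', hd, hd'⟩ := exists_between hd
      obtain ⟨q, hq⟩ := hF'.exists_of_lt_step (hF'.lipschitz_iter hv hh m) hh hd'
      refine hd.trans_le (hF.le_step (hF.lipschitz_iter hu hh m) hh (l q) fun z hz => ?_)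
      have h1 := hq (p z) (hs.mapsTo z hz)
      have h2 := ih _ (hS x hx z hz h hh)
      rw [map_add, map_smul] at h2
      rw [hs.adjoint, hs.restrict]
      linarith
  exact le_of_tendsto_of_tendsto' (hF'.tendsto_approx hv (p := (t, p x)) ht)
    (hF.tendsto_approx hu (p := (t, x)) ht) fun k => iter _ (meshSize_pos k).le _ x hx

/-- Here the second player imitates. Minus the value of the reflected small game is its upper value,
in which the minimizer commits to `-q` first. The answer to `q'` in the large game is the direction
`z` of `IsGame.key` for the pair `q'`, `l (-q)`. The initial error `ε * ‖x‖` grows since positions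
may move at speed `L`. -/
theorem IsSubgame.value_le_neg_value (hs : IsSubgame F Z F' Z' l p) (hF : IsGame F Z L)
    (hF' : IsGame F' Z' L') (hu : LipschitzWith M u) (hv : LipschitzWith M' v)
    (hS : ∀ x ∈ S, ∀ z ∈ Z, ∀ h : ℝ, 0 ≤ h → x + h • z ∈ S) {ε : ℝ} (hε : 0 ≤ ε)
    (huv : ∀ x ∈ S, u x ≤ -v (p x) + ε * ‖x‖)
    {t : ℝ} (ht : 0 ≤ t) {x : E} (hx : x ∈ S) :
    gameValue F Z u (t, x) ≤ -gameValue (reflect F') Z' v (t, p x) + ε * (‖x‖ + t * L) := by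
  have iter : ∀ (h : ℝ), 0 ≤ h → ∀ (m : ℕ), ∀ x ∈ S, gameIter F Z h u m x
      ≤ -gameIter (reflect F') Z' h v m (p x) + ε * (‖x‖ + m * h * L) := by
    intro h hh m
    induction m with
    | zero => simpa [gameIter_zero] using huv
    | succ m ih =>
      intro x hx
      rw [gameIter_succ, gameIter_succ, ← sub_le_iff_le_add, le_neg]
      refine le_of_forall_lt fun d hd => ?_
      obtain ⟨d', hd, hd'⟩ := exists_between hd
      refine hd.trans_le ?_
      rw [le_neg, sub_le_iff_le_add]
      obtain ⟨q, hq⟩ := hF'.reflected.exists_of_lt_step (hF'.reflected.lipschitz_iter hv hh m) hh hd'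
      refine hF.step_le (hF.lipschitz_iter hu hh m) hh fun q' => ?_
      obtain ⟨z, hz, hz'⟩ := hF.key q' (l (-q))
      refine ⟨z, hz, ?_⟩
      have h1 := hq (p z) (hs.mapsTo z hz)
      have h2 := ih _ (hS x hx z hz h hh)
      rw [map_add, map_smul] at h2
      rw [inner_sub_right, hs.adjoint, hs.restrict, inner_neg_right] at hz'
      have h3 : ‖x + h • z‖ ≤ ‖x‖ + h * L := (norm_add_le _ _).trans (by
        rw [norm_smul, Real.norm_eq_abs, abs_of_nonneg hh]
        linarith [mul_le_mul_of_nonneg_left (hF.bound z hz) hh])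
      have h4 := mul_le_mul_of_nonneg_left h3 hε
      have h5 := mul_le_mul_of_nonneg_left hz' hh
      simp only [reflect] at h1
      push_cast
      linarith
  have h1 := hF.tendsto_approx hu (p := (t, x)) ht
  have h2 := ((hF'.reflected.tendsto_approx hv (p := (t, p x)) ht).neg).add_const (ε * (‖x‖ + t * L))
  refine le_of_tendsto_of_tendsto' h1 h2 fun k => ?_
  refine (iter _ (meshSize_pos k).le (gridIndex k t) x hx).trans ?_
  refine add_le_add le_rfl (mul_le_mul_of_nonneg_left ?_ hε)
  exact add_le_add le_rfl (mul_le_mul_of_nonneg_right (gridIndex_mul_le ht) L.2)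

end TwoGames

/-! ### Calculus of smooth test functions -/

section SmoothTests

variable {E : Type*} [NormedAddCommGroup E] [InnerProductSpace ℝ E]
  {S : Set E} {φ φt : ℝ × E → ℝ} {φx : ℝ × E → E}

theorem IsSmoothTest.add {ψ ψt : ℝ × E → ℝ} {ψx : ℝ × E → E}
    (hφ : IsSmoothTest S φ φt φx) (hψ : IsSmoothTest S ψ ψt ψx) :
    IsSmoothTest S (fun q => φ q + ψ q) (fun q => φt q + ψt q) (fun q => φx q + ψx q) := by
  refine ⟨fun p hp => ?_, hφ.continuousOn.add hψ.continuousOn⟩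
  refine ((hφ.expansion p hp).add (hψ.expansion p hp)).congr_left fun q => ?_
  rw [inner_add_left]; ring

theorem tendsto_quadratic_remainder (T : Set (ℝ × E)) (p : ℝ × E) :
    Tendsto (fun q : ℝ × E => |q.1 - p.1| ^ 2 + ‖q.2 - p.2‖ ^ 2) (𝓝[T] p) (𝓝 0) := by
  have h : Continuous fun q : ℝ × E => |q.1 - p.1| ^ 2 + ‖q.2 - p.2‖ ^ 2 := by fun_prop
  have := (h.tendsto p).mono_left (nhdsWithin_le_nhds (s := T))
  simpa using this

theorem IsSmoothTest.continuousOn_self (hφ : IsSmoothTest S φ φt φx) :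
    ContinuousOn φ (Ioi (0 : ℝ) ×ˢ S) := by
  intro p hp
  have h1 := (hφ.expansion p hp).trans_tendsto (tendsto_quadratic_remainder _ p)
  have h2 : Continuous fun q : ℝ × E => φ p + (φt p * (q.1 - p.1) + inner ℝ (φx p) (q.2 - p.2)) := by
    fun_prop
  have h3 := h1.add ((h2.tendsto p).mono_left (nhdsWithin_le_nhds (s := Ioi (0 : ℝ) ×ˢ S)))
  simp only [sub_self, mul_zero, inner_zero_right, add_zero, zero_add] at h3
  refine h3.congr fun q => ?_
  ring

/-- Mean value theorem for smooth functions on convex sets. -/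
theorem IsSmoothTest.exists_eq_slope (hφ : IsSmoothTest S φ φt φx) (hS : Convex ℝ S) {p q : ℝ × E}
    (hp : p ∈ Ioi (0 : ℝ) ×ˢ S) (hq : q ∈ Ioi (0 : ℝ) ×ˢ S) :
    ∃ ξ ∈ segment ℝ p q, φ q - φ p = φt ξ * (q.1 - p.1) + inner ℝ (φx ξ) (q.2 - p.2) := by
  have hconv : Convex ℝ (Ioi (0 : ℝ) ×ˢ S) := (convex_Ioi 0).prod hS
  set γ : ℝ → ℝ × E := fun s => p + s • (q - p) with hγ
  have hγc : Continuous γ := by fun_prop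
  have hmaps : MapsTo γ (Icc 0 1) (Ioi (0 : ℝ) ×ˢ S) := fun s hs =>
    hconv.add_smul_sub_mem hp hq hs
  have hd : ∀ s ∈ Ioo (0 : ℝ) 1, HasDerivAt (fun s => φ (γ s))
      (φt (γ s) * (q.1 - p.1) + inner ℝ (φx (γ s)) (q.2 - p.2)) s := by
    intro s hs
    have hγt : Tendsto γ (𝓝 s) (𝓝[Ioi (0 : ℝ) ×ˢ S] (γ s)) :=
      tendsto_nhdsWithin_iff.2 ⟨hγc.tendsto s, by
        filter_upwards [Icc_mem_nhds hs.1 hs.2] with r hr using hmaps hr⟩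
    have h1 := (hφ.expansion (γ s) (hmaps ⟨hs.1.le, hs.2.le⟩)).comp_tendsto hγt
    rw [hasDerivAt_iff_isLittleO]
    have h2 : (fun r : ℝ => |(γ r).1 - (γ s).1| ^ 2 + ‖(γ r).2 - (γ s).2‖ ^ 2)
        =o[𝓝 s] fun r => r - s := by
      have h3 : (fun r : ℝ => |(γ r).1 - (γ s).1| ^ 2 + ‖(γ r).2 - (γ s).2‖ ^ 2)
          = fun r => (|q.1 - p.1| ^ 2 + ‖q.2 - p.2‖ ^ 2) * ((r - s) * (r - s)) := by
        funext r
        have e1 : (γ r).1 - (γ s).1 = (r - s) * (q.1 - p.1) := by simp [hγ]; ring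
        have e2 : (γ r).2 - (γ s).2 = (r - s) • (q.2 - p.2) := by simp [hγ]; module
        rw [e1, e2, norm_smul, abs_mul, Real.norm_eq_abs, mul_pow, mul_pow, sq_abs (r - s)]
        ring
      rw [h3]
      refine IsLittleO.const_mul_left ?_ _
      have h4 : Tendsto (fun r : ℝ => r - s) (𝓝 s) (𝓝 0) := by
        have := (continuous_id.sub continuous_const).tendsto (x := s) (f := fun r : ℝ => r - s)
        simpa using this
      simpa using ((isLittleO_one_iff ℝ).2 h4).mul_isBigO (isBigO_refl (fun r : ℝ => r - s) (𝓝 s))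
    refine (h1.trans_isLittleO h2).congr_left fun r => ?_
    have e1 : (γ r).1 - (γ s).1 = (r - s) * (q.1 - p.1) := by simp [hγ]; ring
    have e2 : (γ r).2 - (γ s).2 = (r - s) • (q.2 - p.2) := by simp [hγ]; module
    simp only [Function.comp_apply]
    rw [e1, e2, real_inner_smul_right, smul_eq_mul]
    ring
  obtain ⟨s, hs, hs'⟩ := exists_hasDerivAt_eq_slope (fun s => φ (γ s)) _ zero_lt_one
    (hφ.continuousOn_self.comp hγc.continuousOn hmaps) hd
  refine ⟨γ s, ?_, ?_⟩
  · rw [segment_eq_image']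
    exact ⟨s, ⟨hs.1.le, hs.2.le⟩, rfl⟩
  · rw [hs']; simp [hγ]

/-- Local maxima can be made strict without changing the differential of the test function. -/
theorem IsSmoothTest.exists_strict (hφ : IsSmoothTest S φ φt φx) {V : ℝ × E → ℝ} {p : ℝ × E}
    (hmax : IsLocalMaxOn (fun q => V q - φ q) (Ioi (0 : ℝ) ×ˢ S) p) :
    ∃ φ' φt' φx', IsSmoothTest S φ' φt' φx' ∧ φt' p = φt p ∧ φx' p = φx p ∧
      ∃ ρ > 0, ∀ q ∈ Ioi (0 : ℝ) ×ˢ S, dist q p ≤ ρ →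
        V q - φ' q + (|q.1 - p.1| ^ 2 + ‖q.2 - p.2‖ ^ 2) ≤ V p - φ' p := by
  -- The added polynomial is the squared distance to `p` up to a constant, so its differential
  -- vanishes at `p`.
  refine ⟨_, _, _, hφ.add (isSmoothTest_quadratic S 1 (-2 * p.1) 1 ((-2 : ℝ) • p.2)), by simp, ?_, ?_⟩
  · simp only [add_eq_left]; module
  · obtain ⟨ρ, hρ, hball⟩ := Metric.mem_nhdsWithin_iff.1 hmax
    refine ⟨ρ / 2, by positivity, fun q hq hd => ?_⟩
    have h1 := hball ⟨Metric.mem_ball.2 (by linarith), hq⟩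
    simp only [mem_ofPred_eq] at h1
    rw [norm_sub_sq_real, sq_abs, real_inner_smul_left, real_inner_smul_left,
      real_inner_self_eq_norm_sq, real_inner_comm q.2 p.2]
    linarith

end SmoothTests

/-! ### Viscosity inequalities for game values in finite dimension -/

section Viscosity

variable {E : Type*} [NormedAddCommGroup E] [InnerProductSpace ℝ E]

/-- Approximate solutions on the grids: `W k m` approximates a solution at time
`m * meshSize k`. -/
structure IsApprox (Z : Set E) (F : E → ℝ) (W : ℕ → ℕ → E → ℝ) (V : ℝ × E → ℝ) : Prop where
  continuous : ∀ k m, Continuous (W k m)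
  equi : ∃ K M : ℝ, ∀ k, ∀ p q : ℝ × E, 0 ≤ p.1 → 0 ≤ q.1 →
    |W k (gridIndex k p.1) p.2 - W k (gridIndex k q.1) q.2|
      ≤ K * (|p.1 - q.1| + meshSize k) + M * ‖p.2 - q.2‖
  tendsto : ∀ p : ℝ × E, 0 ≤ p.1 →
    Tendsto (fun k => W k (gridIndex k p.1) p.2) (hyperfilter ℕ : Filter ℕ) (𝓝 (V p))
  -- This one-sided dynamic programming inequality holds both for the values and for their opposites
  -- with the reflected nonlinearity, so one limit theorem gives both viscosity inequalities.
  step : ∀ k m x g, ∀ η > 0, ∃ z ∈ Z, W k (m + 1) x - meshSize k * η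
    ≤ W k m (x + meshSize k • z) + meshSize k * (F g - inner ℝ z g)

variable {Z S : Set E} {F : E → ℝ} {W : ℕ → ℕ → E → ℝ} {V : ℝ × E → ℝ} {L : NNReal}

theorem IsApprox.tendsto_of_tendsto (hW : IsApprox Z F W V) {q : ℕ → ℝ × E} {p : ℝ × E}
    (hq : ∀ k, 0 ≤ (q k).1) (hp : 0 ≤ p.1)
    (h : Tendsto q (hyperfilter ℕ : Filter ℕ) (𝓝 p)) :
    Tendsto (fun k => W k (gridIndex k (q k).1) (q k).2) (hyperfilter ℕ : Filter ℕ) (𝓝 (V p)) := by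
  obtain ⟨K, M, hKM⟩ := hW.equi
  have h1 : Tendsto (fun k => K * (|(q k).1 - p.1| + meshSize k) + M * ‖(q k).2 - p.2‖)
      (hyperfilter ℕ : Filter ℕ) (𝓝 (K * (|p.1 - p.1| + 0) + M * ‖p.2 - p.2‖)) :=
    ((((continuous_fst.tendsto p).comp h).sub_const _).abs.add tendsto_meshSize |>.const_mul K).add
      ((((continuous_snd.tendsto p).comp h).sub_const _).norm.const_mul M)
  simp only [sub_self, abs_zero, add_zero, mul_zero, norm_zero] at h1
  have h2 : Tendsto (fun k => W k (gridIndex k (q k).1) (q k).2 - W k (gridIndex k p.1) p.2)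
      (hyperfilter ℕ : Filter ℕ) (𝓝 0) :=
    squeeze_zero_norm (fun k => hKM k _ _ (hq k) hp) h1
  simpa using h2.add (hW.tendsto p hp)

/-- Strict local maxima for the limit are limits of local maxima for the approximations. -/
theorem IsApprox.exists_max [FiniteDimensional ℝ E] (hW : IsApprox Z F W V) (hSc : IsClosed S)
    {φ : ℝ × E → ℝ} (hφ : ContinuousOn φ (Ioi (0 : ℝ) ×ˢ S)) {p : ℝ × E}
    (hp : p ∈ Ioi (0 : ℝ) ×ˢ S) {ρ : ℝ} (hρ : 0 < ρ)
    (hmax : ∀ q ∈ Ioi (0 : ℝ) ×ˢ S, dist q p ≤ ρ →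
      V q - φ q + (|q.1 - p.1| ^ 2 + ‖q.2 - p.2‖ ^ 2) ≤ V p - φ p) :
    ∃ r > 0, ∃ (m : ℕ → ℕ) (x : ℕ → E), (∀ k, x k ∈ S) ∧
      Tendsto (fun k => ((m k * meshSize k, x k) : ℝ × E)) (hyperfilter ℕ : Filter ℕ) (𝓝 p) ∧
      ∀ᶠ k in (hyperfilter ℕ : Filter ℕ), ∀ (m' : ℕ) (x' : E), x' ∈ S →
        dist ((m' * meshSize k, x') : ℝ × E) p ≤ r →
        W k m' x' - φ (m' * meshSize k, x') ≤ W k (m k) (x k) - φ (m k * meshSize k, x k) := by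
  obtain ⟨hp1, hp2⟩ := hp
  rw [mem_Ioi] at hp1
  set r := min ρ (p.1 / 2) with hr
  have hr0 : 0 < r := lt_min hρ (by positivity)
  have hrt : r ≤ p.1 / 2 := min_le_right _ _
  have := FiniteDimensional.proper ℝ E
  set B : Set E := Metric.closedBall p.2 r ∩ S with hB
  have hBc : IsCompact B := (isCompact_closedBall _ _).inter_right hSc
  set T : ℕ → Set ℕ := fun k => {m | |m * meshSize k - p.1| ≤ r} with hT
  have hTfin : ∀ k, (T k).Finite := fun k => by
    refine (Set.finite_Iic ⌊(p.1 + r) / meshSize k⌋₊).subset fun m hm => ?_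
    refine Nat.le_floor ?_
    rw [le_div_iff₀ (meshSize_pos k)]
    have := (abs_le.1 (show |m * meshSize k - p.1| ≤ r from hm)).2
    linarith
  have hpos : ∀ k, ∀ m ∈ T k, 0 < m * meshSize k := fun k m hm => by
    have := (abs_le.1 (show |m * meshSize k - p.1| ≤ r from hm)).1
    linarith
  -- Finitely many grid times and a compact ball in space give a maximizer. When no grid time is
  -- close enough, a dummy point of `S` keeps the family total.
  have hex : ∀ k, ∃ a : ℕ × E, a.2 ∈ S ∧ ((T k).Nonempty → a ∈ T k ×ˢ B ∧ ∀ b ∈ T k ×ˢ B,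
      W k b.1 b.2 - φ (b.1 * meshSize k, b.2) ≤ W k a.1 a.2 - φ (a.1 * meshSize k, a.2)) := by
    intro k
    by_cases hne : (T k).Nonempty
    · have hcont : ContinuousOn (fun a : ℕ × E => W k a.1 a.2 - φ (a.1 * meshSize k, a.2))
          (T k ×ˢ B) := by
        rw [continuousOn_prod_of_discrete_left]
        intro m
        refine (hW.continuous k m).continuousOn.sub (hφ.comp
          ((continuous_const (y := (m : ℝ) * meshSize k)).prodMk
            (continuous_id (X := E))).continuousOn fun y hy => ?_)
        exact ⟨hpos k m hy.1, hy.2.2⟩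
      obtain ⟨a, ha, hamax⟩ := ((hTfin k).isCompact.prod hBc).exists_isMaxOn
        (hne.prod ⟨p.2, Metric.mem_closedBall_self hr0.le, hp2⟩) hcont
      exact ⟨a, ha.2.2, fun _ => ⟨ha, fun b hb => hamax hb⟩⟩
    · exact ⟨(0, p.2), hp2, fun h => absurd h hne⟩
  choose a haS ha using hex
  have hTne : ∀ᶠ k in (hyperfilter ℕ : Filter ℕ), gridIndex k p.1 ∈ T k := by
    filter_upwards [tendsto_meshSize.eventually_lt_const hr0] with k hk
    change |_| ≤ r
    rw [abs_le]
    constructor <;> linarith [lt_gridIndex_mul k p.1, gridIndex_mul_le (k := k) hp1.le]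
  set q : ℕ → ℝ × E := fun k => ((a k).1 * meshSize k, (a k).2) with hq
  have hq0 : ∀ k, 0 ≤ (q k).1 := fun k => mul_nonneg (Nat.cast_nonneg _) (meshSize_pos k).le
  have hqmem : ∀ᶠ k in (hyperfilter ℕ : Filter ℕ), q k ∈ Icc (p.1 - r) (p.1 + r) ×ˢ B := by
    filter_upwards [hTne] with k hk
    have h1 := (ha k ⟨_, hk⟩).1
    have h2 := abs_le.1 (show |((a k).1 : ℝ) * meshSize k - p.1| ≤ r from h1.1)
    exact ⟨⟨by simp only [hq]; linarith [h2.1], by simp only [hq]; linarith [h2.2]⟩, h1.2⟩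
  obtain ⟨ph, hph, hlim⟩ := (isCompact_Icc.prod hBc).ultrafilter_le_nhds ((hyperfilter ℕ).map q)
    (le_principal_iff.2 hqmem)
  have hlim : Tendsto q (hyperfilter ℕ : Filter ℕ) (𝓝 ph) := hlim
  have hph0 : 0 < ph.1 := by linarith [hph.1.1]
  have hφlim : ∀ {y : ℕ → ℝ × E} {y' : ℝ × E}, y' ∈ Ioi (0 : ℝ) ×ˢ S →
      (∀ᶠ k in (hyperfilter ℕ : Filter ℕ), y k ∈ Ioi (0 : ℝ) ×ˢ S) →
      Tendsto y (hyperfilter ℕ : Filter ℕ) (𝓝 y') →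
      Tendsto (fun k => φ (y k)) (hyperfilter ℕ : Filter ℕ) (𝓝 (φ y')) := fun hy' hy h =>
    (hφ _ hy').tendsto.comp (tendsto_nhdsWithin_iff.2 ⟨h, hy⟩)
  have hphS : ph ∈ Ioi (0 : ℝ) ×ˢ S := ⟨hph0, hph.2.2⟩
  have l1 := (hW.tendsto_of_tendsto hq0 hph0.le hlim).sub (hφlim hphS (by
    filter_upwards [hTne] with k hk
    exact ⟨hpos k _ (ha k ⟨_, hk⟩).1.1, haS k⟩) hlim)
  set y : ℕ → ℝ × E := fun k => (gridIndex k p.1 * meshSize k, p.2) with hy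
  have hylim : Tendsto y (hyperfilter ℕ : Filter ℕ) (𝓝 p) := by
    refine Tendsto.prodMk_nhds ?_ tendsto_const_nhds
    have h1 := tendsto_meshSize.const_sub p.1
    rw [sub_zero] at h1
    exact tendsto_of_tendsto_of_tendsto_of_le_of_le h1 tendsto_const_nhds
      (fun k => by linarith [lt_gridIndex_mul k p.1]) (fun k => gridIndex_mul_le hp1.le)
  have l2 := (hW.tendsto_of_tendsto (q := y)
    (fun k => mul_nonneg (Nat.cast_nonneg _) (meshSize_pos k).le) hp1.le hylim).sub
    (hφlim ⟨hp1, hp2⟩ (by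
    filter_upwards [hTne] with k hk
    exact ⟨hpos k _ hk, hp2⟩) hylim)
  have hle : V p - φ p ≤ V ph - φ ph := by
    refine le_of_tendsto_of_tendsto l2 l1 ?_
    filter_upwards [hTne] with k hk
    have := (ha k ⟨_, hk⟩).2 (gridIndex k p.1, p.2)
      ⟨hk, Metric.mem_closedBall_self hr0.le, hp2⟩
    simp only [hy, hq, gridIndex_mul]
    exact this
  -- The limit of the discrete maximizers is a maximum point of the limit, and strictness leaves
  -- only `p`.
  have hph_eq : ph = p := by
    have h1 := hmax ph hphS (by
      rw [Prod.dist_eq]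
      refine max_le ?_ ((Metric.mem_closedBall.1 hph.2.1).trans (min_le_left _ _))
      rw [Real.dist_eq, abs_le]
      constructor <;> linarith [hph.1.1, hph.1.2, min_le_left ρ (p.1 / 2)])
    have h2 : |ph.1 - p.1| ^ 2 ≤ 0 := by nlinarith [sq_nonneg ‖ph.2 - p.2‖]
    have h3 : ‖ph.2 - p.2‖ ^ 2 ≤ 0 := by nlinarith [sq_nonneg |ph.1 - p.1|]
    have h4 : |ph.1 - p.1| = 0 := pow_eq_zero_iff two_ne_zero |>.1 (le_antisymm h2 (sq_nonneg _))
    have h5 : ‖ph.2 - p.2‖ = 0 := pow_eq_zero_iff two_ne_zero |>.1 (le_antisymm h3 (sq_nonneg _))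
    exact Prod.ext (sub_eq_zero.1 (abs_eq_zero.1 h4)) (sub_eq_zero.1 (norm_eq_zero.1 h5))
  refine ⟨r, hr0, fun k => (a k).1, fun k => (a k).2, haS, hph_eq ▸ hlim, ?_⟩
  filter_upwards [hTne] with k hk m' x' hx' hd
  rw [Prod.dist_eq, max_le_iff, Real.dist_eq] at hd
  exact (ha k ⟨_, hk⟩).2 (m', x') ⟨hd.1, hd.2, hx'⟩

/-- Limits of approximate solutions are subsolutions. -/
theorem IsApprox.le_of_isLocalMaxOn [FiniteDimensional ℝ E] (hW : IsApprox Z F W V)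
    (hF : IsGame F Z L) (hSc : IsClosed S) (hS : Convex ℝ S)
    (hSZ : ∀ x ∈ S, ∀ z ∈ Z, ∀ h : ℝ, 0 ≤ h → x + h • z ∈ S)
    {φ φt : ℝ × E → ℝ} {φx : ℝ × E → E} (hφ : IsSmoothTest S φ φt φx) {p : ℝ × E}
    (hp : p ∈ Ioi (0 : ℝ) ×ˢ S)
    (hmax : IsLocalMaxOn (fun q => V q - φ q) (Ioi (0 : ℝ) ×ˢ S) p) : φt p ≤ F (φx p) := by
  obtain ⟨φ', φt', φx', hφ', ht, hx, ρ, hρ, hstrict⟩ := hφ.exists_strict hmax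
  rw [← ht, ← hx]
  clear hφ hmax ht hx φ φt φx
  obtain ⟨r, hr, m, x, hxS, hlim, hev⟩ := hW.exists_max hSc hφ'.continuousOn_self hp hρ hstrict
  have hL : (0 : ℝ) ≤ L := L.2
  refine le_of_forall_pos_le_add fun ε hε => ?_
  set η := ε / (2 + 3 * L) with hη
  have hη0 : 0 < η := by positivity
  have hηε : η * (2 + 3 * L) = ε := by rw [hη]; field_simp
  obtain ⟨δ, hδ, hcont⟩ := Metric.continuousWithinAt_iff.1 (hφ'.continuousOn p hp) η hη0
  -- The bound by `p.1` keeps times positive on the ball and forces the grid index of the maximizer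
  -- to be a successor.
  set R := min (min r δ) p.1 with hR
  have hR0 : 0 < R := lt_min (lt_min hr hδ) hp.1
  have hnear : ∀ᶠ k in (hyperfilter ℕ : Filter ℕ),
      dist ((m k * meshSize k, x k) : ℝ × E) p < R / 2 :=
    hlim.eventually (Metric.ball_mem_nhds p (by positivity))
  have hsmall : ∀ᶠ k in (hyperfilter ℕ : Filter ℕ), meshSize k < R / (2 * (1 + L)) :=
    tendsto_meshSize.eventually_lt_const (by positivity)
  obtain ⟨k, hk1, hk2, hk3⟩ := (hev.and (hnear.and hsmall)).exists
  set h := meshSize k with hh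
  have hh0 : 0 < h := meshSize_pos k
  rw [lt_div_iff₀ (by positivity)] at hk3
  have hd1 := hk2
  rw [Prod.dist_eq, max_lt_iff, Real.dist_eq, dist_eq_norm] at hd1
  simp only at hd1
  obtain ⟨hd1, hd2⟩ := hd1
  have hhR : h ≤ R / 2 := by nlinarith
  have hhL : h * L ≤ R / 2 := by nlinarith
  obtain ⟨n, hn⟩ : ∃ n, m k = n + 1 := by
    refine Nat.exists_eq_succ_of_ne_zero fun h0 => ?_
    rw [h0, Nat.cast_zero, zero_mul, zero_sub, abs_neg, abs_of_pos hp.1] at hd1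
    linarith [min_le_right (min r δ) p.1]
  rw [hn] at hk1 hd1 hk2
  have htime : ((n + 1 : ℕ) : ℝ) * h = n * h + h := by push_cast; ring
  set P : ℝ × E := (((n + 1 : ℕ) : ℝ) * h, x k) with hP
  have hPball : P ∈ Metric.ball p R := Metric.mem_ball.2 (by linarith)
  have hball : ∀ y ∈ Metric.ball p R, 0 < y.1 := fun y hy => by
    rw [Metric.mem_ball, Prod.dist_eq, max_lt_iff, Real.dist_eq] at hy
    linarith [(abs_lt.1 hy.1).1, min_le_right (min r δ) p.1]
  have hballS : ∀ y ∈ Metric.ball p R, y.2 ∈ S →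
      |φt' y - φt' p| ≤ η ∧ ‖φx' y - φx' p‖ ≤ η := fun y hy hyS => by
    have h1 := hcont (x := y) ⟨hball y hy, hyS⟩ ((Metric.mem_ball.1 hy).trans_le
      ((min_le_left _ _).trans (min_le_right _ _)))
    rw [Prod.dist_eq, max_lt_iff, Real.dist_eq, dist_eq_norm] at h1
    exact ⟨h1.1.le, h1.2.le⟩
  set g := φx' P with hg
  obtain ⟨z, hz, hstep⟩ := hW.step k n (x k) g η hη0
  have hzL := hF.bound z hz
  set Q : ℝ × E := (n * h, x k + h • z) with hQ
  -- The move stays in `S`, so maximality may be tested at its endpoint even when `x k` is on the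
  -- boundary.
  have hQS : x k + h • z ∈ S := hSZ _ (hxS k) z hz h hh0.le
  have hhz : ‖h • z‖ ≤ R / 2 := by
    rw [norm_smul, Real.norm_eq_abs, abs_of_pos hh0]
    exact (mul_le_mul_of_nonneg_left hzL hh0.le).trans hhL
  have hQball : Q ∈ Metric.ball p R := by
    rw [Metric.mem_ball, Prod.dist_eq, max_lt_iff, Real.dist_eq, dist_eq_norm]
    constructor
    · simp only [hQ]
      rw [abs_lt] at hd1 ⊢
      rw [htime] at hd1
      -- strict bounds from both sides
      constructor <;> linarith [hd1.1, hd1.2]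
    · have e : Q.2 - p.2 = (x k - p.2) + h • z := by simp only [hQ]; abel
      rw [e]
      exact (norm_add_le _ _).trans_lt (by linarith)
  have hmaxQ := hk1 n (x k + h • z) hQS ((Metric.mem_ball.1 hQball).le.trans
    ((min_le_left _ _).trans (min_le_left _ _)))
  have hPS : P ∈ Ioi (0 : ℝ) ×ˢ S := ⟨hball P hPball, hxS k⟩
  have hQS' : Q ∈ Ioi (0 : ℝ) ×ˢ S := ⟨hball Q hQball, hQS⟩
  obtain ⟨ξ, hξ, hslope⟩ := hφ'.exists_eq_slope hS hPS hQS'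
  have hξball : ξ ∈ Metric.ball p R := (convex_ball p R).segment_subset hPball hQball hξ
  have hξS : ξ ∈ Ioi (0 : ℝ) ×ˢ S :=
    ((convex_Ioi (0 : ℝ)).prod hS).segment_subset hPS hQS' hξ
  have hs1 : Q.1 - P.1 = -h := by simp only [hQ, hP]; rw [htime]; ring
  have hs2 : Q.2 - P.2 = h • z := by simp only [hQ, hP]; abel
  rw [hs1, hs2, real_inner_smul_right] at hslope
  rw [← hh] at hstep
  have hmaxQ : W k n (x k + h • z) - φ' Q ≤ W k (n + 1) (x k) - φ' P := hmaxQ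
  have hmain : h * (φt' ξ - inner ℝ (φx' ξ) z - η) ≤ h * (F g - inner ℝ z g) := by
    linarith
  have hmain := le_of_mul_le_mul_left hmain hh0
  have b1 := hballS ξ hξball hξS.2
  have b2 := hballS P hPball hPS.2
  have hinner : inner ℝ (φx' ξ) z - inner ℝ z g ≤ L * (2 * η) := by
    rw [real_inner_comm, ← inner_sub_right]
    refine (real_inner_le_norm _ _).trans (mul_le_mul hzL ?_ (norm_nonneg _) hL)
    have : φx' ξ - g = (φx' ξ - φx' p) - (φx' P - φx' p) := by rw [hg]; abel
    rw [this]
    exact (norm_sub_le _ _).trans (by linarith [b1.2, b2.2])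
  have hFg : F g - F (φx' p) ≤ L * η :=
    (le_abs_self _).trans ((hF.abs_apply_sub_le g (φx' p)).trans (mul_le_mul_of_nonneg_left b2.2 hL))
  linarith [(abs_le.1 b1.1).1]

variable {u : E → ℝ} {M : NNReal}

/-- For a nearly optimal `q`, the answer is the direction of `IsGame.key` for the pair `q`, `g`,
which replaces `q` by the prescribed `g`. -/
theorem IsGame.isApprox (hF : IsGame F Z L) (hu : LipschitzWith M u) :
    IsApprox Z F (fun k => gameIter F Z (meshSize k) u) (gameValue F Z u) where
  continuous k m := (hF.lipschitz_iter hu (meshSize_pos k).le m).continuous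
  equi := ⟨M * L + |F 0|, M, fun k _ _ hp hq => hF.abs_approx_sub_le hu k hp hq⟩
  tendsto _ hp := hF.tendsto_approx hu hp
  step k m x g η hη := by
    have hh := meshSize_pos k
    obtain ⟨q, hq⟩ := hF.exists_of_lt_step (hF.lipschitz_iter hu hh.le m) hh.le
      (show gameStep F Z (meshSize k) (gameIter F Z (meshSize k) u m) x - meshSize k * η
        < gameStep F Z (meshSize k) (gameIter F Z (meshSize k) u m) x by nlinarith)
    obtain ⟨z, hz, hz'⟩ := hF.key q g
    refine ⟨z, hz, ?_⟩
    rw [gameIter_succ]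
    rw [inner_sub_right] at hz'
    have := mul_le_mul_of_nonneg_left hz' hh.le
    linarith [hq z hz]

/-- Here the first player plays `-g`, and `z` is a nearly optimal answer. -/
theorem IsGame.isApprox_neg (hF : IsGame F Z L) (hu : LipschitzWith M u) :
    IsApprox Z (reflect F) (fun k m x => -gameIter F Z (meshSize k) u m x)
      (fun p => -gameValue F Z u p) where
  continuous k m := (hF.lipschitz_iter hu (meshSize_pos k).le m).continuous.neg
  equi := ⟨M * L + |F 0|, M, fun k p q hp hq => by
    rw [neg_sub_neg, abs_sub_comm]; exact hF.abs_approx_sub_le hu k hp hq⟩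
  tendsto _ hp := (hF.tendsto_approx hu hp).neg
  step k m x g η hη := by
    have hh := meshSize_pos k
    obtain ⟨z, hz, hz'⟩ := hF.exists_of_step_lt (hF.lipschitz_iter hu hh.le m) hh.le
      (show gameStep F Z (meshSize k) (gameIter F Z (meshSize k) u m) x
        < gameStep F Z (meshSize k) (gameIter F Z (meshSize k) u m) x + meshSize k * η by nlinarith)
      (-g)
    refine ⟨z, hz, ?_⟩
    rw [gameIter_succ]
    rw [inner_neg_right] at hz'
    simp only [reflect]
    linarith

theorem IsGame.isViscSub_value [FiniteDimensional ℝ E] (hF : IsGame F Z L)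
    (hu : LipschitzWith M u) (hSc : IsClosed S) (hS : Convex ℝ S)
    (hSZ : ∀ x ∈ S, ∀ z ∈ Z, ∀ h : ℝ, 0 ≤ h → x + h • z ∈ S) :
    IsViscSub S F (gameValue F Z u) := by
  obtain ⟨K, hK⟩ := hF.exists_lipschitzOnWith_value hu
  refine ⟨hK.continuousOn.mono (prod_mono_right (subset_univ S)), ?_⟩
  intro p hp φ φt φx hφ hmax
  linarith [(hF.isApprox hu).le_of_isLocalMaxOn hF hSc hS hSZ hφ hp hmax]

theorem IsGame.isViscSuper_value [FiniteDimensional ℝ E] (hF : IsGame F Z L)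
    (hu : LipschitzWith M u) (hSc : IsClosed S) (hS : Convex ℝ S)
    (hSZ : ∀ x ∈ S, ∀ z ∈ Z, ∀ h : ℝ, 0 ≤ h → x + h • z ∈ S) :
    IsViscSuper S F (gameValue F Z u) := by
  obtain ⟨K, hK⟩ := hF.exists_lipschitzOnWith_value hu
  refine ⟨hK.continuousOn.mono (prod_mono_right (subset_univ S)), ?_⟩
  intro p hp φ φt φx hφ hmin
  have := (hF.isApprox_neg hu).le_of_isLocalMaxOn hF.reflected hSc hS hSZ hφ.neg hp (by
    refine hmin.neg.mono fun q hq => ?_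
    linarith)
  simp only [reflect, neg_neg] at this
  linarith

end Viscosity

/-! ### Passage from finite dimension to a Hilbert space -/

section Approximation

variable {E E' : Type*} [NormedAddCommGroup E] [InnerProductSpace ℝ E]
  [NormedAddCommGroup E'] [InnerProductSpace ℝ E']

/-- `p` is the adjoint of the isometry `l`. -/
def IsAdjointOf (l : E' →ₗᵢ[ℝ] E) (p : E →ₗ[ℝ] E') : Prop :=
  ∀ z q, inner ℝ z (l q) = inner ℝ (p z) q

variable {l : E' →ₗᵢ[ℝ] E} {p : E →ₗ[ℝ] E'}

theorem IsAdjointOf.left_inv (h : IsAdjointOf l p) (x : E') : p (l x) = x := by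
  rw [← sub_eq_zero, ← inner_self_eq_zero (𝕜 := ℝ), inner_sub_left, ← h, l.inner_map_map, sub_self]

theorem IsAdjointOf.norm_le (h : IsAdjointOf l p) (z : E) : ‖p z‖ ≤ ‖z‖ := by
  have h1 : ‖p z‖ * ‖p z‖ ≤ ‖z‖ * ‖p z‖ := by
    rw [← real_inner_self_eq_norm_mul_norm, ← h]
    refine (real_inner_le_norm _ _).trans ?_
    rw [l.norm_map]
  rcases (norm_nonneg (p z)).eq_or_lt with h0 | h0
  · rw [← h0]; exact norm_nonneg z
  · exact le_of_mul_le_mul_right h1 h0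

theorem IsAdjointOf.continuous (h : IsAdjointOf l p) : Continuous p :=
  AddMonoidHomClass.continuous_of_bound p 1 fun z => by rw [one_mul]; exact h.norm_le z

theorem IsSmoothTest.comp_isometry (h : IsAdjointOf l p) {S : Set E} {S' : Set E'}
    (hl : MapsTo l S' S) {φ φt : ℝ × E → ℝ} {φx : ℝ × E → E} (hφ : IsSmoothTest S φ φt φx) :
    IsSmoothTest S' (fun q => φ (q.1, l q.2)) (fun q => φt (q.1, l q.2))
      (fun q => p (φx (q.1, l q.2))) := by
  have hc : Continuous fun q : ℝ × E' => (q.1, l q.2) := by fun_prop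
  have hm : MapsTo (fun q : ℝ × E' => (q.1, l q.2)) (Ioi (0 : ℝ) ×ˢ S') (Ioi (0 : ℝ) ×ˢ S) :=
    fun q hq => ⟨hq.1, hl hq.2⟩
  refine ⟨fun q hq => ?_, ?_⟩
  · have h1 := (hφ.expansion _ (hm hq)).comp_tendsto
      ((hc.continuousWithinAt (s := Ioi (0 : ℝ) ×ˢ S')).tendsto_nhdsWithin hm)
    refine (h1.congr_right fun r => ?_).congr_left fun r => ?_
    · simp only [Function.comp_apply, ← map_sub, l.norm_map]
    · simp only [Function.comp_apply, ← map_sub, h _ _]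
  · have h1 := hφ.continuousOn.comp hc.continuousOn hm
    exact (continuous_fst.comp_continuousOn h1).prodMk
      (h.continuous.comp_continuousOn (continuous_snd.comp_continuousOn h1))

/-- Limits of solutions of finite-dimensional approximations are subsolutions. -/
theorem le_of_isLocalMaxOn_of_approx {ι : Type*} {𝓕 : Filter ι} [𝓕.NeBot] {X : ι → Type*}
    [∀ n, NormedAddCommGroup (X n)] [∀ n, InnerProductSpace ℝ (X n)]
    [∀ n, FiniteDimensional ℝ (X n)] {l : ∀ n, X n →ₗᵢ[ℝ] E} {p : ∀ n, E →ₗ[ℝ] X n}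
    (hadj : ∀ n, IsAdjointOf (l n) (p n)) (hlim : ∀ κ, Tendsto (fun n => l n (p n κ)) 𝓕 (𝓝 κ))
    {S : Set E} {S' : ∀ n, Set (X n)} (hS' : ∀ n, IsClosed (S' n))
    (hl : ∀ n, MapsTo (l n) (S' n) S) (hp : ∀ n, MapsTo (p n) S (S' n))
    {H : E → ℝ} {L : ℝ} (hH : ∀ q q', |H q - H q'| ≤ L * ‖q - q'‖)
    {u : ∀ n, ℝ × X n → ℝ} (hucont : ∀ n, ContinuousOn (u n) (Ici (0 : ℝ) ×ˢ S' n))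
    (hu : ∀ n, IsSubAdm (S' n) (fun _ _ => True) (fun b => H (l n b)) (u n))
    {f : ℝ × E → ℝ} {ε : ι → ℝ} (hε : Tendsto ε 𝓕 (𝓝 0))
    (huf : ∀ n t, 0 ≤ t → ∀ x ∈ S' n, u n (t, x) ≤ f (t, l n x) + ε n * (‖x‖ + t * L))
    (hconv : ∀ t, 0 ≤ t → ∀ μ ∈ S, Tendsto (fun n => u n (t, p n μ)) 𝓕 (𝓝 (f (t, μ))))
    {φ φt : ℝ × E → ℝ} {φx : ℝ × E → E} (hφ : IsSmoothTest S φ φt φx) {q : ℝ × E}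
    (hq : q ∈ Ioi (0 : ℝ) ×ˢ S)
    (hmax : IsLocalMaxOn (fun q => f q - φ q) (Ioi (0 : ℝ) ×ˢ S) q) : φt q ≤ H (φx q) := by
  obtain ⟨φ', φt', φx', hφ', ht, hx, ρ, hρ, hstrict⟩ := hφ.exists_strict hmax
  rw [← ht, ← hx]
  clear hφ hmax ht hx φ φt φx
  obtain ⟨hq1, hq2⟩ := hq
  rw [mem_Ioi] at hq1
  set r := min ρ (q.1 / 2) with hr
  have hr0 : 0 < r := lt_min hρ (by positivity)
  have hrt : r ≤ q.1 / 2 := min_le_right _ _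
  -- Balls of the large space are not compact, but their traces on the finite-dimensional subspaces
  -- are; each approximation is maximized there.
  set A : ∀ n, Set (ℝ × X n) := fun n =>
    Icc (q.1 - r) (q.1 + r) ×ˢ (S' n ∩ {x | ‖l n x - q.2‖ ≤ r}) with hA
  have hAcomp : ∀ n, IsCompact (A n) := fun n => by
    have := FiniteDimensional.proper ℝ (X n)
    refine isCompact_Icc.prod ?_
    refine (isCompact_closedBall (0 : X n) (r + ‖q.2‖)).of_isClosed_subset ?_ fun x hx => ?_
    · refine (hS' n).inter (isClosed_le ?_ continuous_const)
      exact ((l n).continuous.sub continuous_const).norm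
    · rw [mem_closedBall_zero_iff, ← (l n).norm_map]
      have := norm_add_le (l n x - q.2) q.2
      rw [sub_add_cancel] at this
      linarith [hx.2.out]
  have hApos : ∀ n, ∀ y ∈ A n, 0 < y.1 := fun n y hy => by linarith [hy.1.1]
  have hAmem : ∀ n, ∀ y ∈ A n, (y.1, l n y.2) ∈ Ioi (0 : ℝ) ×ˢ S := fun n y hy =>
    ⟨hApos n y hy, hl n hy.2.1⟩
  have hex : ∀ n, ∃ a : ℝ × X n, (q.1, p n q.2) ∈ A n → a ∈ A n ∧ ∀ b ∈ A n,
      u n b - φ' (b.1, l n b.2) ≤ u n a - φ' (a.1, l n a.2) := by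
    intro n
    by_cases hne : (q.1, p n q.2) ∈ A n
    · have hcont : ContinuousOn (fun b : ℝ × X n => u n b - φ' (b.1, l n b.2)) (A n) :=
        ((hucont n).mono fun y hy => ⟨(hApos n y hy).le, hy.2.1⟩).sub
          (hφ'.continuousOn_self.comp (by fun_prop) (hAmem n))
      obtain ⟨a, ha, hamax⟩ := (hAcomp n).exists_isMaxOn ⟨_, hne⟩ hcont
      exact ⟨a, fun _ => ⟨ha, fun b hb => hamax hb⟩⟩
    · exact ⟨0, fun h => absurd h hne⟩
  choose a ha using hex
  have hne : ∀ᶠ n in 𝓕, (q.1, p n q.2) ∈ A n := by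
    filter_upwards [(hlim q.2).eventually (Metric.closedBall_mem_nhds q.2 hr0)] with n hn
    exact ⟨⟨by simp only; linarith, by simp only; linarith⟩, hp n hq2, mem_closedBall_iff_norm.1 hn⟩
  set y : ι → ℝ × E := fun n => ((a n).1, l n (a n).2) with hy
  have hyA : ∀ᶠ n in 𝓕, y n ∈ Ioi (0 : ℝ) ×ˢ S ∧ |(y n).1 - q.1| ≤ r ∧ ‖(y n).2 - q.2‖ ≤ r := by
    filter_upwards [hne] with n hn
    have h1 := (ha n hn).1
    refine ⟨hAmem n _ h1, ?_, h1.2.2⟩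
    rw [abs_le]; constructor <;> linarith [h1.1.1, h1.1.2]
  set B := r + ‖q.2‖ + (q.1 + r) * |L| with hB
  have hφlp : Tendsto (fun n => φ' (q.1, l n (p n q.2))) 𝓕 (𝓝 (φ' q)) := by
    refine (hφ'.continuousOn_self q ⟨hq1, hq2⟩).tendsto.comp (tendsto_nhdsWithin_iff.2 ⟨?_, ?_⟩)
    · exact tendsto_const_nhds.prodMk_nhds (hlim q.2)
    · exact Eventually.of_forall fun n => ⟨hq1, hl n (hp n hq2)⟩
  -- Strong convergence of the maximizers comes from the quadratic gain of the strict maximum. Each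
  -- maximizer is compared with the projection of `q`, using the uniform one-sided bound `huf` at
  -- the former and only pointwise convergence at the latter.
  have hd0 : Tendsto (fun n => |(y n).1 - q.1| ^ 2 + ‖(y n).2 - q.2‖ ^ 2) 𝓕 (𝓝 0) := by
    have h1 : Tendsto (fun n => |ε n| * B + (f q - u n (q.1, p n q.2))
        + (φ' (q.1, l n (p n q.2)) - φ' q)) 𝓕 (𝓝 (|0| * B + (f q - f q) + (φ' q - φ' q))) :=
      ((hε.abs.mul_const B).add ((hconv q.1 hq1.le q.2 hq2).const_sub (f q))).add
        (hφlp.sub_const (φ' q))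
    simp only [abs_zero, zero_mul, sub_self, add_zero] at h1
    refine tendsto_of_tendsto_of_tendsto_of_le_of_le' tendsto_const_nhds h1
      (Eventually.of_forall fun n => by positivity) ?_
    filter_upwards [hne, hyA] with n hn hyn
    have h2 := (ha n hn).2 _ hn
    have h3 := hstrict (y n) hyn.1 (by
      rw [Prod.dist_eq, Real.dist_eq, dist_eq_norm]
      exact (max_le hyn.2.1 hyn.2.2).trans (min_le_left _ _))
    have h4 := huf n (a n).1 (hApos n _ (ha n hn).1).le (a n).2 (ha n hn).1.2.1
    have h5 : ε n * (‖(a n).2‖ + (a n).1 * L) ≤ |ε n| * B := by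
      refine (le_abs_self _).trans ?_
      rw [abs_mul]
      refine mul_le_mul_of_nonneg_left ?_ (abs_nonneg _)
      refine (abs_add_le _ _).trans ?_
      rw [abs_norm, abs_mul, abs_of_pos (hApos n _ (ha n hn).1)]
      have e1 : ‖(a n).2‖ ≤ r + ‖q.2‖ := by
        have := norm_add_le (l n (a n).2 - q.2) q.2
        rw [sub_add_cancel, (l n).norm_map] at this
        linarith [hyn.2.2]
      have e2 : (a n).1 * |L| ≤ (q.1 + r) * |L| :=
        mul_le_mul_of_nonneg_right (ha n hn).1.1.2 (abs_nonneg L)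
      linarith
    change u n (a n) ≤ f (y n) + _ at h4
    change _ ≤ u n (a n) - φ' (y n) at h2
    linarith
  have hsq : ∀ {g : ι → ℝ}, (∀ n, g n ^ 2 ≤ |(y n).1 - q.1| ^ 2 + ‖(y n).2 - q.2‖ ^ 2) →
      Tendsto g 𝓕 (𝓝 0) := fun {g} hg => by
    have h1 := squeeze_zero (fun n => sq_nonneg (g n)) hg hd0
    have h2 := h1.sqrt
    simp only [Real.sqrt_sq_eq_abs, Real.sqrt_zero] at h2
    exact (tendsto_zero_iff_abs_tendsto_zero g).2 h2
  have hylim : Tendsto y 𝓕 (𝓝 q) := by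
    rw [tendsto_iff_dist_tendsto_zero]
    refine hsq fun n => ?_
    rw [Prod.dist_eq, Real.dist_eq, dist_eq_norm]
    rcases max_choice |(y n).1 - q.1| ‖(y n).2 - q.2‖ with h | h <;> rw [h]
    · exact le_add_of_nonneg_right (by positivity)
    · exact le_add_of_nonneg_left (by positivity)
  have hineq : ∀ᶠ n in 𝓕, φt' (y n) ≤ H (l n (p n (φx' (y n)))) := by
    filter_upwards [hne, hyA, hylim.eventually (Metric.ball_mem_nhds q hr0)] with n hn hyn hball
    have hmem := (ha n hn).1
    refine hu n (a n) ⟨hApos n _ hmem, hmem.2.1⟩ _ _ _ (hφ'.comp_isometry (hadj n) (hl n)) ?_ trivial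
    have hc : Continuous fun b : ℝ × X n => (b.1, l n b.2) := by fun_prop
    have hopen : ∀ᶠ b in 𝓝 (a n), (b.1, l n b.2) ∈ Metric.ball q r :=
      hc.tendsto (a n) (Metric.isOpen_ball.mem_nhds hball)
    filter_upwards [nhdsWithin_le_nhds hopen, self_mem_nhdsWithin] with b hb hbS
    rw [Metric.mem_ball, Prod.dist_eq, max_lt_iff, Real.dist_eq, dist_eq_norm, abs_lt] at hb
    exact (ha n hn).2 b ⟨⟨by linarith [hb.1.1], by linarith [hb.1.2]⟩, hbS.2, hb.2.le⟩
  have hDlim := (hφ'.continuousOn q ⟨hq1, hq2⟩).tendsto.comp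
    (tendsto_nhdsWithin_iff.2 ⟨hylim, hyA.mono fun n hn => hn.1⟩)
  have hφt := (continuous_fst.tendsto _).comp hDlim
  have hφx := (continuous_snd.tendsto _).comp hDlim
  -- The projections are contractions converging strongly to the identity, so they may be applied to
  -- a convergent sequence of gradients.
  have hgl : Tendsto (fun n => l n (p n (φx' (y n)))) 𝓕 (𝓝 (φx' q)) := by
    have h1 : Tendsto (fun n => l n (p n (φx' (y n) - φx' q))) 𝓕 (𝓝 0) := by
      refine squeeze_zero_norm (fun n => ?_) (tendsto_iff_norm_sub_tendsto_zero.1 hφx)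
      rw [(l n).norm_map]
      exact (hadj n).norm_le _
    have h2 := h1.add (hlim (φx' q))
    rw [zero_add] at h2
    refine h2.congr fun n => ?_
    rw [← map_add, ← map_add, sub_add_cancel]
  have hHc : Continuous H := by
    refine continuous_iff_continuousAt.2 fun κ => tendsto_iff_norm_sub_tendsto_zero.2 ?_
    have h1 : Tendsto (fun κ' => L * ‖κ' - κ‖) (𝓝 κ) (𝓝 0) := by
      have h2 : Continuous fun κ' => L * ‖κ' - κ‖ := by fun_prop
      simpa using h2.tendsto κ
    exact squeeze_zero (fun _ => norm_nonneg _) (fun κ' => hH κ' κ) h1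
  exact le_of_tendsto_of_tendsto hφt ((hHc.tendsto _).comp hgl) hineq

end Approximation

/-! ### Positive semidefinite matrices -/

section Psd

variable {D : ℕ}

/-- The rank-one matrix `v vᵀ`. -/
noncomputable def rankOne (v : Fin D → ℝ) : SymMat D :=
  ⟨WithLp.toLp 2 fun p => v p.1 * v p.2, fun i k => by simp [mul_comm]⟩

theorem inner_symMat (a b : SymMat D) :
    inner ℝ a b = ∑ i, ∑ k, (a : Mat D) (i, k) * (b : Mat D) (i, k) := by
  rw [Submodule.coe_inner, PiLp.inner_apply, Fintype.sum_prod_type]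
  simp [mul_comm]

theorem inner_smul_symMat (c : ℝ) (a b : SymMat D) : inner ℝ (c • a) b = c * inner ℝ a b :=
  real_inner_smul_left a b c

theorem inner_symMat_smul (c : ℝ) (a b : SymMat D) : inner ℝ a (c • b) = c * inner ℝ a b :=
  real_inner_smul_right a b c

theorem mem_psd_iff {a : SymMat D} : a ∈ psd D ↔ ∀ v, 0 ≤ inner ℝ a (rankOne v) := by
  have key : ∀ v : Fin D → ℝ, inner ℝ a (rankOne v)
      = star v ⬝ᵥ (Matrix.of fun i k => (a : Mat D) (i, k)).mulVec v := fun v => by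
    rw [inner_symMat]
    simp only [dotProduct, Matrix.mulVec, Finset.mul_sum, Matrix.of_apply, rankOne, Pi.star_apply,
      star_trivial]
    refine Finset.sum_congr rfl fun i _ => Finset.sum_congr rfl fun k _ => ?_
    ring
  simp only [key]
  constructor
  · intro h v
    exact h.dotProduct_mulVec_nonneg v
  · intro h
    refine Matrix.PosSemidef.of_dotProduct_mulVec_nonneg ?_ h
    ext i k
    simp [a.2 i k]

theorem inner_rankOne (v w : Fin D → ℝ) :
    inner ℝ (rankOne v) (rankOne w) = (v ⬝ᵥ w) ^ 2 := by
  rw [inner_symMat, sq, dotProduct, Finset.sum_mul_sum]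
  refine Finset.sum_congr rfl fun i _ => Finset.sum_congr rfl fun k _ => ?_
  simp only [rankOne]
  ring

theorem rankOne_mem_psd (v : Fin D → ℝ) : rankOne v ∈ psd D :=
  mem_psd_iff.2 fun w => by rw [inner_rankOne]; positivity

theorem norm_rankOne (v : Fin D → ℝ) : ‖rankOne v‖ = v ⬝ᵥ v := by
  have h1 : ‖rankOne v‖ ^ 2 = (v ⬝ᵥ v) ^ 2 := by
    rw [← real_inner_self_eq_norm_sq, inner_rankOne]
  have h2 : 0 ≤ v ⬝ᵥ v := by
    simp only [dotProduct]; exact Finset.sum_nonneg fun i _ => mul_self_nonneg _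
  exact (sq_eq_sq₀ (norm_nonneg _) h2).1 h1

/-- A positive semidefinite matrix is a sum of rank-one matrices `v vᵀ`, against which `a` pairs
nonnegatively. -/
theorem psd_inner_nonneg {a b : SymMat D} (ha : a ∈ psd D) (hb : b ∈ psd D) :
    0 ≤ inner ℝ a b := by
  obtain ⟨m, B, hB⟩ := Matrix.posSemidef_iff_eq_sum_vecMulVec.1 hb
  have hb' : b = ∑ j, rankOne (B j) := by
    refine Subtype.ext (PiLp.ext fun p => ?_)
    have := congrFun (congrFun hB p.1) p.2
    rw [Matrix.sum_apply] at this
    simp only [Matrix.of_apply, Matrix.vecMulVec_apply, star_trivial] at this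
    rw [this, AddSubmonoidClass.coe_finsetSum, WithLp.ofLp_sum, Finset.sum_apply]
    rfl
  rw [hb', inner_sum]
  exact Finset.sum_nonneg fun j _ => mem_psd_iff.1 ha _

theorem isClosedCone_psd : IsClosedCone (psd D) where
  closed := by
    have : psd D = ⋂ v, {a | 0 ≤ inner ℝ a (rankOne v)} := by
      ext a; simp [mem_psd_iff]
    rw [this]
    exact isClosed_iInter fun v => isClosed_le continuous_const (by fun_prop)
  zero_mem := mem_psd_iff.2 fun v => by simp
  add_mem a ha b hb := mem_psd_iff.2 fun v => by
    rw [inner_add_left]; exact add_nonneg (mem_psd_iff.1 ha v) (mem_psd_iff.1 hb v)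
  smul_mem c hc a ha := mem_psd_iff.2 fun v => by
    rw [inner_smul_symMat]; exact mul_nonneg hc (mem_psd_iff.1 ha v)

theorem dualCone_psd : dualCone (psd D) = psd D :=
  Subset.antisymm (fun _ ha => mem_psd_iff.2 fun v => ha _ (rankOne_mem_psd v))
    fun _ ha _ hb => psd_inner_nonneg ha hb

variable (D) in
/-- The identity matrix. -/
noncomputable def idMat : SymMat D :=
  ⟨WithLp.toLp 2 fun p => if p.1 = p.2 then 1 else 0, fun i k => by simp [eq_comm]⟩

theorem inner_idMat_rankOne (v : Fin D → ℝ) : inner ℝ (idMat D) (rankOne v) = v ⬝ᵥ v := by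
  rw [inner_symMat]
  simp [idMat, rankOne, dotProduct]

theorem smul_idMat_add_mem_psd {ρ : ℝ} {b : SymMat D} (hb : ‖b‖ ≤ ρ) : ρ • idMat D + b ∈ psd D := by
  refine mem_psd_iff.2 fun v => ?_
  rw [inner_add_left, inner_smul_symMat, inner_idMat_rankOne]
  have h1 := abs_real_inner_le_norm b (rankOne v)
  rw [norm_rankOne] at h1
  have h2 : 0 ≤ v ⬝ᵥ v := by rw [← norm_rankOne]; positivity
  linarith [neg_abs_le (inner ℝ b (rankOne v)), mul_le_mul_of_nonneg_right hb h2]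

theorem idMat_mem_psd : idMat D ∈ psd D := by
  simpa using smul_idMat_add_mem_psd (D := D) (ρ := 1) (b := 0) (by simp)

/-- The trace. -/
noncomputable def trMat (a : SymMat D) : ℝ := inner ℝ a (idMat D)

theorem trMat_nonneg {a : SymMat D} (ha : a ∈ psd D) : 0 ≤ trMat a :=
  psd_inner_nonneg ha idMat_mem_psd

theorem trMat_add (a b : SymMat D) : trMat (a + b) = trMat a + trMat b := inner_add_left _ _ _

theorem trMat_sub (a b : SymMat D) : trMat (a - b) = trMat a - trMat b := inner_sub_left _ _ _

theorem trMat_smul (c : ℝ) (a : SymMat D) : trMat (c • a) = c * trMat a :=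
  inner_smul_symMat c a _

theorem trMat_le (a : SymMat D) : trMat a ≤ ‖a‖ * ‖idMat D‖ := real_inner_le_norm _ _

/-- By Cauchy-Schwarz `(v ⬝ᵥ v) I - v vᵀ` is positive semidefinite, hence so is `tr(a) I - a`;
pairing the latter with `a` gives `‖a‖ ^ 2 ≤ tr(a) ^ 2`. Increments of increasing matrix paths are
thereby controlled by a scalar monotone function, the trace. -/
theorem norm_le_trMat {a : SymMat D} (ha : a ∈ psd D) : ‖a‖ ≤ trMat a := by
  have h1 : trMat a • idMat D - a ∈ psd D := by
    refine mem_psd_iff.2 fun v => ?_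
    have h2 : (v ⬝ᵥ v) • idMat D - rankOne v ∈ psd D := by
      refine mem_psd_iff.2 fun w => ?_
      rw [inner_sub_left, inner_smul_symMat, inner_idMat_rankOne, inner_rankOne]
      have := Finset.sum_mul_sq_le_sq_mul_sq Finset.univ v w
      simp only [dotProduct, ← sq]
      linarith
    have h3 := psd_inner_nonneg ha h2
    rw [inner_sub_right, inner_symMat_smul] at h3
    rw [inner_sub_left, inner_smul_symMat, inner_idMat_rankOne, trMat]
    linarith
  have h4 := psd_inner_nonneg ha h1
  rw [inner_sub_right, inner_symMat_smul, real_inner_self_eq_norm_sq, ← trMat] at h4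
  exact le_of_sq_le_sq (by nlinarith) (trMat_nonneg ha)

end Psd

/-! ### The cone of increasing step functions -/

section StepCone

variable {D : ℕ} {n : ℕ+}

theorem inner_stepSpace (x y : StepSpace D n) :
    inner ℝ x y = ∑ k : Fin n, (1 / (n : ℝ)) * inner ℝ (x k) (y k) := rfl

instance : FiniteDimensional ℝ (StepSpace D n) :=
  inferInstanceAs (Module.Finite ℝ (Fin n → SymMat D))

theorem pnat_cast_pos (n : ℕ+) : (0 : ℝ) < (n : ℝ) := Nat.cast_pos.2 n.pos

theorem norm_sq_stepSpace (x : StepSpace D n) : ‖x‖ ^ 2 = ∑ k : Fin n, (1 / (n : ℝ)) * ‖x k‖ ^ 2 := by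
  rw [← real_inner_self_eq_norm_sq, inner_stepSpace]
  simp_rw [real_inner_self_eq_norm_sq]

/-- The norm of `L¹`. -/
noncomputable def stepNorm1 (x : StepSpace D n) : ℝ := ∑ k : Fin n, (1 / (n : ℝ)) * ‖x k‖

theorem stepNorm1_le (x : StepSpace D n) : stepNorm1 x ≤ ‖x‖ := by
  have hn := pnat_cast_pos n
  refine le_of_sq_le_sq ?_ (norm_nonneg x)
  rw [norm_sq_stepSpace, stepNorm1, ← Finset.mul_sum, ← Finset.mul_sum, mul_pow]
  have h := sq_sum_le_card_mul_sum_sq (s := (Finset.univ : Finset (Fin n))) (f := fun k => ‖x k‖)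
  rw [Finset.card_univ, Fintype.card_fin] at h
  have h2 := mul_le_mul_of_nonneg_left h (show 0 ≤ (1 / (n : ℝ)) ^ 2 by positivity)
  refine h2.trans (le_of_eq ?_)
  field_simp

theorem stepNorm1_nonneg (x : StepSpace D n) : 0 ≤ stepNorm1 x :=
  Finset.sum_nonneg fun _ _ => by positivity

theorem stepNorm1_add_le (x y : StepSpace D n) : stepNorm1 (x + y) ≤ stepNorm1 x + stepNorm1 y := by
  rw [stepNorm1, stepNorm1, stepNorm1, ← Finset.sum_add_distrib]
  refine Finset.sum_le_sum fun k _ => ?_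
  rw [← mul_add]
  exact mul_le_mul_of_nonneg_left (norm_add_le (x k) (y k)) (by positivity)

theorem stepNorm1_smul (c : ℝ) (x : StepSpace D n) : stepNorm1 (c • x) = |c| * stepNorm1 x := by
  rw [stepNorm1, stepNorm1, Finset.mul_sum]
  refine Finset.sum_congr rfl fun k _ => ?_
  rw [show (c • x) k = c • x k from rfl, norm_smul, Real.norm_eq_abs]
  ring

theorem norm_apply_le (x : StepSpace D n) (k : Fin n) : ‖x k‖ ≤ n * ‖x‖ := by
  have hn := pnat_cast_pos n
  have h1 : (1 / (n : ℝ)) * ‖x k‖ ≤ stepNorm1 x :=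
    Finset.single_le_sum (f := fun k => (1 / (n : ℝ)) * ‖x k‖) (fun _ _ => by positivity)
      (Finset.mem_univ k)
  have h2 := h1.trans (stepNorm1_le x)
  rw [one_div, inv_mul_le_iff₀ hn] at h2
  exact h2

theorem continuous_stepSpace_apply (k : Fin n) : Continuous fun x : StepSpace D n => x k :=
  AddMonoidHomClass.continuous_of_bound
    ({ toFun := fun x => x k, map_add' := fun _ _ => rfl, map_smul' := fun _ _ => rfl } :
      StepSpace D n →ₗ[ℝ] SymMat D) n fun x => norm_apply_le x k

theorem isClosedCone_stepCone : IsClosedCone (stepCone D n) where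
  closed := by
    have : stepCone D n = (⋂ k, (fun x : StepSpace D n => x k) ⁻¹' psd D) ∩
        ⋂ i, ⋂ k, ⋂ _ : i ≤ k, (fun x : StepSpace D n => x k - x i) ⁻¹' psd D := by
      ext x; simp [stepCone]
    rw [this]
    refine (isClosed_iInter fun k => isClosedCone_psd.closed.preimage
      (continuous_stepSpace_apply k)).inter ?_
    exact isClosed_iInter fun i => isClosed_iInter fun k => isClosed_iInter fun _ =>
      isClosedCone_psd.closed.preimage
        ((continuous_stepSpace_apply k).sub (continuous_stepSpace_apply i))
  zero_mem := ⟨fun k => isClosedCone_psd.zero_mem, fun i k _ => by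
    change (0 : SymMat D) - 0 ∈ _
    rw [sub_zero]; exact isClosedCone_psd.zero_mem⟩
  add_mem x hx y hy := ⟨fun k => isClosedCone_psd.add_mem _ (hx.1 k) _ (hy.1 k), fun i k hik => by
    have : (x + y) k - (x + y) i = (x k - x i) + (y k - y i) := by
      change x k + y k - (x i + y i) = _
      abel
    rw [this]
    exact isClosedCone_psd.add_mem _ (hx.2 i k hik) _ (hy.2 i k hik)⟩
  smul_mem c hc x hx := ⟨fun k => isClosedCone_psd.smul_mem c hc _ (hx.1 k), fun i k hik => by
    have : (c • x) k - (c • x) i = c • (x k - x i) := (smul_sub c (x k) (x i)).symm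
    rw [this]
    exact isClosedCone_psd.smul_mem c hc _ (hx.2 i k hik)⟩

theorem stepCone_subset_dualCone : stepCone D n ⊆ dualCone (stepCone D n) := fun x hx y hy => by
  rw [inner_stepSpace]
  exact Finset.sum_nonneg fun k _ => mul_nonneg (by positivity) (psd_inner_nonneg (hx.1 k) (hy.1 k))

/-- A point in the interior of the cone. -/
noncomputable def stepInner (D : ℕ) (n : ℕ+) : StepSpace D n := fun k => ((k : ℕ) + 1 : ℝ) • idMat D

/-- Consecutive coordinates of `stepInner` differ by the identity matrix, which absorbs small
perturbations of the increments. -/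
theorem stepInner_add_mem {x : StepSpace D n} {ρ : ℝ} (hx : ∀ k, 2 * ‖x k‖ ≤ ρ) :
    ρ • stepInner D n + x ∈ stepCone D n := by
  have hval : ∀ k, (ρ • stepInner D n + x) k = (ρ * ((k : ℕ) + 1)) • idMat D + x k := fun k => by
    rw [mul_smul]; rfl
  refine ⟨fun k => ?_, fun i k hik => ?_⟩
  · rw [hval]
    refine smul_idMat_add_mem_psd ?_
    nlinarith [hx k, norm_nonneg (x k), (Nat.cast_nonneg (k : ℕ) : (0 : ℝ) ≤ _)]
  · rcases hik.eq_or_lt with rfl | hlt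
    · rw [sub_self]; exact isClosedCone_psd.zero_mem
    · have : (ρ • stepInner D n + x) k - (ρ • stepInner D n + x) i
          = (ρ * ((k : ℕ) - (i : ℕ) : ℝ)) • idMat D + (x k - x i) := by
        rw [hval, hval]; module
      rw [this]
      refine smul_idMat_add_mem_psd ?_
      have h1 : ((i : ℕ) : ℝ) + 1 ≤ (k : ℕ) := by exact_mod_cast hlt
      nlinarith [hx k, hx i, norm_nonneg (x k), norm_sub_le (x k) (x i)]

theorem stepInner_ball {x : StepSpace D n} (hx : ‖x‖ ≤ 1 / (2 * n)) :
    stepInner D n + x ∈ stepCone D n := by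
  have hn := pnat_cast_pos n
  have := stepInner_add_mem (x := x) (ρ := 1) fun k => by
    have h1 := norm_apply_le x k
    have h2 := mul_le_mul_of_nonneg_left hx hn.le
    have h3 : (n : ℝ) * (1 / (2 * n)) = 1 / 2 := by field_simp
    linarith
  rwa [one_smul] at this

theorem stepInner_mem_interior : stepInner D n ∈ interior (stepCone D n) := by
  have hn := pnat_cast_pos n
  rw [mem_interior_iff_mem_nhds]
  refine Filter.mem_of_superset (Metric.closedBall_mem_nhds _ (show 0 < 1 / (2 * (n : ℝ)) by positivity))
    fun y hy => ?_
  have := stepInner_ball (x := y - stepInner D n) (mem_closedBall_iff_norm.1 hy)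
  rwa [add_sub_cancel] at this

/-- The sums of the last coordinates. -/
noncomputable def tailSum (d : StepSpace D n) (j : ℕ) : SymMat D :=
  ∑ k : Fin n, if j ≤ (k : ℕ) then d k else 0

theorem tailSum_self (d : StepSpace D n) : tailSum d n = 0 :=
  Finset.sum_eq_zero fun k _ => if_neg (by have := k.2; omega)

theorem tailSum_sub_succ (d : StepSpace D n) (k : Fin n) :
    tailSum d k - tailSum d (k + 1) = d k := by
  rw [tailSum, tailSum, ← Finset.sum_sub_distrib, Finset.sum_eq_single k]
  · simp
  · intro i _ hik
    have : (i : ℕ) ≠ k := fun h => hik (Fin.ext h)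
    by_cases h : (k : ℕ) ≤ i
    · rw [if_pos h, if_pos (by omega), sub_self]
    · rw [if_neg h, if_neg (by omega), sub_self]
  · simp

/-- Duality is tested on the step functions jumping from `0` to `b` at index `j`. -/
theorem tailSum_mem_psd {d : StepSpace D n} (hd : d ∈ dualCone (stepCone D n)) (j : ℕ) :
    tailSum d j ∈ psd D := by
  have hn := pnat_cast_pos n
  rw [← dualCone_psd]
  intro b hb
  set y : StepSpace D n := fun k => if j ≤ (k : ℕ) then b else 0 with hy
  have h1 := hd y ⟨fun k => ?_, fun i k hik => ?_⟩
  · rw [inner_stepSpace, ← Finset.mul_sum] at h1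
    have h2 : ∑ k : Fin n, inner ℝ (d k) (y k)
        = inner ℝ (tailSum d j) b := by
      rw [tailSum, sum_inner]
      refine Finset.sum_congr rfl fun k _ => ?_
      simp only [hy]
      split_ifs <;> simp
    rw [h2] at h1
    exact nonneg_of_mul_nonneg_right h1 (by positivity)
  · simp only [hy]
    split_ifs
    · exact hb
    · exact isClosedCone_psd.zero_mem
  · simp only [hy]
    have : (i : ℕ) ≤ k := hik
    split_ifs
    · rw [sub_self]; exact isClosedCone_psd.zero_mem
    · rwa [sub_zero]
    · omega
    · rw [sub_self]; exact isClosedCone_psd.zero_mem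

theorem norm_tailSum_le (d : StepSpace D n) (j : ℕ) : ‖tailSum d j‖ ≤ ∑ k : Fin n, ‖d k‖ := by
  refine norm_sum_le_of_le _ fun k _ => ?_
  split_ifs <;> simp

/-- The functional `∫ ξb` on step functions. -/
noncomputable def stepFunctional (ξb : SymMat D → ℝ) (n : ℕ+) (a : StepSpace D n) : ℝ :=
  ∑ k : Fin n, (1 / (n : ℝ)) * ξb (a k)

theorem stepNonlin_eq (ξb : SymMat D → ℝ) (n : ℕ+) :
    stepNonlin ξb n = coneExt (stepCone D n) (stepFunctional ξb n) := rfl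

variable {ξb : SymMat D → ℝ} {L : NNReal}

theorem lipschitzOn_stepFunctional (h : LipschitzOnWith L ξb (psd D)) :
    LipschitzOnWith L (stepFunctional ξb n) (stepCone D n) := by
  refine LipschitzOnWith.of_dist_le_mul fun x hx y hy => ?_
  rw [Real.dist_eq, dist_eq_norm, stepFunctional, stepFunctional, ← Finset.sum_sub_distrib]
  refine (Finset.abs_sum_le_sum_abs _ _).trans ?_
  refine le_trans ?_ (mul_le_mul_of_nonneg_left (stepNorm1_le (x - y)) L.2)
  rw [stepNorm1, Finset.mul_sum]
  refine Finset.sum_le_sum fun k _ => ?_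
  rw [← mul_sub, abs_mul, abs_of_nonneg (by positivity)]
  have := h.dist_le_mul _ (hx.1 k) _ (hy.1 k)
  rw [Real.dist_eq, dist_eq_norm] at this
  calc _ ≤ 1 / (n : ℝ) * (L * ‖x k - y k‖) := mul_le_mul_of_nonneg_left this (by positivity)
    _ = L * (1 / (n : ℝ) * ‖(x - y) k‖) := by rw [show (x - y) k = x k - y k from rfl]; ring

/-- Small transfers towards the last coordinates increase the functional. -/
theorem stepFunctional_le_add_smul (hξ : IsProperFn D ξb) {w d : StepSpace D n}
    (hw : w ∈ stepCone D n) (hd : d ∈ dualCone (stepCone D n)) {ε ρ : ℝ} (hε : 0 ≤ ε)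
    (hερ : ε * ∑ k : Fin n, ‖d k‖ ≤ ρ) :
    stepFunctional ξb n (w + ρ • stepInner D n)
      ≤ stepFunctional ξb n (w + ρ • stepInner D n + ε • d) := by
  set W : StepSpace D n := w + ρ • stepInner D n with hW
  have hWk : ∀ k, W k = w k + (ρ * ((k : ℕ) + 1)) • idMat D := fun k => by
    rw [mul_smul]; rfl
  have hρ0 : 0 ≤ ρ := le_trans (mul_nonneg hε (Finset.sum_nonneg fun _ _ => norm_nonneg _)) hερ
  have hD := tailSum_mem_psd hd
  have hDn : ∀ j, ‖ε • tailSum d j‖ ≤ ρ := fun j => by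
    rw [norm_smul, Real.norm_eq_abs, abs_of_nonneg hε]
    exact (mul_le_mul_of_nonneg_left (norm_tailSum_le d j) hε).trans hερ
  have hdn : ∀ k, ‖ε • d k‖ ≤ ρ := fun k => by
    rw [norm_smul, Real.norm_eq_abs, abs_of_nonneg hε]
    exact (mul_le_mul_of_nonneg_left (Finset.single_le_sum (f := fun k => ‖d k‖)
      (fun _ _ => norm_nonneg _) (Finset.mem_univ k)) hε).trans hερ
  -- The shift by `ρ • stepInner D n` makes room for these base points, which are positive
  -- semidefinite and increasing in `k`.
  have hlow : ∀ k : Fin n, W k - ε • tailSum d (k + 1) ∈ psd D := fun k => by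
    have h1 : W k - ε • tailSum d (k + 1)
        = w k + ((ρ * ((k : ℕ) + 1)) • idMat D + -(ε • tailSum d (k + 1))) := by rw [hWk]; abel
    rw [h1]
    refine isClosedCone_psd.add_mem _ (hw.1 k) _ (smul_idMat_add_mem_psd ?_)
    rw [norm_neg]
    exact (hDn _).trans (by nlinarith [(Nat.cast_nonneg (k : ℕ) : (0 : ℝ) ≤ _)])
  have hWd : ∀ k : Fin n, (W + ε • d) k = W k - ε • tailSum d (k + 1) + ε • tailSum d k := fun k => by
    change W k + ε • d k = _
    rw [← tailSum_sub_succ d k]; module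
  set A : ℕ → ℝ := fun k => if h : k < n then ξb ((W + ε • d) ⟨k, h⟩)
    - ξb (W ⟨k, h⟩ - ε • tailSum d (k + 1)) else 0 with hA
  set B : ℕ → ℝ := fun k => if h : k < n then ξb (W ⟨k, h⟩)
    - ξb (W ⟨k, h⟩ - ε • tailSum d (k + 1)) else 0 with hB
  -- Abel summation. From the base point of index `k`, adding `ε • tailSum d (k + 1)` gives `W k`
  -- and adding `ε • tailSum d k` gives `(W + ε • d) k`. So `B k` and `A (k + 1)` involve the same
  -- increment at ordered base points, and properness gives `B k ≤ A (k + 1)`. The unmatched terms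
  -- are the last `B`, which vanishes, and `A 0 ≥ 0`.
  have hAB : ∑ k ∈ Finset.range n, B k ≤ ∑ k ∈ Finset.range n, A k := by
    obtain ⟨N, hN⟩ := Nat.exists_eq_succ_of_ne_zero n.ne_zero
    rw [hN, Nat.succ_eq_add_one, Finset.sum_range_succ, Finset.sum_range_succ']
    have hlast : B N = 0 := by
      have : N < n := by omega
      simp only [hB]
      rw [dif_pos this, show N + 1 = (n : ℕ) by omega, tailSum_self, smul_zero, sub_zero, sub_self]
    have hfirst : 0 ≤ A 0 := by
      simp only [hA]
      rw [dif_pos n.pos, sub_nonneg, hWd]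
      refine hξ.1 _ (isClosedCone_psd.add_mem _ (hlow _) _ (isClosedCone_psd.smul_mem _ hε _ (hD _)))
        _ (hlow ⟨0, n.pos⟩) ?_
      rw [add_sub_cancel_left]
      exact isClosedCone_psd.smul_mem _ hε _ (hD _)
    refine add_le_add (Finset.sum_le_sum fun k hk => ?_) (by rw [hlast]; exact hfirst)
    rw [Finset.mem_range] at hk
    have h1 : k < n := by omega
    have h2 : k + 1 < n := by omega
    simp only [hA, hB]
    rw [dif_pos h1, dif_pos h2, hWd]
    have h3 := hξ.2 (ε • tailSum d (k + 1)) (isClosedCone_psd.smul_mem _ hε _ (hD _))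
      _ (hlow ⟨k + 1, h2⟩) _ (hlow ⟨k, h1⟩) ?_
    · simp only [sub_add_cancel] at h3
      exact h3
    · have h4 := tailSum_sub_succ d ⟨k + 1, h2⟩
      simp only at h4
      have h5 : W ⟨k + 1, h2⟩ - ε • tailSum d (k + 1 + 1) - (W ⟨k, h1⟩ - ε • tailSum d (k + 1))
          = (w ⟨k + 1, h2⟩ - w ⟨k, h1⟩) + (ρ • idMat D + ε • d ⟨k + 1, h2⟩) := by
        rw [← h4, hWk, hWk]
        push_cast
        module
      simp only
      rw [h5]
      exact isClosedCone_psd.add_mem _ (hw.2 _ _ (by simp)) _ (smul_idMat_add_mem_psd (hdn _))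
  have hsum : ∀ g : Fin n → ℝ, ∑ k ∈ Finset.range n, (if h : k < n then g ⟨k, h⟩ else 0)
      = ∑ k : Fin n, g k := fun g => by
    rw [Finset.sum_range]
    refine Finset.sum_congr rfl fun k _ => ?_
    rw [dif_pos k.2]
  have hA' := hsum fun k => ξb ((W + ε • d) k) - ξb (W k - ε • tailSum d (k + 1))
  have hB' := hsum fun k => ξb (W k) - ξb (W k - ε • tailSum d (k + 1))
  simp only [hA, hB] at hAB
  rw [hA', hB', Finset.sum_sub_distrib, Finset.sum_sub_distrib, sub_le_sub_iff_right] at hAB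
  rw [stepFunctional, stepFunctional, ← Finset.mul_sum, ← Finset.mul_sum]
  exact mul_le_mul_of_nonneg_left hAB (by positivity)

/-- The segment from `y` to `x` is cut into small transfers after a shift by `ρ • stepInner D n`;
then `ρ → 0` by Lipschitz continuity. -/
theorem increasing_stepFunctional (hξ : IsProperFn D ξb) (hL : LipschitzOnWith L ξb (psd D)) :
    IncreasingAlong (dualCone (stepCone D n)) (stepCone D n) (stepFunctional ξb n) := by
  intro x hx y hy hxy
  set d := x - y with hd
  have hshift : ∀ ρ : ℝ, 0 < ρ → stepFunctional ξb n (y + ρ • stepInner D n)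
      ≤ stepFunctional ξb n (x + ρ • stepInner D n) := by
    intro ρ hρ
    obtain ⟨N, hN⟩ := exists_nat_gt ((∑ k : Fin n, ‖d k‖) / ρ)
    have hS : 0 ≤ ∑ k : Fin n, ‖d k‖ := Finset.sum_nonneg fun _ _ => norm_nonneg _
    have hN0 : (0 : ℝ) < N := lt_of_le_of_lt (by positivity) hN
    rw [div_lt_iff₀ hρ] at hN
    have hstep : ∀ i : ℕ, i ≤ N → stepFunctional ξb n (y + ρ • stepInner D n)
        ≤ stepFunctional ξb n (y + ((i : ℝ) / N) • d + ρ • stepInner D n) := by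
      intro i
      induction i with
      | zero => intro _; simp
      | succ i ih =>
        intro hi
        refine (ih (by omega)).trans ?_
        have hmem : y + ((i : ℝ) / N) • d ∈ stepCone D n :=
          isClosedCone_stepCone.convex.add_smul_sub_mem hy hx
            ⟨by positivity, by rw [div_le_one hN0]; exact_mod_cast (by omega : i ≤ N)⟩
        have h1 := stepFunctional_le_add_smul hξ hmem hxy (ε := 1 / N) (ρ := ρ) (by positivity)
          (by rw [one_div, inv_mul_le_iff₀ hN0]; exact hN.le)
        refine h1.trans (le_of_eq ?_)
        congr 1
        push_cast
        rw [add_div]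
        module
    have := hstep N le_rfl
    rwa [div_self hN0.ne', one_smul, hd, add_sub_cancel] at this
  have hlip := lipschitzOn_stepFunctional (n := n) hL
  have he : stepInner D n ∈ stepCone D n := by
    have := stepInner_ball (D := D) (n := n) (x := 0) (by rw [norm_zero]; positivity)
    rwa [add_zero] at this
  have hnear : ∀ z ∈ stepCone D n, ∀ ρ > 0, |stepFunctional ξb n (z + ρ • stepInner D n)
      - stepFunctional ξb n z| ≤ L * (ρ * ‖stepInner D n‖) := by
    intro z hz ρ hρ
    have := hlip.dist_le_mul _ (isClosedCone_stepCone.add_mem z hz _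
      (isClosedCone_stepCone.smul_mem ρ hρ.le _ he)) z hz
    rwa [Real.dist_eq, dist_eq_norm, add_sub_cancel_left, norm_smul, Real.norm_eq_abs,
      abs_of_pos hρ] at this
  refine le_of_forall_pos_le_add fun ε hε => ?_
  have hK : (0 : ℝ) ≤ L * ‖stepInner D n‖ := by positivity
  set ρ := ε / (2 * (L * ‖stepInner D n‖ + 1)) with hρ
  have hρ0 : 0 < ρ := by positivity
  have hρε : 2 * (L * ‖stepInner D n‖ + 1) * ρ = ε := by rw [hρ]; field_simp
  have h1 := hshift ρ hρ0
  have h2 := (abs_le.1 (hnear x hx ρ hρ0)).2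
  have h3 := (abs_le.1 (hnear y hy ρ hρ0)).1
  linarith

theorem isConeFunctional_step (hξ : IsProperFn D ξb) (hL : LipschitzOnWith L ξb (psd D)) :
    IsConeFunctional (stepCone D n) (stepFunctional ξb n) L :=
  ⟨stepCone_subset_dualCone, lipschitzOn_stepFunctional hL, increasing_stepFunctional hξ hL⟩

end StepCone

/-! ### Existence of regularizations -/

section Regularization

variable {D : ℕ}

/-- The regularization is `max ξ g` for small traces and `g` beyond, where `g` is affine in the
trace with slope `2 * Lx`, twice what is needed to dominate the growth of `ξ`. On the unit ball the
trace is at most `c`, so `g ≤ ξ 0 ≤ ξ`. For trace between `2 * c` and `2 * R` one has `ξ ≤ g`, so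
the two definitions agree there and can be glued. -/
theorem exists_isRegularization {ξ : Mat D → ℝ} (hξ : LocallyLipschitz ξ)
    (hproper : IsProperFn D (fun a : SymMat D => ξ (a : Mat D))) : ∃ ξb, IsRegularization ξ ξb := by
  classical
  set c : ℝ := ‖idMat D‖ with hc
  have hc0 : 0 ≤ c := norm_nonneg _
  set R : ℝ := 2 * c + 1 with hR
  have hR0 : 0 < R := by positivity
  obtain ⟨Lx, hLx⟩ := (hξ.locallyLipschitzOn (s := Metric.closedBall (0 : Mat D) (2 * R))).exists_lipschitzOnWith_of_compact
    (isCompact_closedBall _ _)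
  have hL0 : (0 : ℝ) ≤ Lx := Lx.2
  set g : SymMat D → ℝ := fun a => ξ (0 : SymMat D) + 2 * Lx * (trMat a - c) with hg
  have hball : ∀ a ∈ psd D, trMat a ≤ 2 * R → (a : Mat D) ∈ Metric.closedBall (0 : Mat D) (2 * R) :=
    fun a ha h => by
      rw [mem_closedBall_zero_iff]
      exact (norm_le_trMat ha).trans h
  have hξlip : ∀ a ∈ psd D, ∀ b ∈ psd D, trMat a ≤ 2 * R → trMat b ≤ 2 * R →
      |ξ a - ξ b| ≤ Lx * ‖a - b‖ := fun a ha b hb h1 h2 => by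
    have := hLx.dist_le_mul _ (hball a ha h1) _ (hball b hb h2)
    rw [Real.dist_eq, dist_eq_norm] at this
    exact this
  have hz : (0 : SymMat D) ∈ psd D := isClosedCone_psd.zero_mem
  have htr0 : trMat (0 : SymMat D) = 0 := by simp [trMat]
  have hξup : ∀ a ∈ psd D, trMat a ≤ 2 * R → ξ a ≤ ξ (0 : SymMat D) + Lx * trMat a :=
    fun a ha h => by
      have h1 := hξlip a ha 0 hz h (by rw [htr0]; positivity)
      rw [sub_zero] at h1
      have h2 := mul_le_mul_of_nonneg_left (norm_le_trMat ha) hL0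
      linarith [le_abs_self (ξ a - ξ (0 : SymMat D))]
  set θ : SymMat D → ℝ := fun a => if trMat a ≤ R then max (ξ a - g a) 0 else 0 with hθ
  have hw_neg : ∀ a ∈ psd D, R ≤ trMat a → trMat a ≤ 2 * R → ξ a - g a ≤ 0 := fun a ha h1 h2 => by
    have := hξup a ha h2
    simp only [hg]
    nlinarith
  have hθ_region : ∀ a ∈ psd D, trMat a ≤ 2 * R → θ a = max (ξ a - g a) 0 := fun a ha h => by
    simp only [hθ]
    split_ifs with h1
    · rfl
    · rw [max_eq_right (hw_neg a ha (not_le.1 h1).le h)]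
  have hθ_zero : ∀ a ∈ psd D, R ≤ trMat a → θ a = 0 := fun a ha h => by
    simp only [hθ]
    split_ifs with h1
    · exact max_eq_right (hw_neg a ha h (by linarith))
    · rfl
  have hθ0 : ∀ a, 0 ≤ θ a := fun a => by
    simp only [hθ]
    split_ifs
    · exact le_max_right _ _
    · exact le_rfl
  have htr_le : ∀ a ∈ psd D, ∀ b ∈ psd D, b - a ∈ psd D → trMat a ≤ trMat b := fun a _ b _ h => by
    have := trMat_nonneg h
    rw [trMat_sub] at this
    linarith
  have hw_anti : ∀ a ∈ psd D, ∀ b ∈ psd D, b - a ∈ psd D → trMat b ≤ 2 * R →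
      ξ b - g b ≤ ξ a - g a := fun a ha b hb hab h => by
    have h1 := hξlip b hb a ha h ((htr_le a ha b hb hab).trans h)
    have h2 := mul_le_mul_of_nonneg_left (norm_le_trMat hab) hL0
    have h3 := mul_nonneg hL0 (trMat_nonneg hab)
    rw [trMat_sub] at h2 h3
    simp only [hg]
    linarith [le_abs_self (ξ b - ξ a)]
  -- `g` increases faster than `ξ`, so the excess `θ`, the positive part of `ξ - g`, is decreasing.
  have hθ_anti : ∀ a ∈ psd D, ∀ b ∈ psd D, b - a ∈ psd D → θ b ≤ θ a := fun a ha b hb hab => by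
    by_cases h : trMat b ≤ R
    · rw [hθ_region a ha (by linarith [htr_le a ha b hb hab]), hθ_region b hb (by linarith)]
      exact max_le_max (hw_anti a ha b hb hab (by linarith)) le_rfl
    · rw [hθ_zero b hb (not_le.1 h).le]; exact hθ0 a
  have hpos : ∀ a, θ a ≠ 0 → trMat a ≤ R ∧ θ a = ξ a - g a := fun a h => by
    simp only [hθ] at h ⊢
    split_ifs at h ⊢ with h1
    · refine ⟨h1, ?_⟩
      rcases max_choice (ξ a - g a) 0 with h2 | h2
      · exact h2
      · exact absurd h2 h
    · exact absurd rfl h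
  have hge_g : ∀ a, g a ≤ g a + θ a := fun a => by linarith [hθ0 a]
  have hge_ξ : ∀ a ∈ psd D, trMat a ≤ 2 * R → ξ a ≤ g a + θ a := fun a ha h => by
    rw [hθ_region a ha h]
    linarith [le_max_left (ξ a - g a) 0]
  have hg_conv : ∀ x y : SymMat D, ∀ t : ℝ, g (y + t • (x - y)) = (1 - t) * g y + t * g x :=
    fun x y t => by
      simp only [hg, trMat_add, trMat_smul, trMat_sub]; ring
  refine ⟨fun a => g a + θ a, ?_, ?_, ?_, ?_⟩
  · intro a ha ha1
    have h1 : trMat a ≤ c := (trMat_le a).trans (mul_le_of_le_one_left hc0 ha1)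
    have h2 : ξ (0 : SymMat D) ≤ ξ a := hproper.1 a ha 0 hz (by rwa [sub_zero])
    have h3 : g a ≤ ξ a := by
      simp only [hg]; nlinarith
    rw [hθ_region a ha (by linarith), max_eq_left (by linarith)]
    ring
  · refine ⟨Lx * (1 + 4 * ‖idMat D‖₊), LipschitzOnWith.of_dist_le_mul fun x hx y hy => ?_⟩
    rw [Real.dist_eq, dist_eq_norm]
    push_cast
    rw [← hc]
    have htr : |trMat (x - y)| ≤ c * ‖x - y‖ := by
      rw [mul_comm]; exact abs_real_inner_le_norm _ _
    have hgl : |g x - g y| ≤ 2 * Lx * (c * ‖x - y‖) := by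
      have : g x - g y = 2 * Lx * trMat (x - y) := by simp only [hg, trMat_sub]; ring
      rw [this, abs_mul, abs_of_nonneg (by positivity)]
      exact mul_le_mul_of_nonneg_left htr (by positivity)
    have hθM : ∀ a ∈ psd D, θ a ≤ 2 * Lx * c := fun a ha => by
      simp only [hθ]
      have h0 : 0 ≤ 2 * (Lx : ℝ) * c := by positivity
      split_ifs with h1
      · refine max_le ?_ h0
        have := hξup a ha (by linarith)
        simp only [hg]
        nlinarith [mul_nonneg hL0 (trMat_nonneg ha)]
      · exact h0
    have hfar : ∀ x ∈ psd D, ∀ y ∈ psd D, 2 * R < trMat x →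
        |θ x - θ y| ≤ Lx * (1 + 2 * c) * ‖x - y‖ := by
      intro x hx y hy h
      rw [hθ_zero x hx (by linarith), zero_sub, abs_neg, abs_of_nonneg (hθ0 y)]
      by_cases h2 : R ≤ trMat y
      · rw [hθ_zero y hy h2]; positivity
      · have h3 : R ≤ c * ‖x - y‖ := by
          have := (le_abs_self _).trans (show |trMat (x - y)| ≤ c * ‖x - y‖ by
            rw [mul_comm]; exact abs_real_inner_le_norm _ _)
          rw [trMat_sub] at this
          linarith
        have h4 := hθM y hy
        have h5 : 2 * (Lx : ℝ) * c ≤ 2 * Lx * (c * ‖x - y‖) :=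
          mul_le_mul_of_nonneg_left (by linarith) (by positivity)
        have h6 := mul_nonneg hL0 (norm_nonneg (x - y))
        linarith
    have hθl : |θ x - θ y| ≤ Lx * (1 + 2 * c) * ‖x - y‖ := by
      by_cases h1 : 2 * R < trMat x
      · exact hfar x hx y hy h1
      by_cases h2 : 2 * R < trMat y
      · rw [abs_sub_comm, norm_sub_rev]; exact hfar y hy x hx h2
      rw [hθ_region x hx (not_lt.1 h1), hθ_region y hy (not_lt.1 h2)]
      refine (abs_max_sub_max_le_abs _ _ _).trans ?_
      have h3 := hξlip x hx y hy (not_lt.1 h1) (not_lt.1 h2)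
      have h4 : ξ x - g x - (ξ y - g y) = (ξ x - ξ y) - (g x - g y) := by ring
      rw [h4]
      refine (abs_sub _ _).trans ?_
      linarith
    have : g x + θ x - (g y + θ y) = (g x - g y) + (θ x - θ y) := by ring
    rw [this]
    refine (abs_add_le _ _).trans ?_
    linarith
  · refine ⟨fun x hx y hy hxy => ?_, fun b hb x hx y hy hxy => ?_⟩
    · simp only
      have htr := htr_le y hy x hx hxy
      have hg_le : g y ≤ g x := by
        simp only [hg]; nlinarith
      by_cases h1 : R ≤ trMat y
      · rw [hθ_zero y hy h1, hθ_zero x hx (h1.trans htr)]; linarith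
      rw [not_le] at h1
      rw [hθ_region y hy (by linarith)]
      rcases max_choice (ξ y - g y) 0 with h2 | h2 <;> rw [h2]
      · by_cases h3 : trMat x ≤ 2 * R
        · have h4 := hproper.1 x hx y hy hxy
          simp only at h4
          linarith [hge_ξ x hx h3]
        · rw [not_le] at h3
          have h4 := hξup y hy (by linarith)
          have h5 : g x ≤ g x + θ x := hge_g x
          have h6 : ξ (0 : SymMat D) + Lx * trMat y ≤ g x := by
            simp only [hg]; nlinarith
          linarith
      · linarith [hge_g x]
    · simp only
      have hxb := isClosedCone_psd.add_mem x hx b hb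
      have hyb := isClosedCone_psd.add_mem y hy b hb
      have hgg : g (x + b) - g x = g (y + b) - g y := by
        simp only [hg, trMat_add]; ring
      -- If `θ (y + b)` or `θ x` vanishes, monotonicity of `θ` suffices. Otherwise both equal `ξ -
      -- g`, and properness of `ξ` applies since all traces are at most `2 * R`.
      have hmain : θ (y + b) - θ y ≤ θ (x + b) - θ x := by
        have e1 : θ x ≤ θ y := hθ_anti y hy x hx hxy
        have e2 : θ (y + b) ≤ θ y := hθ_anti y hy _ hyb (by rwa [add_sub_cancel_left])
        by_cases h1 : θ (y + b) = 0
        · linarith [hθ0 (x + b)]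
        by_cases h2 : θ x = 0
        · linarith [hθ0 (x + b)]
        obtain ⟨t1, v1⟩ := hpos _ h1
        obtain ⟨t2, v2⟩ := hpos _ h2
        have t3 : trMat (x + b) ≤ 2 * R := by
          rw [trMat_add] at t1 ⊢
          linarith [trMat_nonneg hy]
        have v3 : ξ (x + b : SymMat D) - g (x + b) ≤ θ (x + b) := by
          rw [hθ_region _ hxb t3]; exact le_max_left _ _
        have v4 : ξ y - g y ≤ θ y := by
          rw [hθ_region _ hy (by linarith [htr_le y hy x hx hxy])]; exact le_max_left _ _
        have h3 := hproper.2 b hb x hx y hy hxy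
        simp only at h3
        linarith
      linarith
  · intro hconv
    refine ⟨isClosedCone_psd.convex, ?_⟩
    have hfar : ∀ x ∈ psd D, ∀ y ∈ psd D, ∀ t : ℝ, 0 ≤ t → t ≤ 1 → 2 * R < trMat x →
        trMat (y + t • (x - y)) < R →
        ξ (y + t • (x - y) : SymMat D) ≤ (1 - t) * (g y + θ y) + t * (g x + θ x) := by
      intro x hx y hy t ht0 ht1 h1 h2
      have htz : trMat (y + t • (x - y)) = trMat y + t * (trMat x - trMat y) := by
        rw [trMat_add, trMat_smul, trMat_sub]
      rw [htz] at h2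
      have hy1 : trMat y < R := by
        by_contra h
        rw [not_lt] at h
        nlinarith
      have hden : 0 < trMat x - trMat y := by linarith
      -- The segment from `y` to `x` is cut where the trace equals `2 * R`. There `ξ ≤ g`, so
      -- convexity of `ξ` up to the cut and affinity of `g` give the bound.
      set κ : ℝ := (2 * R - trMat y) / (trMat x - trMat y) with hκ
      have hκ0 : 0 < κ := div_pos (by linarith) hden
      have hκ1 : κ ≤ 1 := by rw [hκ, div_le_one hden]; linarith
      have hκe : κ * (trMat x - trMat y) = 2 * R - trMat y := by rw [hκ]; field_simp
      have htκ : t ≤ κ := by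
        refine le_of_mul_le_mul_right ?_ hden
        linarith
      set x' : SymMat D := y + κ • (x - y) with hx'
      have hx'psd : x' ∈ psd D := isClosedCone_psd.convex.add_smul_sub_mem hy hx ⟨hκ0.le, hκ1⟩
      have hx'tr : trMat x' = 2 * R := by
        rw [hx', trMat_add, trMat_smul, trMat_sub]; linarith
      set s : ℝ := t / κ with hs
      have hs0 : 0 ≤ s := by positivity
      have hs1 : s ≤ 1 := by rw [hs, div_le_one hκ0]; exact htκ
      have hsκ : s * κ = t := by rw [hs]; field_simp
      have hzeq : y + t • (x - y) = (1 - s) • y + s • x' := by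
        rw [hx', ← hsκ]; module
      have h3 := hconv.2 hy hx'psd (show 0 ≤ 1 - s by linarith) hs0 (by ring)
      simp only [smul_eq_mul] at h3
      rw [hzeq]
      have h4 : ξ x' ≤ g x' := by linarith [hw_neg x' hx'psd (by linarith) (by linarith)]
      rw [hx', hg_conv, ← hx'] at h4
      have h5 : ξ y ≤ g y + θ y := hge_ξ y hy (by linarith)
      have h6 := mul_le_mul_of_nonneg_left (hge_g y) (show 0 ≤ 1 - κ by linarith)
      have h7 := mul_le_mul_of_nonneg_left (hge_g x) hκ0.le
      have h8 := mul_le_mul_of_nonneg_left (h4.trans (add_le_add h6 h7)) hs0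
      have h9 := mul_le_mul_of_nonneg_left h5 (show 0 ≤ 1 - s by linarith)
      have h10 : s * ((1 - κ) * (g y + θ y) + κ * (g x + θ x))
          = (s - t) * (g y + θ y) + t * (g x + θ x) := by rw [← hsκ]; ring
      rw [h10] at h8
      linarith
    intro x hx y hy a b ha hb hab
    have hz := isClosedCone_psd.convex hx hy ha hb hab
    have e1 : a • x + b • y = y + a • (x - y) := by
      rw [show b = 1 - a by linarith]; module
    have e2 : a • x + b • y = x + b • (y - x) := by
      rw [show a = 1 - b by linarith]; module
    have hgz : g (a • x + b • y) ≤ a * (g x + θ x) + b * (g y + θ y) := by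
      rw [e1, hg_conv, show 1 - a = b by linarith]
      linarith [mul_le_mul_of_nonneg_left (hge_g x) ha, mul_le_mul_of_nonneg_left (hge_g y) hb]
    simp only [smul_eq_mul]
    by_cases h1 : R ≤ trMat (a • x + b • y)
    · rw [hθ_zero _ hz h1, add_zero]; exact hgz
    rw [not_le] at h1
    rw [hθ_region _ hz (by linarith)]
    rcases max_choice (ξ (a • x + b • y : SymMat D) - g (a • x + b • y)) 0 with h2 | h2 <;> rw [h2]
    · rw [add_sub_cancel]
      by_cases h3 : 2 * R < trMat x
      · rw [e1] at h1 ⊢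
        have := hfar x hx y hy a ha (by linarith) h3 h1
        rw [show 1 - a = b by linarith] at this
        linarith
      by_cases h4 : 2 * R < trMat y
      · rw [e2] at h1 ⊢
        have := hfar y hy x hx b hb (by linarith) h4 h1
        rw [show 1 - b = a by linarith] at this
        linarith
      rw [not_lt] at h3 h4
      have h5 := hconv.2 hx hy ha hb hab
      simp only [smul_eq_mul] at h5
      linarith [mul_le_mul_of_nonneg_left (hge_ξ x hx h3) ha, mul_le_mul_of_nonneg_left (hge_ξ y hy h4) hb]
    · rw [add_zero]; exact hgz

end Regularization

/-! ### Extension of initial conditions from the cone to the whole space -/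

section Extension

variable {D : ℕ} {n : ℕ+} {ψ : StepSpace D n → ℝ}

/-- The difficulty is that `y + r` may leave the cone. The passage from `y` to `x` is split into `N`
steps after a shift to the interior. Each step adds `r / N`, which the shift absorbs, then decreases
along the dual cone. -/
theorem le_add_stepNorm1 (hinc : IncreasingAlong (dualCone (stepCone D n)) (stepCone D n) ψ)
    (hlip : ∀ x ∈ stepCone D n, ∀ y ∈ stepCone D n, |ψ x - ψ y| ≤ stepNorm1 (x - y))
    {x y r : StepSpace D n} (hx : x ∈ stepCone D n) (hy : y ∈ stepCone D n)
    (hc : y + r - x ∈ dualCone (stepCone D n)) : ψ x ≤ ψ y + stepNorm1 r := by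
  have hn := pnat_cast_pos n
  have hC := isClosedCone_stepCone (D := D) (n := n)
  have he : stepInner D n ∈ stepCone D n := interior_subset stepInner_mem_interior
  have hshift : ∀ η : ℝ, 0 < η →
      ψ (x + η • stepInner D n) ≤ ψ (y + η • stepInner D n) + stepNorm1 r := by
    intro η hη
    obtain ⟨N, hN⟩ := exists_nat_gt (‖r‖ * (2 * n) / η)
    have hN0 : (0 : ℝ) < N := lt_of_le_of_lt (by positivity) hN
    rw [div_lt_iff₀ hη] at hN
    set w : ℕ → StepSpace D n := fun i => y + ((i : ℝ) / N) • (x - y) with hw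
    have hwC : ∀ i ≤ N, w i ∈ stepCone D n := fun i hi =>
      hC.convex.add_smul_sub_mem hy hx
        ⟨by positivity, by rw [div_le_one hN0]; exact_mod_cast hi⟩
    have hr : η • stepInner D n + (1 / (N : ℝ)) • r ∈ stepCone D n := by
      have h1 : stepInner D n + (1 / (η * N)) • r ∈ stepCone D n := by
        refine stepInner_ball ?_
        rw [norm_smul, Real.norm_eq_abs, abs_of_nonneg (by positivity), one_div_mul_eq_div,
          div_le_div_iff₀ (by positivity) (by positivity)]
        linarith
      have h2 := hC.smul_mem η hη.le _ h1
      rwa [smul_add, smul_smul, show η * (1 / (η * N)) = 1 / N by field_simp] at h2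
    have hstep : ∀ i ≤ N, ψ (w i + η • stepInner D n)
        ≤ ψ (y + η • stepInner D n) + (i / N) * stepNorm1 r := by
      intro i
      induction i with
      | zero => intro _; simp [hw]
      | succ i ih =>
        intro hi
        have h1 : w i + η • stepInner D n + (1 / (N : ℝ)) • r ∈ stepCone D n := by
          rw [add_assoc]; exact hC.add_mem _ (hwC i (by omega)) _ hr
        have h2 : w (i + 1) + η • stepInner D n ∈ stepCone D n :=
          hC.add_mem _ (hwC _ hi) _ (hC.smul_mem η hη.le _ he)
        have h3 : w i + η • stepInner D n ∈ stepCone D n :=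
          hC.add_mem _ (hwC _ (by omega)) _ (hC.smul_mem η hη.le _ he)
        have h4 := hinc _ h1 _ h2 (by
          have : w i + η • stepInner D n + (1 / (N : ℝ)) • r - (w (i + 1) + η • stepInner D n)
              = (1 / (N : ℝ)) • (y + r - x) := by
            simp only [hw]; push_cast; rw [add_div]; module
          rw [this]
          exact dualCone_smul hc (by positivity))
        have h5 := hlip _ h1 _ h3
        rw [add_sub_cancel_left, stepNorm1_smul,
          abs_of_nonneg (show (0 : ℝ) ≤ 1 / (N : ℝ) by positivity)] at h5
        have h6 := ih (by omega)
        have h7 := le_abs_self (ψ (w i + η • stepInner D n + (1 / (N : ℝ)) • r)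
          - ψ (w i + η • stepInner D n))
        push_cast
        rw [add_div, add_mul]
        linarith
    have := hstep N le_rfl
    rwa [div_self hN0.ne', one_mul, show w N = x by
      simp only [hw]; rw [div_self hN0.ne', one_smul]; abel] at this
  have hnear : ∀ z ∈ stepCone D n, ∀ η : ℝ, 0 < η →
      |ψ (z + η • stepInner D n) - ψ z| ≤ η * stepNorm1 (stepInner D n) := fun z hz η hη => by
    have := hlip _ (hC.add_mem z hz _ (hC.smul_mem η hη.le _ he)) z hz
    rwa [add_sub_cancel_left, stepNorm1_smul, abs_of_pos hη] at this
  refine le_of_forall_pos_le_add fun ε hε => ?_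
  have hK := stepNorm1_nonneg (stepInner D n)
  set η := ε / (2 * (stepNorm1 (stepInner D n) + 1)) with hη
  have hη0 : 0 < η := by positivity
  have hηε : 2 * (stepNorm1 (stepInner D n) + 1) * η = ε := by rw [hη]; field_simp
  have h1 := (abs_le.1 (hnear x hx η hη0)).1
  have h2 := (abs_le.1 (hnear y hy η hη0)).2
  linarith [hshift η hη0]

/-- Extension of an increasing Lipschitz function on the cone to the whole space. -/
theorem exists_increasing_extension
    (hinc : IncreasingAlong (dualCone (stepCone D n)) (stepCone D n) ψ)
    (hlip : ∀ x ∈ stepCone D n, ∀ y ∈ stepCone D n, |ψ x - ψ y| ≤ stepNorm1 (x - y)) :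
    ∃ ψ' : StepSpace D n → ℝ, (∀ x ∈ stepCone D n, ψ' x = ψ x) ∧
      (∀ c ∈ dualCone (stepCone D n), ∀ x, ψ' x ≤ ψ' (x + c)) ∧
      ∀ x w, ψ' (x + w) ≤ ψ' x + stepNorm1 w := by
  have hC := isClosedCone_stepCone (D := D) (n := n)
  -- The extension is the infimum of `ψ y + stepNorm1 r` over all `y` in the cone and `r` with `y +
  -- r` above `x` in the dual order.
  set A : StepSpace D n → Set ℝ := fun x =>
    {a | ∃ y ∈ stepCone D n, ∃ r, y + r - x ∈ dualCone (stepCone D n) ∧ a = ψ y + stepNorm1 r}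
    with hA
  have hne : ∀ x, (A x).Nonempty := fun x => by
    obtain ⟨r, -, hr, -⟩ := hC.exists_proj x
    exact ⟨_, 0, hC.zero_mem, r, by rwa [zero_add], rfl⟩
  have hbdd : ∀ x, BddBelow (A x) := fun x => by
    obtain ⟨s, -, hs, -⟩ := hC.exists_proj (-x)
    refine ⟨ψ 0 - stepNorm1 s, ?_⟩
    rintro _ ⟨y, hy, r, hr, rfl⟩
    have h1 := le_add_stepNorm1 hinc hlip hC.zero_mem hy (r := r + s) (by
      have := dualCone_add hr hs
      convert this using 1
      abel)
    linarith [stepNorm1_add_le r s]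
  refine ⟨fun x => sInf (A x), fun x hx => ?_, fun c hc x => ?_, fun x w => ?_⟩
  · refine le_antisymm (csInf_le (hbdd x) ⟨x, hx, 0, ?_, ?_⟩) (le_csInf (hne x) ?_)
    · rw [add_zero, sub_self]; exact dualCone_zero _
    · have : stepNorm1 (0 : StepSpace D n) = 0 := by
        have := stepNorm1_smul (0 : ℝ) (0 : StepSpace D n)
        rwa [zero_smul, abs_zero, zero_mul] at this
      rw [this, add_zero]
    · rintro _ ⟨y, hy, r, hr, rfl⟩
      exact le_add_stepNorm1 hinc hlip hx hy hr
  · refine le_csInf (hne _) ?_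
    rintro _ ⟨y, hy, r, hr, rfl⟩
    refine csInf_le (hbdd x) ⟨y, hy, r, ?_, rfl⟩
    have := dualCone_add hr hc
    convert this using 1
    abel
  · rw [← sub_le_iff_le_add]
    refine le_csInf (hne _) ?_
    rintro _ ⟨y, hy, r, hr, rfl⟩
    rw [sub_le_iff_le_add]
    refine (csInf_le (hbdd _) ⟨y, hy, r + w, ?_, rfl⟩).trans ?_
    · convert hr using 1
      abel
    · linarith [stepNorm1_add_le r w]

end Extension

/-! ### Uniform partitions of the unit interval -/

section Cells

variable {n : ℕ+}

/-- Lebesgue measure on `[0,1)`. -/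
noncomputable abbrev pathMeasure : Measure ℝ := (volume : Measure ℝ).restrict (Ico (0 : ℝ) 1)

instance : IsProbabilityMeasure pathMeasure :=
  ⟨by rw [Measure.restrict_apply_univ, Real.volume_Ico]; simp⟩

theorem mem_cell_iff {s : ℝ} (hs : 0 ≤ s) (k : Fin n) : s ∈ cell n k ↔ ⌊s * n⌋₊ = k := by
  have hn := pnat_cast_pos n
  rw [cell, mem_Ico, div_le_iff₀ hn, lt_div_iff₀ hn, Nat.floor_eq_iff (by positivity)]

theorem cell_subset (k : Fin n) : cell n k ⊆ Ico (0 : ℝ) 1 := fun s hs => by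
  have hn := pnat_cast_pos n
  refine ⟨le_trans (by positivity) hs.1, hs.2.trans_le ?_⟩
  rw [div_le_one hn]
  exact_mod_cast k.2

theorem measurableSet_cell (k : Fin n) : MeasurableSet (cell n k) := measurableSet_Ico

theorem floor_lt_of_mem {s : ℝ} (hs : s ∈ Ico (0 : ℝ) 1) : ⌊s * n⌋₊ < n := by
  have hn := pnat_cast_pos n
  rw [Nat.floor_lt (mul_nonneg hs.1 hn.le)]
  nlinarith [hs.2]

theorem exists_mem_cell {s : ℝ} (hs : s ∈ Ico (0 : ℝ) 1) : ∃ k : Fin n, s ∈ cell n k :=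
  ⟨⟨_, floor_lt_of_mem hs⟩, (mem_cell_iff hs.1 _).2 rfl⟩

theorem iUnion_cell : ⋃ k, cell n k = Ico (0 : ℝ) 1 :=
  Subset.antisymm (iUnion_subset cell_subset) fun _ hs => mem_iUnion.2 (exists_mem_cell hs)

theorem pairwise_disjoint_cell : Pairwise (Function.onFun Disjoint (cell n)) := fun i k hik =>
  Set.disjoint_left.2 fun s hi hk => hik (Fin.ext (by
    rw [← (mem_cell_iff (cell_subset i hi).1 i).1 hi, (mem_cell_iff (cell_subset i hi).1 k).1 hk]))

theorem pathMeasure_restrict_cell (k : Fin n) :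
    pathMeasure.restrict (cell n k) = volume.restrict (cell n k) := by
  rw [Measure.restrict_restrict (measurableSet_cell k), inter_eq_self_of_subset_left (cell_subset k)]

theorem volume_real_cell (k : Fin n) : (volume : Measure ℝ).real (cell n k) = 1 / n := by
  have hn := pnat_cast_pos n
  rw [cell, Real.volume_real_Ico_of_le (by gcongr; linarith)]
  ring

theorem pathMeasure_real_cell (k : Fin n) : pathMeasure.real (cell n k) = 1 / n := by
  rw [← volume_real_cell k, measureReal_def, measureReal_def,
    Measure.restrict_apply (measurableSet_cell k), inter_eq_self_of_subset_left (cell_subset k)]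

theorem integral_eq_sum_cell {F : Type*} [NormedAddCommGroup F] [NormedSpace ℝ F] {g : ℝ → F}
    (hg : Integrable g pathMeasure) : ∫ s, g s ∂pathMeasure = ∑ k : Fin n, ∫ s in cell n k, g s := by
  have h := integral_iUnion_fintype (fun k => measurableSet_cell (n := n) k)
    pairwise_disjoint_cell (f := g) (μ := volume)
    fun k => IntegrableOn.mono_set hg (cell_subset k)
  rwa [iUnion_cell] at h

theorem ae_cell_of_ae {P : ℝ → Prop} (h : ∀ᵐ s ∂pathMeasure, P s) (k : Fin n) :
    ∀ᵐ s ∂(volume : Measure ℝ).restrict (cell n k), P s :=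
  ae_mono (Measure.restrict_mono (cell_subset k) le_rfl) h

end Cells

/-! ### Averages and step functions as adjoint maps -/

section LiftProj

variable {D : ℕ} {n : ℕ+}

/-- The step function with the values `x`. -/
noncomputable def stepFun (n : ℕ+) (x : StepSpace D n) (s : ℝ) : SymMat D :=
  if h : ⌊s * n⌋₊ < n then x ⟨⌊s * n⌋₊, h⟩ else 0

theorem stepFun_of_mem {x : StepSpace D n} {k : Fin n} {s : ℝ} (hs : s ∈ cell n k) :
    stepFun n x s = x k := by
  have h := (mem_cell_iff (cell_subset k hs).1 k).1 hs
  have hk : ⌊s * n⌋₊ < n := by rw [h]; exact k.2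
  rw [stepFun, dif_pos hk]
  congr 1
  exact Fin.ext h

theorem stepLift_coeFn (x : StepSpace D n) : stepLift n x =ᵐ[pathMeasure] stepFun n x := by
  have h1 : ∀ k : Fin n, ∀ᵐ s ∂pathMeasure,
      (indicatorConstLp 2 (s := cell n k) (μ := pathMeasure) measurableSet_Ico
        (measure_ne_top _ _) (x k) : PathSpace D) s = (cell n k).indicator (fun _ => x k) s :=
    fun k => indicatorConstLp_coeFn
  have h2 : ∀ᵐ s ∂pathMeasure, s ∈ Ico (0 : ℝ) 1 := ae_restrict_mem measurableSet_Ico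
  have h3 := Lp.coeFn_finsetSum (p := 2) (μ := pathMeasure) (Finset.univ : Finset (Fin n))
    fun k => (indicatorConstLp 2 (s := cell n k) (μ := pathMeasure) measurableSet_Ico
        (measure_ne_top _ _) (x k) : PathSpace D)
  filter_upwards [ae_all_iff.2 h1, h2, h3] with s hs hs2 hs3
  obtain ⟨k, hk⟩ := exists_mem_cell (n := n) hs2
  rw [stepFun_of_mem hk, stepLift, hs3, Finset.sum_apply, Finset.sum_eq_single k]
  · rw [hs, indicator_of_mem hk]
  · intro i _ hik
    rw [hs, indicator_of_notMem]
    exact fun hi => disjoint_left.1 (pairwise_disjoint_cell hik) hi hk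
  · simp

theorem stepFun_add (x y : StepSpace D n) (s : ℝ) :
    stepFun n (x + y) s = stepFun n x s + stepFun n y s := by
  simp only [stepFun]
  split_ifs
  · rfl
  · simp

theorem stepFun_smul (c : ℝ) (x : StepSpace D n) (s : ℝ) :
    stepFun n (c • x) s = c • stepFun n x s := by
  simp only [stepFun]
  split_ifs
  · rfl
  · simp

theorem integrable_path (κ : PathSpace D) : Integrable κ pathMeasure :=
  (Lp.memLp κ).integrable one_le_two

theorem integrableOn_cell {F : Type*} [NormedAddCommGroup F] {g : ℝ → F}
    (hg : Integrable g pathMeasure) (k : Fin n) : IntegrableOn g (cell n k) :=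
  IntegrableOn.mono_set hg (cell_subset k)

/-- Linear maps between inner product spaces. -/
abbrev HilbertMap (E E' : Type*) [NormedAddCommGroup E] [InnerProductSpace ℝ E]
    [NormedAddCommGroup E'] [InnerProductSpace ℝ E'] : Type _ := E →ₗ[ℝ] E'

variable (D n) in
/-- `stepProj` as a linear map. -/
noncomputable def projMap : HilbertMap (PathSpace D) (StepSpace D n) where
  toFun := stepProj n
  map_add' κ κ' := by
    funext k
    change (n : ℝ) • (∫ s in cell n k, (κ + κ') s)
      = (n : ℝ) • (∫ s in cell n k, κ s) + (n : ℝ) • ∫ s in cell n k, κ' s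
    rw [← smul_add, ← integral_add (integrableOn_cell (integrable_path κ) k)
      (integrableOn_cell (integrable_path κ') k)]
    congr 1
    exact integral_congr_ae (ae_cell_of_ae (Lp.coeFn_add κ κ') k)
  map_smul' c κ := by
    funext k
    change (n : ℝ) • (∫ s in cell n k, (c • κ) s) = c • ((n : ℝ) • ∫ s in cell n k, κ s)
    rw [smul_comm c, ← integral_smul c]
    congr 1
    exact integral_congr_ae (ae_cell_of_ae (Lp.coeFn_smul c κ) k)

theorem inner_stepLift (z : PathSpace D) (q : StepSpace D n) :
    inner ℝ z (stepLift n q) = inner ℝ (stepProj n z) q := by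
  have hn := pnat_cast_pos n
  rw [stepLift, inner_stepSpace]
  refine (inner_sum (𝕜 := ℝ) (E := PathSpace D) _ _ _).trans (Finset.sum_congr rfl fun k _ => ?_)
  rw [real_inner_comm]
  refine (L2.inner_indicatorConstLp_eq_inner_setIntegral ℝ (measurableSet_cell k)
    (measure_ne_top pathMeasure _) (q k) z).trans ?_
  rw [pathMeasure_restrict_cell, stepProj, inner_smul_symMat, real_inner_comm]
  field_simp

theorem stepProj_stepLift (x : StepSpace D n) : stepProj n (stepLift n x) = x := by
  have hn := pnat_cast_pos n
  funext k
  have h : ∫ s in cell n k, stepLift n x s = ∫ s in cell n k, x k := by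
    refine integral_congr_ae ?_
    filter_upwards [ae_cell_of_ae (stepLift_coeFn x) k, ae_restrict_mem (measurableSet_cell k)]
      with s h1 h2
    rw [h1, stepFun_of_mem h2]
  rw [stepProj, h, setIntegral_const, volume_real_cell, smul_smul, mul_one_div_cancel hn.ne',
    one_smul]

variable (D n) in
/-- `stepLift` as a linear isometry. -/
noncomputable def liftMap : StepSpace D n →ₗᵢ[ℝ] PathSpace D where
  toFun := stepLift n
  map_add' x y := by
    refine Lp.ext ?_
    filter_upwards [stepLift_coeFn (x + y), stepLift_coeFn x, stepLift_coeFn y,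
      Lp.coeFn_add (stepLift n x) (stepLift n y)] with s h1 h2 h3 h4
    rw [h1, h4, Pi.add_apply, h2, h3, stepFun_add]
  map_smul' c x := by
    refine Lp.ext ?_
    filter_upwards [stepLift_coeFn (c • x), stepLift_coeFn x,
      Lp.coeFn_smul c (stepLift n x)] with s h1 h2 h4
    rw [h1, RingHom.id_apply, h4, Pi.smul_apply, h2, stepFun_smul]
  norm_map' x := by
    change ‖stepLift n x‖ = ‖x‖
    refine (sq_eq_sq₀ (norm_nonneg (stepLift n x)) (norm_nonneg x)).1 ?_
    rw [← real_inner_self_eq_norm_sq (stepLift n x), ← real_inner_self_eq_norm_sq x,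
      inner_stepLift, stepProj_stepLift]

@[simp] theorem liftMap_apply (x : StepSpace D n) : liftMap D n x = stepLift n x := rfl

@[simp] theorem projMap_apply (κ : PathSpace D) : projMap D n κ = stepProj n κ := rfl

theorem isAdjointOf_liftMap : IsAdjointOf (liftMap D n) (projMap D n) := inner_stepLift

theorem integral_comp_stepLift {F : Type*} [NormedAddCommGroup F] [NormedSpace ℝ F]
    [CompleteSpace F] (g : SymMat D → F) (x : StepSpace D n) :
    ∫ s, g (stepLift n x s) ∂pathMeasure = ∑ k : Fin n, (1 / (n : ℝ)) • g (x k) := by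
  have hn := pnat_cast_pos n
  have hcell : ∀ k : Fin n, (fun s => g (stepLift n x s))
      =ᵐ[volume.restrict (cell n k)] fun _ => g (x k) := fun k => by
    filter_upwards [ae_cell_of_ae (stepLift_coeFn x) k, ae_restrict_mem (measurableSet_cell k)]
      with s h1 h2
    rw [h1, stepFun_of_mem h2]
  have hint : Integrable (fun s => g (stepLift n x s)) pathMeasure := by
    have : IntegrableOn (fun s => g (stepLift n x s)) (⋃ k, cell n k) volume := by
      refine integrableOn_finite_iUnion.2 fun k => ?_
      refine Integrable.congr ?_ (hcell k).symm
      exact integrableOn_const (by rw [cell, Real.volume_Ico]; exact ENNReal.ofReal_ne_top)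
    rwa [iUnion_cell] at this
  rw [integral_eq_sum_cell (n := n) hint]
  refine Finset.sum_congr rfl fun k _ => ?_
  rw [integral_congr_ae (hcell k), setIntegral_const, volume_real_cell]

/-- Cauchy-Schwarz against the indicator of `A`. -/
theorem norm_setIntegral_le (κ : PathSpace D) {A : Set ℝ} (hA : MeasurableSet A) :
    ∫ s in A, ‖κ s‖ ∂pathMeasure ≤ √(pathMeasure.real A) * ‖κ‖ := by
  have hm := (Lp.memLp κ).norm
  have h1 := L2.inner_indicatorConstLp_one (𝕜 := ℝ) (μ := pathMeasure) hA (measure_ne_top _ A)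
    hm.toLp
  have h2 : ∫ s in A, hm.toLp (fun s => ‖κ s‖) s ∂pathMeasure = ∫ s in A, ‖κ s‖ ∂pathMeasure :=
    integral_congr_ae (ae_restrict_of_ae hm.coeFn_toLp)
  rw [← h2, ← h1]
  refine (real_inner_le_norm _ _).trans (le_of_eq ?_)
  rw [norm_indicatorConstLp two_ne_zero ENNReal.ofNat_ne_top, norm_one, one_mul, Real.sqrt_eq_rpow,
    Lp.norm_toLp, eLpNorm_norm, ← Lp.norm_def]
  simp

theorem integral_norm_le (κ : PathSpace D) : ∫ s, ‖κ s‖ ∂pathMeasure ≤ ‖κ‖ := by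
  have := norm_setIntegral_le κ MeasurableSet.univ
  simpa using this

theorem integral_norm_cell_le (κ : PathSpace D) (k : Fin n) :
    ∫ s in cell n k, ‖κ s‖ ≤ √(1 / n) * ‖κ‖ := by
  have := norm_setIntegral_le κ (measurableSet_cell k)
  rwa [pathMeasure_restrict_cell, pathMeasure_real_cell] at this

theorem norm_sub_lift_proj_le (κ : PathSpace D) (y : StepSpace D n) :
    ‖κ - stepLift n (stepProj n κ)‖ ≤ ‖κ - stepLift n y‖ := by
  have h0 : inner ℝ (κ - stepLift n (stepProj n κ)) (liftMap D n (projMap D n κ - y)) = 0 := by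
    rw [isAdjointOf_liftMap, LinearMap.map_sub (projMap D n), ← liftMap_apply, ← projMap_apply,
      isAdjointOf_liftMap.left_inv, sub_self, inner_zero_left]
  have h1 : κ - stepLift n y = (κ - stepLift n (stepProj n κ)) + liftMap D n (projMap D n κ - y) := by
    rw [LinearIsometry.map_sub (liftMap D n)]; simp
  rw [h1]
  refine le_of_sq_le_sq ?_ (norm_nonneg (_ : PathSpace D))
  rw [norm_add_sq_real (κ - stepLift n (stepProj n κ)), h0]
  nlinarith [sq_nonneg ‖liftMap D n (projMap D n κ - y)‖]

/-- Averages are the best `L²` approximation by step functions, so it is enough to approximate `κ`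
by a continuous compactly supported function and sample the latter at the left endpoints of the
cells. -/
theorem tendsto_lift_proj (κ : PathSpace D) :
    Tendsto (fun n : ℕ+ => stepLift n (stepProj n κ)) atTop (𝓝 κ) := by
  rw [Metric.tendsto_atTop]
  intro ε hε
  obtain ⟨g, hgs, hg, hgc, hgm⟩ := (Lp.memLp κ).exists_hasCompactSupport_eLpNorm_sub_le
    (ENNReal.ofNat_ne_top) (ε := ENNReal.ofReal (ε / 4)) (by simpa using by linarith)
  obtain ⟨δ, hδ, hgδ⟩ := Metric.uniformContinuous_iff.1
    (hgs.uniformContinuous_of_continuous hgc) (ε / 4) (by linarith)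
  obtain ⟨N, hN⟩ := exists_nat_gt (1 / δ)
  refine ⟨N.succPNat, fun n hn => ?_⟩
  have hn0 := pnat_cast_pos n
  have hnδ : 1 / (n : ℝ) < δ := by
    rw [one_div_lt hn0 hδ]
    refine hN.trans_le ?_
    have : N ≤ (n : ℕ) := (Nat.le_succ N).trans hn
    exact_mod_cast this
  set y : StepSpace D n := fun k => g (((k : ℕ) : ℝ) / n) with hy
  have h1 : ‖κ - hgm.toLp g‖ ≤ ε / 4 := by
    rw [← Lp.toLp_coeFn κ (Lp.memLp κ), ← MemLp.toLp_sub, Lp.norm_toLp]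
    exact ENNReal.toReal_le_of_le_ofReal (by linarith) hg
  have h2 : ‖hgm.toLp g - stepLift n y‖ ≤ ε / 4 := by
    have := Lp.norm_le_of_ae_bound (f := hgm.toLp g - stepLift n y) (C := ε / 4) (by linarith) (by
      filter_upwards [Lp.coeFn_sub (hgm.toLp g) (stepLift n y), hgm.coeFn_toLp, stepLift_coeFn y,
        ae_restrict_mem measurableSet_Ico] with s e1 e2 e3 hs
      obtain ⟨k, hk⟩ := exists_mem_cell (n := n) hs
      rw [e1, Pi.sub_apply, e2, e3, stepFun_of_mem hk, ← dist_eq_norm]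
      refine (hgδ ?_).le
      rw [Real.dist_eq, abs_of_nonneg (sub_nonneg.2 hk.1)]
      have := hk.2
      rw [add_div] at this
      linarith)
    have h1 : measureUnivNNReal pathMeasure = 1 := by simp [measureUnivNNReal]
    rwa [h1, NNReal.coe_one, Real.one_rpow, one_mul] at this
  rw [dist_comm, dist_eq_norm]
  have h3 := norm_sub_lift_proj_le κ y
  have h4 : κ - stepLift n y = (κ - hgm.toLp g) + (hgm.toLp g - stepLift n y) := by abel
  have h5 := norm_add_le (κ - hgm.toLp g) (hgm.toLp g - stepLift n y)
  rw [← h4] at h5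
  linarith

end LiftProj

/-! ### Increasing paths and closedness of their cone -/

section IncreasingPaths

variable {D : ℕ} {n : ℕ+}

/-- `μ` is increasing on `T` with positive semidefinite values. -/
def IsIncreasingPath (T : Set ℝ) (μ : ℝ → SymMat D) : Prop :=
  (∀ s ∈ T, μ s ∈ psd D) ∧ ∀ s ∈ T, ∀ t ∈ T, s ≤ t → μ t - μ s ∈ psd D

variable {T : Set ℝ} {μ ν : ℝ → SymMat D}

theorem IsIncreasingPath.monotoneOn_trMat (h : IsIncreasingPath T μ) :
    MonotoneOn (fun s => trMat (μ s)) T := fun s hs t ht hst => by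
  have := trMat_nonneg (h.2 s hs t ht hst)
  rw [trMat_sub] at this
  exact sub_nonneg.1 this

theorem IsIncreasingPath.norm_sub_le (h : IsIncreasingPath T μ) {s t : ℝ} (hs : s ∈ T) (ht : t ∈ T) :
    ‖μ s - μ t‖ ≤ |trMat (μ s) - trMat (μ t)| := by
  rcases le_total s t with hst | hst
  · rw [norm_sub_rev, abs_sub_comm, ← trMat_sub]
    exact (norm_le_trMat (h.2 s hs t ht hst)).trans (le_abs_self _)
  · rw [← trMat_sub]
    exact (norm_le_trMat (h.2 t ht s hs hst)).trans (le_abs_self _)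

theorem IsIncreasingPath.norm_sub_le_of_mem_Icc (h : IsIncreasingPath T μ) {s t a b : ℝ}
    (hs : s ∈ T) (ht : t ∈ T) (ha : a ∈ T) (hb : b ∈ T) (hsa : s ∈ Icc a b) (hta : t ∈ Icc a b) :
    ‖μ s - μ t‖ ≤ trMat (μ b) - trMat (μ a) := by
  refine (h.norm_sub_le hs ht).trans (abs_le.2 ⟨?_, ?_⟩) <;>
  linarith [h.monotoneOn_trMat ha hs hsa.1, h.monotoneOn_trMat hs hb hsa.2,
    h.monotoneOn_trMat ha ht hta.1, h.monotoneOn_trMat ht hb hta.2]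

theorem IsIncreasingPath.inner_sub_nonneg (h : IsIncreasingPath T μ) (h' : IsIncreasingPath T ν)
    {s t : ℝ} (hs : s ∈ T) (ht : t ∈ T) : 0 ≤ inner ℝ (μ s - μ t) (ν s - ν t) := by
  rcases le_total s t with hst | hst
  · rw [← neg_sub (μ t), ← neg_sub (ν t), inner_neg_neg]
    exact psd_inner_nonneg (h.2 s hs t ht hst) (h'.2 s hs t ht hst)
  · exact psd_inner_nonneg (h.2 t ht s hs hst) (h'.2 t ht s hs hst)

theorem IsIncreasingPath.exists_tendsto (h : IsIncreasingPath T μ) {F : Filter ℝ} [F.NeBot]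
    (hF : ∀ ε > 0, ∃ S ∈ F, S ⊆ T ∧ ∀ s ∈ S, ∀ t ∈ S, |trMat (μ s) - trMat (μ t)| < ε) :
    ∃ l, Tendsto μ F (𝓝 l) := by
  refine cauchy_map_iff_exists_tendsto.1 (Metric.cauchy_iff.2 ⟨inferInstance, fun ε hε => ?_⟩)
  obtain ⟨S, hS, hST, hSε⟩ := hF ε hε
  refine ⟨μ '' S, image_mem_map hS, ?_⟩
  rintro _ ⟨s, hs, rfl⟩ _ ⟨t, ht, rfl⟩
  rw [dist_eq_norm]
  exact (h.norm_sub_le (hST hs) (hST ht)).trans_lt (hSε s hs t ht)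

theorem IsIncreasingPath.exists_tendsto_right (h : IsIncreasingPath T μ) {t : ℝ}
    [(𝓝[T ∩ Ioi t] t).NeBot] : ∃ l, Tendsto μ (𝓝[T ∩ Ioi t] t) (𝓝 l) := by
  refine h.exists_tendsto fun ε hε => ?_
  set A := (fun s => trMat (μ s)) '' (T ∩ Ioi t) with hA
  have hne : A.Nonempty := (Filter.nonempty_of_mem (self_mem_nhdsWithin (a := t))).image _
  have hbdd : BddBelow A := ⟨0, by rintro _ ⟨s, hs, rfl⟩; exact trMat_nonneg (h.1 s hs.1)⟩
  obtain ⟨_, ⟨s₀, hs₀, rfl⟩, hlt⟩ := exists_lt_of_csInf_lt hne (lt_add_of_pos_right (sInf A) hε)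
  refine ⟨(T ∩ Ioi t) ∩ Iio s₀, inter_mem self_mem_nhdsWithin
    (mem_nhdsWithin_of_mem_nhds (Iio_mem_nhds hs₀.2)), fun s hs => hs.1.1, ?_⟩
  have key : ∀ s ∈ (T ∩ Ioi t) ∩ Iio s₀, trMat (μ s) ∈ Ico (sInf A) (sInf A + ε) := fun s hs =>
    ⟨csInf_le hbdd ⟨s, hs.1, rfl⟩,
      (h.monotoneOn_trMat hs.1.1 hs₀.1 (le_of_lt hs.2)).trans_lt hlt⟩
  intro s hs r hr
  have h1 := key s hs
  have h2 := key r hr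
  rw [abs_lt]
  constructor <;> linarith [h1.1, h1.2, h2.1, h2.2]

theorem IsIncreasingPath.exists_tendsto_left (h : IsIncreasingPath T μ) {t : ℝ} (ht : t ∈ T)
    [(𝓝[T ∩ Iio t] t).NeBot] : ∃ l, Tendsto μ (𝓝[T ∩ Iio t] t) (𝓝 l) := by
  refine h.exists_tendsto fun ε hε => ?_
  set A := (fun s => trMat (μ s)) '' (T ∩ Iio t) with hA
  have hne : A.Nonempty := (Filter.nonempty_of_mem (self_mem_nhdsWithin (a := t))).image _
  have hbdd : BddAbove A :=
    ⟨trMat (μ t), by rintro _ ⟨s, hs, rfl⟩; exact h.monotoneOn_trMat hs.1 ht hs.2.le⟩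
  obtain ⟨_, ⟨s₀, hs₀, rfl⟩, hlt⟩ := exists_lt_of_lt_csSup hne (sub_lt_self (sSup A) hε)
  refine ⟨(T ∩ Iio t) ∩ Ioi s₀, inter_mem self_mem_nhdsWithin
    (mem_nhdsWithin_of_mem_nhds (Ioi_mem_nhds hs₀.2)), fun s hs => hs.1.1, ?_⟩
  have key : ∀ s ∈ (T ∩ Iio t) ∩ Ioi s₀, trMat (μ s) ∈ Ioc (sSup A - ε) (sSup A) := fun s hs =>
    ⟨hlt.trans_le (h.monotoneOn_trMat hs₀.1 hs.1.1 (le_of_lt hs.2)), le_csSup hbdd ⟨s, hs.1, rfl⟩⟩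
  intro s hs r hr
  have h1 := key s hs
  have h2 := key r hr
  rw [abs_lt]
  constructor <;> linarith [h1.1, h1.2, h2.1, h2.2]

theorem nhdsWithin_Ico_inter_Iio {t : ℝ} (ht : t ∈ Ioo (0 : ℝ) 1) :
    𝓝[Ico (0 : ℝ) 1 ∩ Iio t] t = 𝓝[<] t := by
  exact nhdsWithin_inter_of_mem (mem_nhdsWithin_of_mem_nhds (Ico_mem_nhds ht.1 ht.2))

theorem IsIncreasingPath.mem_pathCone (h : IsIncreasingPath (Ico 0 1) μ)
    (hc : ∀ t ∈ Ico (0 : ℝ) 1, ContinuousWithinAt μ (Ici t) t) {κ : PathSpace D}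
    (hκ : κ =ᵐ[pathMeasure] μ) : κ ∈ pathCone D := by
  refine ⟨μ, h.1, h.2, hc, fun t ht => ?_, hκ⟩
  have : (𝓝[Ico (0 : ℝ) 1 ∩ Iio t] t).NeBot := by
    rw [nhdsWithin_Ico_inter_Iio ht]; infer_instance
  have := h.exists_tendsto_left (t := t) ⟨ht.1.le, ht.2⟩
  rwa [nhdsWithin_Ico_inter_Iio ht] at this

theorem exists_increasing_of_mem_pathCone {κ : PathSpace D} (hκ : κ ∈ pathCone D) :
    ∃ μ : ℝ → SymMat D, IsIncreasingPath (Ico 0 1) μ ∧ κ =ᵐ[pathMeasure] μ := by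
  obtain ⟨μ, h1, h2, -, -, h3⟩ := hκ
  exact ⟨μ, ⟨h1, h2⟩, h3⟩

theorem zero_mem_pathCone : (0 : PathSpace D) ∈ pathCone D :=
  IsIncreasingPath.mem_pathCone (μ := fun _ => 0)
    ⟨fun _ _ => isClosedCone_psd.zero_mem, fun _ _ _ _ _ => by
      rw [sub_zero]; exact isClosedCone_psd.zero_mem⟩
    (fun _ _ => continuousWithinAt_const) (Lp.coeFn_zero _ _ _)

theorem add_mem_pathCone {κ κ' : PathSpace D} (h : κ ∈ pathCone D) (h' : κ' ∈ pathCone D) :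
    κ + κ' ∈ pathCone D := by
  obtain ⟨μ, h1, h2, h3, -, h4⟩ := h
  obtain ⟨μ', h1', h2', h3', -, h4'⟩ := h'
  refine IsIncreasingPath.mem_pathCone (μ := fun s => μ s + μ' s)
    ⟨fun s hs => isClosedCone_psd.add_mem _ (h1 s hs) _ (h1' s hs), fun s hs t ht hst => ?_⟩
    (fun t ht => (h3 t ht).add (h3' t ht)) ?_
  · rw [add_sub_add_comm]
    exact isClosedCone_psd.add_mem _ (h2 s hs t ht hst) _ (h2' s hs t ht hst)
  · filter_upwards [Lp.coeFn_add κ κ', h4, h4'] with s e1 e2 e3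
    rw [e1, Pi.add_apply, e2, e3]

theorem smul_mem_pathCone {κ : PathSpace D} {c : ℝ} (hc : 0 ≤ c) (h : κ ∈ pathCone D) :
    c • κ ∈ pathCone D := by
  obtain ⟨μ, h1, h2, h3, -, h4⟩ := h
  refine IsIncreasingPath.mem_pathCone (μ := fun s => c • μ s)
    ⟨fun s hs => isClosedCone_psd.smul_mem c hc _ (h1 s hs), fun s hs t ht hst => ?_⟩
    (fun t ht => (h3 t ht).const_smul c) ?_
  · rw [← smul_sub]
    exact isClosedCone_psd.smul_mem c hc _ (h2 s hs t ht hst)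
  · filter_upwards [Lp.coeFn_smul c κ, h4] with s e1 e2
    rw [e1, Pi.smul_apply, e2]

theorem ae_mem_psd {κ : PathSpace D} (hκ : κ ∈ pathCone D) : ∀ᵐ s ∂pathMeasure, κ s ∈ psd D := by
  obtain ⟨μ, h, hμ⟩ := exists_increasing_of_mem_pathCone hκ
  filter_upwards [hμ, ae_restrict_mem measurableSet_Ico] with s h1 h2
  rw [h1]
  exact h.1 s h2

theorem pathCone_subset_dualCone : pathCone D ⊆ dualCone (pathCone D) := fun κ hκ κ' hκ' => by
  rw [L2.inner_def]
  refine integral_nonneg_of_ae ?_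
  filter_upwards [ae_mem_psd hκ, ae_mem_psd hκ'] with s h1 h2
  exact psd_inner_nonneg h1 h2

theorem isIncreasingPath_stepFun {x : StepSpace D n} (hx : x ∈ stepCone D n) :
    IsIncreasingPath (Ico 0 1) (stepFun n x) := by
  refine ⟨fun s hs => ?_, fun s hs t ht hst => ?_⟩
  · obtain ⟨k, hk⟩ := exists_mem_cell (n := n) hs
    rw [stepFun_of_mem hk]
    exact hx.1 k
  · obtain ⟨k, hk⟩ := exists_mem_cell (n := n) hs
    obtain ⟨j, hj⟩ := exists_mem_cell (n := n) ht
    rw [stepFun_of_mem hk, stepFun_of_mem hj]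
    refine hx.2 k j ?_
    rw [Fin.le_def, ← (mem_cell_iff hs.1 k).1 hk, ← (mem_cell_iff ht.1 j).1 hj]
    exact Nat.floor_mono (mul_le_mul_of_nonneg_right hst (pnat_cast_pos n).le)

theorem stepLift_mem {x : StepSpace D n} (hx : x ∈ stepCone D n) : stepLift n x ∈ pathCone D := by
  refine (isIncreasingPath_stepFun hx).mem_pathCone (fun t ht => ?_) (stepLift_coeFn x)
  obtain ⟨k, hk⟩ := exists_mem_cell (n := n) ht
  refine (continuousWithinAt_const (b := x k)).congr_of_eventuallyEq ?_ (stepFun_of_mem hk)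
  filter_upwards [Ico_mem_nhdsGE hk.2] with s hs
  exact stepFun_of_mem ⟨hk.1.trans hs.1, hs.2⟩

theorem setAverage_mem_of_isClosedCone {A : Set (SymMat D)} (hA : IsClosedCone A) {g : ℝ → SymMat D}
    {B : Set ℝ} (hg : IntegrableOn g B volume) (hmem : ∀ᵐ s ∂volume.restrict B, g s ∈ A) :
    ∫ s in B, g s ∈ A := by
  refine hA.mem_of_forall_dualCone fun c hc => ?_
  rw [real_inner_comm, ← integral_inner hg]
  refine integral_nonneg_of_ae ?_
  filter_upwards [hmem] with s hs
  exact hc _ hs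

theorem integrable_of_ae_eq {κ : PathSpace D} (hκ : κ =ᵐ[pathMeasure] μ) :
    Integrable μ pathMeasure := (integrable_path κ).congr hκ

theorem stepProj_eq {κ : PathSpace D} (hκ : κ =ᵐ[pathMeasure] μ) (k : Fin n) :
    stepProj n κ k = (n : ℝ) • ∫ s in cell n k, μ s := by
  rw [stepProj, integral_congr_ae (ae_cell_of_ae hκ k)]

theorem smul_integral_cell_const (k : Fin n) (a : SymMat D) :
    (n : ℝ) • ∫ _ in cell n k, a = a := by
  have hn := pnat_cast_pos n
  rw [setIntegral_const, volume_real_cell, smul_smul, mul_one_div_cancel hn.ne', one_smul]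

theorem integrableOn_const_cell {F : Type*} [NormedAddCommGroup F] (k : Fin n) (a : F) :
    IntegrableOn (fun _ => a) (cell n k) volume :=
  integrableOn_const (by rw [cell, Real.volume_Ico]; exact ENNReal.ofReal_ne_top)

theorem stepProj_mem {κ : PathSpace D} (hκ : κ ∈ pathCone D) : stepProj n κ ∈ stepCone D n := by
  have hn := pnat_cast_pos n
  obtain ⟨μ, h, hμ⟩ := exists_increasing_of_mem_pathCone hκ
  have hint : ∀ k : Fin n, IntegrableOn μ (cell n k) volume :=
    fun k => integrableOn_cell (integrable_of_ae_eq hμ) k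
  refine ⟨fun k => ?_, fun i k hik => ?_⟩
  · rw [stepProj_eq hμ]
    refine isClosedCone_psd.smul_mem _ hn.le _ (setAverage_mem_of_isClosedCone isClosedCone_psd
      (hint k) ?_)
    filter_upwards [ae_restrict_mem (measurableSet_cell k)] with s hs
    exact h.1 s (cell_subset k hs)
  rcases hik.eq_or_lt with rfl | hlt
  · rw [sub_self]; exact isClosedCone_psd.zero_mem
  set a := μ (((k : ℕ) : ℝ) / n) with ha
  have hkmem : ((k : ℕ) : ℝ) / n ∈ Ico (0 : ℝ) 1 :=
    cell_subset k ⟨le_rfl, div_lt_div_of_pos_right (lt_add_one _) hn⟩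
  have h1 : stepProj n κ k - a ∈ psd D := by
    rw [stepProj_eq hμ]
    nth_rewrite 1 [← smul_integral_cell_const k a]
    rw [← smul_sub, ← integral_sub (hint k) (integrableOn_const_cell k a)]
    refine isClosedCone_psd.smul_mem _ hn.le _ (setAverage_mem_of_isClosedCone isClosedCone_psd
      ((hint k).sub (integrableOn_const_cell k a)) ?_)
    filter_upwards [ae_restrict_mem (measurableSet_cell k)] with s hs
    exact h.2 _ hkmem _ (cell_subset k hs) hs.1
  have h2 : a - stepProj n κ i ∈ psd D := by
    rw [stepProj_eq hμ]
    nth_rewrite 1 [← smul_integral_cell_const i a]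
    rw [← smul_sub, ← integral_sub (integrableOn_const_cell i a) (hint i)]
    refine isClosedCone_psd.smul_mem _ hn.le _ (setAverage_mem_of_isClosedCone isClosedCone_psd
      ((integrableOn_const_cell i a).sub (hint i)) ?_)
    filter_upwards [ae_restrict_mem (measurableSet_cell i)] with s hs
    refine h.2 _ (cell_subset i hs) _ hkmem (hs.2.le.trans ?_)
    have : ((i : ℕ) : ℝ) + 1 ≤ (k : ℕ) := by exact_mod_cast hlt
    gcongr
  have := isClosedCone_psd.add_mem _ h1 _ h2
  rwa [sub_add_sub_cancel] at this

/-- A function which is increasing on a set of full measure has a right-continuous increasing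
version. -/
theorem mem_pathCone_of_increasing {κ : PathSpace D} (hT : T ⊆ Ico 0 1)
    (hTae : ∀ᵐ s ∂pathMeasure, s ∈ T) (h : IsIncreasingPath T κ) : κ ∈ pathCone D := by
  -- A set of full measure meets every interval, so right limits along `T` exist and define the
  -- version `g`.
  have hdense : ∀ a b : ℝ, 0 ≤ a → a < b → b ≤ 1 → ∃ s ∈ T, a < s ∧ s < b := by
    intro a b ha hab hb
    by_contra! hcon
    have h1 : ∀ᵐ s ∂(volume : Measure ℝ).restrict (Ioo a b), s ∈ T :=
      ae_mono (Measure.restrict_mono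
      (show Ioo a b ⊆ Ico 0 1 from fun s hs => ⟨ha.trans hs.1.le, hs.2.trans_le hb⟩) le_rfl) hTae
    have h2 : ∀ᵐ s ∂(volume : Measure ℝ).restrict (Ioo a b), False := by
      filter_upwards [h1, ae_restrict_mem measurableSet_Ioo] with s h3 h4
      exact absurd h4.2 (not_lt.2 (hcon s h3 h4.1))
    rw [eventually_false_iff_eq_bot, ae_eq_bot, Measure.restrict_eq_zero, Real.volume_Ioo,
      ENNReal.ofReal_eq_zero] at h2
    linarith
  have hne : ∀ t ∈ Ico (0 : ℝ) 1, (𝓝[T ∩ Ioi t] t).NeBot := fun t ht => by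
    rw [← mem_closure_iff_nhdsWithin_neBot, Metric.mem_closure_iff]
    intro ε hε
    obtain ⟨s, hs, h1, h2⟩ := hdense t (min (t + ε) 1) ht.1 (lt_min (by linarith) ht.2)
      (min_le_right _ _)
    refine ⟨s, ⟨hs, h1⟩, ?_⟩
    rw [dist_comm, Real.dist_eq, abs_of_pos (sub_pos.2 h1)]
    linarith [h2.trans_le (min_le_left (t + ε) 1)]
  have hex : ∀ t, ∃ l, t ∈ Ico (0 : ℝ) 1 → Tendsto κ (𝓝[T ∩ Ioi t] t) (𝓝 l) := fun t => by
    by_cases ht : t ∈ Ico (0 : ℝ) 1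
    · have := hne t ht
      obtain ⟨l, hl⟩ := h.exists_tendsto_right (t := t)
      exact ⟨l, fun _ => hl⟩
    · exact ⟨0, fun h => absurd h ht⟩
  choose g hg using hex
  have hcl := isClosedCone_psd (D := D) |>.closed
  have hlow : ∀ s ∈ T, ∀ t ∈ Ico (0 : ℝ) 1, s ≤ t → g t - κ s ∈ psd D := fun s hs t ht hst => by
    have := hne t ht
    refine hcl.mem_of_tendsto ((hg t ht).sub_const (κ s)) ?_
    filter_upwards [self_mem_nhdsWithin] with r hr
    exact h.2 s hs r hr.1 (hst.trans (le_of_lt hr.2))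
  have hup : ∀ s ∈ T, ∀ t ∈ Ico (0 : ℝ) 1, t < s → κ s - g t ∈ psd D := fun s hs t ht hst => by
    have := hne t ht
    refine hcl.mem_of_tendsto ((hg t ht).const_sub (κ s)) ?_
    filter_upwards [self_mem_nhdsWithin, mem_nhdsWithin_of_mem_nhds (Iio_mem_nhds hst)] with r hr hr'
    exact h.2 r hr.1 s hs (le_of_lt hr')
  have hginc : IsIncreasingPath (Ico 0 1) g := by
    refine ⟨fun t ht => ?_, fun s hs t ht hst => ?_⟩
    · have := hne t ht
      refine hcl.mem_of_tendsto (hg t ht) ?_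
      filter_upwards [self_mem_nhdsWithin] with r hr
      exact h.1 r hr.1
    · rcases hst.eq_or_lt with rfl | hlt
      · rw [sub_self]; exact isClosedCone_psd.zero_mem
      · obtain ⟨r, hr, h1, h2⟩ := hdense s t hs.1 hlt ht.2.le
        have := isClosedCone_psd.add_mem _ (hlow r hr t ht h2.le) _ (hup r hr s hs h1)
        rwa [sub_add_sub_cancel] at this
  refine hginc.mem_pathCone (fun t ht => ?_) ?_
  · rw [ContinuousWithinAt, Metric.tendsto_nhdsWithin_nhds]
    intro ε hε
    obtain ⟨δ, hδ, hδ'⟩ := Metric.tendsto_nhdsWithin_nhds.1 (hg t ht) (ε / 2) (by linarith)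
    refine ⟨min δ (1 - t), lt_min hδ (by linarith [ht.2]), fun s hs hst => ?_⟩
    rw [mem_Ici] at hs
    rw [Real.dist_eq, abs_of_nonneg (sub_nonneg.2 hs)] at hst
    have hs1 : s ∈ Ico (0 : ℝ) 1 :=
      ⟨ht.1.trans hs, by linarith [hst.trans_le (min_le_right δ (1 - t))]⟩
    have := hne s hs1
    refine lt_of_le_of_lt (b := ε / 2) ?_ (by linarith)
    refine le_of_tendsto ((hg s hs1).dist tendsto_const_nhds) ?_
    have hlt : s < t + δ := by linarith [hst.trans_le (min_le_left δ (1 - t))]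
    filter_upwards [self_mem_nhdsWithin, mem_nhdsWithin_of_mem_nhds (Iio_mem_nhds hlt)] with r hr hr'
    have htr : t < r := lt_of_le_of_lt hs hr.2
    refine (hδ' ⟨hr.1, htr⟩ ?_).le
    rw [Real.dist_eq, abs_of_pos (sub_pos.2 htr)]
    rw [mem_Iio] at hr'
    linarith
  -- For `r < s` one has `g r ≤ κ s ≤ g s`. At continuity points of the trace of `g`, all but
  -- countably many, this squeezes `κ s` to `g s`.
  · have hcount := hginc.monotoneOn_trMat.countable_not_continuousWithinAt
    have hae := hcount.ae_notMem (pathMeasure)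
    have h0 : ∀ᵐ s ∂pathMeasure, s ≠ 0 := by
      have := (countable_singleton (0 : ℝ)).ae_notMem pathMeasure
      simpa using this
    filter_upwards [hae, hTae, h0] with s hs hsT hs0
    have hs1 := hT hsT
    have hs2 : s ∈ Ioo (0 : ℝ) 1 := ⟨lt_of_le_of_ne hs1.1 (Ne.symm hs0), hs1.2⟩
    have hc : ContinuousWithinAt (fun s => trMat (g s)) (Ico 0 1) s := by
      by_contra hcon
      exact hs ⟨hs1, hcon⟩
    have hc2 : Tendsto (fun r => trMat (g s) - trMat (g r)) (𝓝[<] s) (𝓝 (trMat (g s) - trMat (g s))) := by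
      refine Tendsto.const_sub _ ?_
      rw [← nhdsWithin_Ico_inter_Iio hs2]
      exact hc.mono_left (nhdsWithin_mono _ inter_subset_left)
    rw [sub_self] at hc2
    have h4 : ‖g s - κ s‖ ≤ 0 := by
      refine ge_of_tendsto hc2 ?_
      filter_upwards [self_mem_nhdsWithin, mem_nhdsWithin_of_mem_nhds (Ioi_mem_nhds hs2.1)] with r hr hr'
      have hr1 : r ∈ Ico (0 : ℝ) 1 := ⟨le_of_lt hr', lt_trans hr hs2.2⟩
      have h5 := trMat_nonneg (hup s hsT r hr1 hr)
      rw [trMat_sub] at h5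
      have h6 := norm_le_trMat (hlow s hsT s hs1 le_rfl)
      rw [trMat_sub] at h6
      linarith
    exact (sub_eq_zero.1 (norm_le_zero_iff.1 h4)).symm

/-- The lifted averages are increasing and converge to `κ` almost everywhere along a subsequence;
`κ` is increasing on the set of convergence. -/
theorem mem_pathCone_of_forall_stepProj {κ : PathSpace D}
    (h : ∀ n : ℕ+, stepProj n κ ∈ stepCone D n) : κ ∈ pathCone D := by
  have hlim : Tendsto (fun m : ℕ => stepLift m.succPNat (stepProj m.succPNat κ)) atTop (𝓝 κ) :=
    (tendsto_lift_proj κ).comp (tendsto_atTop_mono (f := fun m : ℕ => m.succPNat)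
      (g := fun m : ℕ => m.succPNat) (fun _ => le_rfl) (by
        refine tendsto_atTop.2 fun b => ?_
        filter_upwards [eventually_ge_atTop (b : ℕ)] with m hm
        exact_mod_cast hm.trans (Nat.le_succ m)))
  obtain ⟨φ, hφ, hae⟩ := (tendstoInMeasure_of_tendsto_Lp hlim).exists_seq_tendsto_ae
  have h2 : ∀ᵐ s ∂pathMeasure, ∀ m : ℕ, stepLift m.succPNat (stepProj m.succPNat κ) s
      = stepFun m.succPNat (stepProj m.succPNat κ) s := ae_all_iff.2 fun m => stepLift_coeFn _
  have h3 : ∀ᵐ s ∂pathMeasure, Tendsto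
      (fun j => stepFun (φ j).succPNat (stepProj (φ j).succPNat κ) s) atTop (𝓝 (κ s)) := by
    filter_upwards [hae, h2] with s e1 e2
    refine e1.congr fun j => e2 _
  set T : Set ℝ := {s | s ∈ Ico (0 : ℝ) 1 ∧ Tendsto
      (fun j => stepFun (φ j).succPNat (stepProj (φ j).succPNat κ) s) atTop (𝓝 (κ s))} with hT
  refine mem_pathCone_of_increasing (T := T) (fun s hs => hs.1) ?_ ⟨fun s hs => ?_, fun s hs t ht hst => ?_⟩
  · filter_upwards [h3, ae_restrict_mem measurableSet_Ico] with s e1 e2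
    exact ⟨e2, e1⟩
  · exact isClosedCone_psd.closed.mem_of_tendsto hs.2
      (Eventually.of_forall fun j => (isIncreasingPath_stepFun (h _)).1 s hs.1)
  · exact isClosedCone_psd.closed.mem_of_tendsto (ht.2.sub hs.2)
      (Eventually.of_forall fun j => (isIncreasingPath_stepFun (h _)).2 s hs.1 t ht.1 hst)

theorem isClosedCone_pathCone : IsClosedCone (pathCone D) where
  closed := by
    have : pathCone D = ⋂ n : ℕ+, (projMap D n) ⁻¹' stepCone D n := by
      ext κ
      simp only [mem_iInter, mem_preimage, projMap_apply]
      exact ⟨fun h n => stepProj_mem h, mem_pathCone_of_forall_stepProj⟩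
    rw [this]
    exact isClosed_iInter fun n =>
      isClosedCone_stepCone.closed.preimage isAdjointOf_liftMap.continuous
  zero_mem := zero_mem_pathCone
  add_mem _ hx _ hy := add_mem_pathCone hx hy
  smul_mem _ hc _ hx := smul_mem_pathCone hc hx

end IncreasingPaths

/-! ### Comparison of an increasing path with its averages -/

section Averages

variable {D : ℕ} {n : ℕ+}

theorem integrable_inner_path {μ ν : ℝ → SymMat D} {κ κ' : PathSpace D} (hμ : κ =ᵐ[pathMeasure] μ)
    (hν : κ' =ᵐ[pathMeasure] ν) : Integrable (fun s => inner ℝ (μ s) (ν s)) pathMeasure := by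
  refine (L2.integrable_inner (𝕜 := ℝ) κ κ').congr ?_
  filter_upwards [hμ, hν] with s h1 h2
  rw [h1, h2]

/-- Chebyshev's inequality for increasing matrix-valued functions on an interval of the
partition. -/
theorem inner_integral_cell_le {μ ν : ℝ → SymMat D} {κ κ' : PathSpace D}
    (hμ : κ =ᵐ[pathMeasure] μ) (hν : κ' =ᵐ[pathMeasure] ν) (hμi : IsIncreasingPath (Ico 0 1) μ)
    (hνi : IsIncreasingPath (Ico 0 1) ν) (k : Fin n) :
    n * inner ℝ (∫ s in cell n k, μ s) (∫ s in cell n k, ν s)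
      ≤ ∫ s in cell n k, inner ℝ (μ s) (ν s) := by
  have hn := pnat_cast_pos n
  have h1 := integrableOn_cell (integrable_of_ae_eq hμ) k
  have h2 := integrableOn_cell (integrable_of_ae_eq hν) k
  have h3 := integrableOn_cell (integrable_inner_path hμ hν) k
  set I := ∫ s in cell n k, μ s with hI
  set J := ∫ s in cell n k, ν s with hJ
  set K := ∫ s in cell n k, inner ℝ (μ s) (ν s) with hK
  -- The nonnegative function `⟪μ s - μ r, ν s - ν r⟫` is integrated in `s` here and in `r`
  -- afterwards.
  have hpt : ∀ r ∈ cell n k, 0 ≤ K - inner ℝ I (ν r) - inner ℝ (μ r) J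
      + (1 / n) * inner ℝ (μ r) (ν r) := by
    intro r hr
    have hint : ∫ s in cell n k, inner ℝ (μ s - μ r) (ν s - ν r)
        = K - inner ℝ I (ν r) - inner ℝ (μ r) J + (1 / n) * inner ℝ (μ r) (ν r) := by
      have e : ∀ s, inner ℝ (μ s - μ r) (ν s - ν r)
          = inner ℝ (μ s) (ν s) - inner ℝ (ν r) (μ s) - inner ℝ (μ r) (ν s)
            + inner ℝ (μ r) (ν r) := fun s => by
        rw [inner_sub_left, inner_sub_right, inner_sub_right, real_inner_comm (ν r) (μ s)]; ring
      have i1 : IntegrableOn (fun s => inner ℝ (ν r) (μ s)) (cell n k) volume := h1.const_inner _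
      have i2 : IntegrableOn (fun s => inner ℝ (μ r) (ν s)) (cell n k) volume := h2.const_inner _
      have i3 : IntegrableOn (fun s => inner ℝ (μ s) (ν s) - inner ℝ (ν r) (μ s)) (cell n k)
        volume := h3.sub i1
      have i4 : IntegrableOn (fun s => inner ℝ (μ s) (ν s) - inner ℝ (ν r) (μ s)
        - inner ℝ (μ r) (ν s)) (cell n k) volume := i3.sub i2
      simp_rw [e]
      rw [integral_add i4 (integrableOn_const_cell k _), integral_sub i3 i2, integral_sub h3 i1, integral_inner h1, integral_inner h2,
        setIntegral_const, volume_real_cell, smul_eq_mul, real_inner_comm (∫ s in cell n k, μ s)]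
    rw [← hint]
    refine setIntegral_nonneg (measurableSet_cell k) fun s hs => ?_
    exact hμi.inner_sub_nonneg hνi (cell_subset k hs) (cell_subset k hr)
  have h4 := setIntegral_nonneg (μ := volume) (measurableSet_cell k) hpt
  have i1 : IntegrableOn (fun r => inner ℝ I (ν r)) (cell n k) volume := h2.const_inner _
  have i2 : IntegrableOn (fun r => inner ℝ (μ r) J) (cell n k) volume := h1.inner_const _
  have i3 : ∫ r in cell n k, inner ℝ (μ r) J = inner ℝ I J := by
    simp_rw [real_inner_comm J]
    rw [integral_inner h1]
  have i4 : IntegrableOn (fun r => K - inner ℝ I (ν r)) (cell n k) volume :=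
    (integrableOn_const_cell k K).sub i1
  have i5 : IntegrableOn (fun r => K - inner ℝ I (ν r) - inner ℝ (μ r) J) (cell n k) volume :=
    i4.sub i2
  rw [integral_add i5 (h3.const_mul _), integral_sub i4 i2,
    integral_sub (integrableOn_const_cell k K) i1, integral_inner h2, i3, integral_const_mul,
    setIntegral_const, volume_real_cell, smul_eq_mul] at h4
  have h5 : inner ℝ I J ≤ 1 / n * K := by linarith
  calc n * inner ℝ I J ≤ n * (1 / n * K) := mul_le_mul_of_nonneg_left h5 hn.le
    _ = K := by field_simp

/-- Chebyshev's inequality on each cell: averaging lowers a path in the order of `C^*`, so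
increasing functions decrease under averaging. -/
theorem sub_lift_proj_mem_dualCone {κ : PathSpace D} (hκ : κ ∈ pathCone D) :
    κ - stepLift n (stepProj n κ) ∈ dualCone (pathCone D) := by
  have hn := pnat_cast_pos n
  intro κ' hκ'
  obtain ⟨μ, hμi, hμ⟩ := exists_increasing_of_mem_pathCone hκ
  obtain ⟨ν, hνi, hν⟩ := exists_increasing_of_mem_pathCone hκ'
  have h1 : inner ℝ (stepLift n (stepProj n κ)) κ'
      = ∑ k : Fin n, n * inner ℝ (∫ s in cell n k, μ s) (∫ s in cell n k, ν s) := by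
    rw [real_inner_comm κ', inner_stepLift, inner_stepSpace]
    refine Finset.sum_congr rfl fun k _ => ?_
    rw [stepProj_eq hμ, stepProj_eq hν, inner_smul_symMat, inner_symMat_smul, real_inner_comm]
    field_simp
  have h2 : inner ℝ κ κ' = ∑ k : Fin n, ∫ s in cell n k, inner ℝ (μ s) (ν s) := by
    rw [← integral_eq_sum_cell (integrable_inner_path hμ hν), L2.inner_def]
    refine integral_congr_ae ?_
    filter_upwards [hμ, hν] with s e1 e2
    rw [e1, e2]
  rw [inner_sub_left κ, h1, h2, sub_nonneg]
  exact Finset.sum_le_sum fun k _ => inner_integral_cell_le hμ hν hμi hνi k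

/-- Increasing paths are close to their averages in `L¹`. -/
theorem integral_norm_sub_lift_proj_le {κ : PathSpace D} (hκ : κ ∈ pathCone D) :
    ∫ s in Ico (0 : ℝ) 1, ‖κ s - stepLift n (stepProj n κ) s‖
      ≤ (‖idMat D‖ + 2) * √(1 / n) * ‖κ‖ := by
  have hn := pnat_cast_pos n
  obtain ⟨μ, hμi, hμ⟩ := exists_increasing_of_mem_pathCone hκ
  have hint := integrable_of_ae_eq hμ
  set m : Fin n → SymMat D := fun k => (n : ℝ) • ∫ s in cell n k, μ s with hm
  set T : ℕ → ℝ := fun j => trMat (μ ((j : ℝ) / n)) with hT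
  set C := ‖idMat D‖ * (√(1 / n) * ‖κ‖) with hC
  have hpt : ∀ j : ℕ, j < n → (j : ℝ) / n ∈ Ico (0 : ℝ) 1 := fun j hj =>
    cell_subset ⟨j, hj⟩ ⟨le_rfl, div_lt_div_of_pos_right (lt_add_one _) hn⟩
  have h0 : ∫ s in Ico (0 : ℝ) 1, ‖κ s - stepLift n (stepProj n κ) s‖
      = ∑ k : Fin n, ∫ s in cell n k, ‖μ s - m k‖ := by
    have e : (fun s => ‖κ s - stepLift n (stepProj n κ) s‖) =ᵐ[pathMeasure]
        fun s => ‖(κ - stepLift n (stepProj n κ)) s‖ := by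
      filter_upwards [Lp.coeFn_sub κ (stepLift n (stepProj n κ))] with s hs
      rw [hs, Pi.sub_apply]
    rw [integral_congr_ae e, integral_eq_sum_cell (n := n) (integrable_path _).norm]
    refine Finset.sum_congr rfl fun k _ => integral_congr_ae ?_
    filter_upwards [ae_cell_of_ae hμ k, ae_cell_of_ae (stepLift_coeFn (stepProj n κ)) k,
      ae_cell_of_ae (Lp.coeFn_sub κ (stepLift n (stepProj n κ))) k,
      ae_restrict_mem (measurableSet_cell k)] with s e1 e2 e3 e4
    rw [e3, Pi.sub_apply, e1, e2, stepFun_of_mem e4, stepProj_eq hμ]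
  -- On every cell but the last, the oscillation is at most the increment of the trace between
  -- endpoints, and these increments telescope. The right endpoint of the last cell is `1`, where
  -- the path may blow up; that cell is treated by Cauchy-Schwarz.
  have hcell : ∀ k : Fin n, (k : ℕ) + 1 < n →
      ∫ s in cell n k, ‖μ s - m k‖ ≤ (1 / n) * (T (k + 1) - T k) := by
    intro k hk
    have hp : ∀ s ∈ cell n k, ∀ r ∈ cell n k, ‖μ s - μ r‖ ≤ T (k + 1) - T k := fun s hs r hr => by
      refine hμi.norm_sub_le_of_mem_Icc (cell_subset k hs) (cell_subset k hr) (hpt k k.2)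
        (hpt _ hk) ⟨hs.1, ?_⟩ ⟨hr.1, ?_⟩ <;> push_cast
      exacts [hs.2.le, hr.2.le]
    have hc := integrableOn_cell hint k
    have hp2 : ∀ s ∈ cell n k, ‖‖μ s - m k‖‖ ≤ T (k + 1) - T k := fun s hs => by
      have e : μ s - m k = (n : ℝ) • ∫ r in cell n k, (μ s - μ r) := by
        rw [integral_sub (integrableOn_const_cell k _) hc, smul_sub, smul_integral_cell_const]
      rw [norm_norm, e, norm_smul, Real.norm_eq_abs, abs_of_pos hn]
      have := norm_setIntegral_le_of_norm_le_const (μ := volume) (s := cell n k)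
        (by rw [cell, Real.volume_Ico]; exact ENNReal.ofReal_lt_top) (hp s hs)
      rw [volume_real_cell] at this
      calc _ ≤ (n : ℝ) * ((T (k + 1) - T k) * (1 / n)) := mul_le_mul_of_nonneg_left this hn.le
        _ = _ := by field_simp
    have := norm_setIntegral_le_of_norm_le_const (μ := volume) (s := cell n k)
        (by rw [cell, Real.volume_Ico]; exact ENNReal.ofReal_lt_top) hp2
    rw [volume_real_cell, mul_comm] at this
    exact (le_abs_self _).trans this
  obtain ⟨N, hN⟩ := Nat.exists_eq_succ_of_ne_zero n.ne_zero
  have hNn : N < n := by omega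
  have hlastC := integral_norm_cell_le κ (⟨N, hNn⟩ : Fin n)
  rw [integral_congr_ae (g := fun s => ‖μ s‖) (by
    filter_upwards [ae_cell_of_ae hμ ⟨N, hNn⟩] with s hs; rw [hs])] at hlastC
  have hclast := integrableOn_cell hint (⟨N, hNn⟩ : Fin n)
  have hlast : ∫ s in cell n ⟨N, hNn⟩, ‖μ s - m ⟨N, hNn⟩‖ ≤ 2 * (√(1 / n) * ‖κ‖) := by
    have e1 : ‖m ⟨N, hNn⟩‖ ≤ n * ∫ s in cell n ⟨N, hNn⟩, ‖μ s‖ := by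
      rw [hm, norm_smul, Real.norm_eq_abs, abs_of_pos hn]
      exact mul_le_mul_of_nonneg_left (norm_integral_le_integral_norm _) hn.le
    have e2 : ∫ s in cell n ⟨N, hNn⟩, ‖μ s - m ⟨N, hNn⟩‖
        ≤ ∫ s in cell n ⟨N, hNn⟩, (‖μ s‖ + ‖m ⟨N, hNn⟩‖) :=
      integral_mono (hclast.sub (integrableOn_const_cell _ _)).norm
        (hclast.norm.add (integrableOn_const_cell _ _)) fun s => norm_sub_le _ _
    rw [integral_add hclast.norm (integrableOn_const_cell _ _), setIntegral_const, volume_real_cell,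
      smul_eq_mul] at e2
    have e3 := mul_le_mul_of_nonneg_left e1 (show 0 ≤ 1 / (n : ℝ) by positivity)
    rw [← mul_assoc, one_div_mul_cancel hn.ne', one_mul] at e3
    linarith
  -- The telescoped trace is its value at the left endpoint of the last cell, hence below the trace
  -- on that cell, whose integral is of order `n^(-1/2)`.
  have hTN : (1 / n) * T N ≤ C := by
    have e1 : ∫ s in cell n ⟨N, hNn⟩, T N ≤ ∫ s in cell n ⟨N, hNn⟩, ‖idMat D‖ * ‖μ s‖ := by
      refine setIntegral_mono_on (integrableOn_const_cell _ _) (hclast.norm.const_mul _)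
        (measurableSet_cell _) fun s hs => ?_
      refine (hμi.monotoneOn_trMat (hpt N hNn) (cell_subset _ hs) hs.1).trans ?_
      rw [mul_comm]
      exact trMat_le _
    rw [setIntegral_const, volume_real_cell, smul_eq_mul, integral_const_mul] at e1
    exact e1.trans (mul_le_mul_of_nonneg_left hlastC (norm_nonneg _))
  have hsum : ∑ k : Fin n, ∫ s in cell n k, ‖μ s - m k‖
      = ∑ k ∈ Finset.range n, if h : k < n then ∫ s in cell n ⟨k, h⟩, ‖μ s - m ⟨k, h⟩‖ else 0 := by
    rw [Finset.sum_range]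
    refine Finset.sum_congr rfl fun k _ => ?_
    rw [dif_pos k.2]
  have hrange : Finset.range (n : ℕ) = Finset.range (N + 1) := by rw [hN]
  rw [h0, hsum, hrange, Finset.sum_range_succ]
  have hfirst : ∑ k ∈ Finset.range N, (if h : k < n then ∫ s in cell n ⟨k, h⟩, ‖μ s - m ⟨k, h⟩‖
      else 0) ≤ ∑ k ∈ Finset.range N, (1 / n) * (T (k + 1) - T k) := by
    refine Finset.sum_le_sum fun k hk => ?_
    rw [Finset.mem_range] at hk
    rw [dif_pos (by omega : k < n)]
    exact hcell ⟨k, by omega⟩ (by simp only; omega)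
  rw [← Finset.mul_sum, Finset.sum_range_sub] at hfirst
  have hT0 : 0 ≤ T 0 := trMat_nonneg (hμi.1 _ (hpt 0 n.pos))
  have h6 : (1 / (n : ℝ)) * (T N - T 0) ≤ 1 / n * T N :=
    mul_le_mul_of_nonneg_left (by linarith) (by positivity)
  rw [dif_pos hNn]
  calc _ ≤ C + 2 * (√(1 / n) * ‖κ‖) := add_le_add (hfirst.trans (h6.trans hTN)) hlast
    _ = _ := by rw [hC]; ring

end Averages

/-! ### The nonlinearity on paths and on step functions -/

section PathFunctional

variable {D : ℕ} {n : ℕ+} {ξb : SymMat D → ℝ} {L : NNReal}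

/-- The functional `μ ↦ ∫ ξb(μ)`. -/
noncomputable def pathFunctional (ξb : SymMat D → ℝ) (μ : PathSpace D) : ℝ :=
  ∫ s in Ico (0 : ℝ) 1, ξb (μ s)

theorem pathNonlin_eq (ξb : SymMat D → ℝ) :
    pathNonlin ξb = coneExt (pathCone D) (pathFunctional ξb) := rfl

theorem integrable_comp_path (hL : LipschitzOnWith L ξb (psd D)) {μ : PathSpace D}
    (hμ : μ ∈ pathCone D) : Integrable (fun s => ξb (μ s)) pathMeasure := by
  obtain ⟨g, hg, hgξ⟩ := hL.extend_real
  have h1 : Integrable (fun s => g (μ s)) pathMeasure := by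
    refine ((integrable_const |g 0|).add ((integrable_path μ).norm.const_mul L)).mono'
      (hg.continuous.comp_aestronglyMeasurable (Lp.aestronglyMeasurable μ))
      (Eventually.of_forall fun s => ?_)
    have := hg.dist_le_mul (μ s) 0
    rw [dist_zero_right, Real.dist_eq] at this
    rw [Real.norm_eq_abs]
    simp only [Pi.add_apply]
    have h2 := abs_sub_abs_le_abs_sub (g (μ s)) (g 0)
    linarith
  refine h1.congr ?_
  filter_upwards [ae_mem_psd hμ] with s hs
  exact (hgξ hs).symm

theorem lipschitzOn_pathFunctional (hL : LipschitzOnWith L ξb (psd D)) :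
    LipschitzOnWith L (pathFunctional ξb) (pathCone D) := by
  refine LipschitzOnWith.of_dist_le_mul fun μ hμ ν hν => ?_
  rw [Real.dist_eq, dist_eq_norm μ, pathFunctional, pathFunctional,
    ← integral_sub (integrable_comp_path hL hμ) (integrable_comp_path hL hν)]
  refine (abs_integral_le_integral_abs).trans ?_
  refine le_trans ?_ (mul_le_mul_of_nonneg_left (integral_norm_le (μ - ν)) L.2)
  rw [← integral_const_mul]
  refine integral_mono_ae ((integrable_comp_path hL hμ).sub (integrable_comp_path hL hν)).abs
    ((integrable_path _).norm.const_mul _) ?_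
  filter_upwards [ae_mem_psd hμ, ae_mem_psd hν, Lp.coeFn_sub μ ν] with s h1 h2 h3
  have := hL.dist_le_mul _ h1 _ h2
  rw [Real.dist_eq, dist_eq_norm] at this
  rw [h3]
  exact this

theorem pathFunctional_stepLift (x : StepSpace D n) :
    pathFunctional ξb (stepLift n x) = stepFunctional ξb n x :=
  integral_comp_stepLift ξb x

theorem stepProj_mem_dualCone {κ : PathSpace D} (hκ : κ ∈ dualCone (pathCone D)) :
    stepProj n κ ∈ dualCone (stepCone D n) := fun x hx => by
  rw [← inner_stepLift]
  exact hκ _ (stepLift_mem hx)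

theorem stepLift_mem_dualCone {x : StepSpace D n} (hx : x ∈ dualCone (stepCone D n)) :
    stepLift n x ∈ dualCone (pathCone D) := fun κ hκ => by
  rw [real_inner_comm κ, inner_stepLift, real_inner_comm x]
  exact hx _ (stepProj_mem hκ)

theorem tendsto_pathFunctional (hL : LipschitzOnWith L ξb (psd D)) {μ : PathSpace D}
    (hμ : μ ∈ pathCone D) :
    Tendsto (fun n : ℕ+ => stepFunctional ξb n (stepProj n μ)) atTop (𝓝 (pathFunctional ξb μ)) := by
  simp_rw [← pathFunctional_stepLift]
  refine ((lipschitzOn_pathFunctional hL).continuousOn μ hμ).tendsto.comp ?_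
  exact tendsto_nhdsWithin_iff.2 ⟨tendsto_lift_proj μ,
    Eventually.of_forall fun n => stepLift_mem (stepProj_mem hμ)⟩

/-- Monotonicity passes to the limit from step functions, since averaging maps the dual cone of
paths into that of step functions. -/
theorem isConeFunctional_path (hξ : IsProperFn D ξb) (hL : LipschitzOnWith L ξb (psd D)) :
    IsConeFunctional (pathCone D) (pathFunctional ξb) L := by
  refine ⟨pathCone_subset_dualCone, lipschitzOn_pathFunctional hL, fun μ hμ ν hν hμν => ?_⟩
  refine le_of_tendsto_of_tendsto' (tendsto_pathFunctional hL hν) (tendsto_pathFunctional hL hμ)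
    fun n => increasing_stepFunctional hξ hL _ (stepProj_mem hμ) _ (stepProj_mem hν) ?_
  have := stepProj_mem_dualCone (n := n) hμν
  rwa [← projMap_apply, LinearMap.map_sub (projMap D n)] at this

/-- Averaging a competitor keeps the constraint relative to `b` and, by `sub_lift_proj_mem_dualCone`
and monotonicity, does not raise the cost; step competitors therefore suffice. -/
theorem pathNonlin_stepLift (hξ : IsProperFn D ξb) (hL : LipschitzOnWith L ξb (psd D))
    (b : StepSpace D n) : pathNonlin ξb (stepLift n b) = stepNonlin ξb n b := by
  have := FiniteDimensional.complete ℝ (StepSpace D n)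
  have hsub : ∀ κ : PathSpace D, stepProj n (κ - stepLift n b) = stepProj n κ - b := fun κ => by
    rw [← projMap_apply, LinearMap.map_sub (projMap D n), projMap_apply, projMap_apply,
      stepProj_stepLift]
  rw [pathNonlin_eq, stepNonlin_eq]
  apply le_antisymm
  · refine le_coneExt isClosedCone_stepCone fun a ha hab => ?_
    rw [← pathFunctional_stepLift]
    refine (isConeFunctional_path hξ hL).coneExt_le isClosedCone_pathCone (stepLift_mem ha) ?_
    rw [← liftMap_apply, ← liftMap_apply, ← LinearIsometry.map_sub]
    exact stepLift_mem_dualCone hab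
  · refine le_coneExt isClosedCone_pathCone fun μ hμ hμb => ?_
    have h1 := stepProj_mem_dualCone (n := n) hμb
    rw [hsub] at h1
    refine ((isConeFunctional_step hξ hL).coneExt_le isClosedCone_stepCone (stepProj_mem hμ) h1).trans ?_
    rw [← pathFunctional_stepLift]
    exact (isConeFunctional_path hξ hL).increasing _ hμ _ (stepLift_mem (stepProj_mem hμ))
      (sub_lift_proj_mem_dualCone hμ)

end PathFunctional

/-! ### Comparison principles with and without Neumann condition -/

section Comparison

variable {E : Type*} [NormedAddCommGroup E] [InnerProductSpace ℝ E] {S : Set E} {F : E → ℝ}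
  {L : NNReal} {u v : ℝ × E → ℝ}

theorem le_of_isSubAdm [CompleteSpace E] (hSc : IsClosed S) (hS : Convex ℝ S)
    {N : E → E → Prop} {e : E} (he : e ∈ S)
    (hN : ∀ x ∈ S, ∀ y₁ ∈ S, ∀ y₂ ∈ S, ∀ a₁ a₂ b : ℝ, 0 ≤ a₁ → 0 ≤ a₂ → 0 < b →
      N x (a₁ • (x - y₁) + a₂ • (x - y₂) + b • (x - e)))
    (hF : ∀ q q', |F q - F q'| ≤ L * ‖q - q'‖) (hu : IsLipOn S u) (hv : IsLipOn S v)
    (hus : IsSubAdm S N F u) (hvs : IsSubAdm S N (reflect F) (fun q => -v q))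
    (h0 : ∀ x ∈ S, u (0, x) ≤ v (0, x)) : ∀ p ∈ Ici (0 : ℝ) ×ˢ S, u p ≤ v p := by
  obtain ⟨M₁, hM₁⟩ := hu
  obtain ⟨M₂, hM₂⟩ := hv
  have hM₂' : LipschitzOnWith M₂ (fun q => -v q) (Ici (0 : ℝ) ×ˢ S) :=
    LipschitzOnWith.of_dist_le_mul fun x hx y hy => by
      rw [dist_neg_neg]; exact hM₂.dist_le_mul x hx y hy
  intro p hp
  have := add_nonpos_of_isSubAdm hSc hS he hN hF (hM₁.weaken (le_max_left M₁ M₂))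
    (hM₂'.weaken (le_max_right M₁ M₂)) hus hvs (fun x hx => by linarith [h0 x hx]) p hp
  linarith

theorem le_of_isViscSub_of_isViscSuper [CompleteSpace E] (hSc : IsClosed S) (hS : Convex ℝ S)
    (hne : S.Nonempty) (hF : ∀ q q', |F q - F q'| ≤ L * ‖q - q'‖) (hu : IsLipOn S u)
    (hv : IsLipOn S v) (hus : IsViscSub S F u) (hvs : IsViscSuper S F v)
    (h0 : ∀ x ∈ S, u (0, x) ≤ v (0, x)) : ∀ p ∈ Ici (0 : ℝ) ×ˢ S, u p ≤ v p := by
  obtain ⟨e, he⟩ := hne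
  exact le_of_isSubAdm (N := fun _ _ => True) hSc hS he (fun _ _ _ _ _ _ _ _ _ _ _ _ => trivial)
    hF hu hv (hus.isSubAdm _) (hvs.isSubAdm_neg _) h0

/-- `S` contains a ball around `e`, so the normal inequality can be tested at `e` moved slightly
along `ν`. -/
theorem inner_outerNormals_pos {e x : E} (he : e ∈ interior S) {ν : E}
    (hν : ν ∈ outerNormals S x) : 0 < inner ℝ ν (x - e) := by
  obtain ⟨ρ, hρ, hball⟩ := Metric.mem_nhds_iff.1 (mem_interior_iff_mem_nhds.1 he)
  have h1 := hν.2 (e + (ρ / 2) • ν) (hball (by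
    rw [mem_ball_iff_norm, add_sub_cancel_left, norm_smul, hν.1, Real.norm_eq_abs,
      abs_of_pos (by linarith)]
    linarith))
  have h2 : e + (ρ / 2) • ν - x = -(x - e) + (ρ / 2) • ν := by abel
  rw [h2, inner_add_right, inner_neg_right, real_inner_smul_right, real_inner_self_eq_norm_sq,
    hν.1] at h1
  linarith

theorem IsViscSub.isNeumannSub (h : IsViscSub S F u) : IsNeumannSub S F u :=
  ⟨h.1, fun p hp φ φt φx hφ hm => ⟨fun _ => h.2 p hp φ φt φx hφ hm,
    fun _ => Or.inr (h.2 p hp φ φt φx hφ hm)⟩⟩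

theorem IsViscSuper.isNeumannSuper (h : IsViscSuper S F u) : IsNeumannSuper S F u :=
  ⟨h.1, fun p hp φ φt φx hφ hm => ⟨fun _ => h.2 p hp φ φt φx hφ hm,
    fun _ => Or.inr (h.2 p hp φ φt φx hφ hm)⟩⟩

theorem mem_interior_or_frontier {X : Type*} [TopologicalSpace X] {S : Set X} {x : X} (hx : x ∈ S) : x ∈ interior S ∨ x ∈ frontier S := by
  by_cases h : x ∈ interior S
  · exact Or.inl h
  · exact Or.inr ⟨subset_closure hx, h⟩

/-- A gradient pointing strictly outwards along every normal rules out the boundary alternative. -/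
theorem IsNeumannSub.isSubAdm (h : IsNeumannSub S F u) :
    IsSubAdm S (fun x g => ∀ ν ∈ outerNormals S x, 0 < inner ℝ ν g) F u := by
  intro p hp φ φt φx hφ hm hN
  have h1 := h.2 p hp φ φt φx hφ hm
  rcases mem_interior_or_frontier hp.2 with hi | hf
  · linarith [h1.1 hi]
  · rcases h1.2 hf with ⟨ν, hν, hle⟩ | hle
    · linarith [hN ν hν]
    · linarith

theorem IsNeumannSuper.isSubAdm_neg (h : IsNeumannSuper S F u) :
    IsSubAdm S (fun x g => ∀ ν ∈ outerNormals S x, 0 < inner ℝ ν g) (reflect F)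
      (fun q => -u q) := by
  intro p hp φ φt φx hφ hm hN
  have h1 := h.2 p hp _ _ _ hφ.neg (by
    refine hm.neg.mono fun q hq => ?_
    linarith)
  simp only [reflect]
  rcases mem_interior_or_frontier hp.2 with hi | hf
  · linarith [h1.1 hi]
  · rcases h1.2 hf with ⟨ν, hν, hle⟩ | hle
    · rw [inner_neg_right] at hle
      linarith [hN ν hν]
    · linarith

theorem le_of_isNeumannSub_of_isNeumannSuper [CompleteSpace E] (hSc : IsClosed S)
    (hS : Convex ℝ S) (hne : (interior S).Nonempty) (hF : ∀ q q', |F q - F q'| ≤ L * ‖q - q'‖)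
    (hu : IsLipOn S u) (hv : IsLipOn S v) (hus : IsNeumannSub S F u) (hvs : IsNeumannSuper S F v)
    (h0 : ∀ x ∈ S, u (0, x) ≤ v (0, x)) : ∀ p ∈ Ici (0 : ℝ) ×ˢ S, u p ≤ v p := by
  obtain ⟨e, he⟩ := hne
  refine le_of_isSubAdm hSc hS (interior_subset he) ?_ hF hu hv hus.isSubAdm hvs.isSubAdm_neg h0
  intro x hx y₁ hy₁ y₂ hy₂ a₁ a₂ b ha₁ ha₂ hb ν hν
  have h1 := hν.2 y₁ hy₁
  have h2 := hν.2 y₂ hy₂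
  rw [← neg_sub, inner_neg_right] at h1 h2
  rw [inner_add_right, inner_add_right, real_inner_smul_right, real_inner_smul_right,
    real_inner_smul_right]
  have h3 := mul_pos hb (inner_outerNormals_pos he hν)
  have h4 := mul_nonneg ha₁ (show 0 ≤ inner ℝ ν (x - y₁) by linarith)
  have h5 := mul_nonneg ha₂ (show 0 ≤ inner ℝ ν (x - y₂) by linarith)
  linarith

/-- One-sided directional bounds on a function bound the gradients of the test functions touching
it from above. -/
theorem le_inner_of_isLocalMaxOn {φ φt : ℝ × E → ℝ} {φx : ℝ × E → E}
    (hφ : IsSmoothTest univ φ φt φx) {p : ℝ × E} (hp : 0 < p.1)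
    (hm : IsLocalMaxOn (fun q => u q - φ q) (Ioi (0 : ℝ) ×ˢ univ) p) {w : E} {c : ℝ}
    (hc : ∀ h : ℝ, 0 < h → u p + h * c ≤ u (p.1, p.2 + h • w)) : c ≤ inner ℝ (φx p) w := by
  have hpm : p ∈ Ioi (0 : ℝ) ×ˢ (univ : Set E) := ⟨hp, trivial⟩
  have hpath : Tendsto (fun h : ℝ => ((p.1, p.2 + h • w) : ℝ × E)) (𝓝[>] 0)
      (𝓝[Ioi (0 : ℝ) ×ˢ univ] p) := by
    refine tendsto_nhdsWithin_iff.2 ⟨?_, Eventually.of_forall fun h => ⟨hp, trivial⟩⟩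
    have h1 : Continuous fun h : ℝ => ((p.1, p.2 + h • w) : ℝ × E) := by fun_prop
    have h2 := h1.tendsto 0
    simp only [zero_smul, add_zero] at h2
    exact h2.mono_left nhdsWithin_le_nhds
  obtain ⟨C, hC⟩ := ((hφ.expansion p hpm).comp_tendsto hpath).bound
  have hev : ∀ᶠ h : ℝ in 𝓝[>] 0, c ≤ inner ℝ (φx p) w + C * (h * ‖w‖ ^ 2) := by
    filter_upwards [hC, hpath.eventually hm, self_mem_nhdsWithin] with h h1 h2 h3
    rw [mem_Ioi] at h3
    simp only [Function.comp_apply, sub_self, mul_zero, zero_add, add_sub_cancel_left, norm_smul,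
      abs_zero, real_inner_smul_right, Real.norm_eq_abs] at h1
    rw [zero_pow two_ne_zero, zero_add, mul_pow, sq_abs, abs_of_nonneg (show 0 ≤ h ^ 2 * ‖w‖ ^ 2 by positivity)] at h1
    have h4 := (abs_le.1 h1).2
    have h5 := hc h h3
    have h6 : h * c ≤ h * (inner ℝ (φx p) w + C * (h * ‖w‖ ^ 2)) := by nlinarith
    exact le_of_mul_le_mul_left h6 h3
  have h1 : Continuous fun h : ℝ => inner ℝ (φx p) w + C * (h * ‖w‖ ^ 2) := by fun_prop
  have h2 := h1.tendsto 0
  simp only [zero_mul, mul_zero, add_zero] at h2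
  exact ge_of_tendsto (h2.mono_left nhdsWithin_le_nhds) hev

end Comparison

/-! ### Finite-dimensional solutions and independence of the regularization -/

section StepValue

variable {D : ℕ} {n : ℕ+} {ξb ξb' : SymMat D → ℝ} {L L' : NNReal} {u : StepSpace D n → ℝ}

instance : CompleteSpace (StepSpace D n) := FiniteDimensional.complete ℝ _

theorem stepCone_nonempty_interior : (interior (stepCone D n)).Nonempty :=
  ⟨_, stepInner_mem_interior⟩

/-- The admissible directions of the game on step functions. -/
def stepMoves (D : ℕ) (n : ℕ+) (L : NNReal) : Set (StepSpace D n) :=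
  stepCone D n ∩ {z | ‖z‖ ≤ L}

theorem isGame_step (hξ : IsProperFn D ξb) (hL : LipschitzOnWith L ξb (psd D)) :
    IsGame (stepNonlin ξb n) (stepMoves D n L) L :=
  (isConeFunctional_step hξ hL).isGame isClosedCone_stepCone

theorem stepCone_add_moves : ∀ x ∈ stepCone D n, ∀ z ∈ stepMoves D n L, ∀ h : ℝ, 0 ≤ h →
    x + h • z ∈ stepCone D n := fun x hx z hz h hh =>
  isClosedCone_stepCone.add_mem x hx _ (isClosedCone_stepCone.smul_mem h hh z hz.1)

/-- The value of the game on step functions. -/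
noncomputable def stepValue (ξb : SymMat D → ℝ) (n : ℕ+) (L : NNReal) (u : StepSpace D n → ℝ) :
    ℝ × StepSpace D n → ℝ := gameValue (stepNonlin ξb n) (stepMoves D n L) u

/-- The functions on `StepSpace D n` which are increasing and Lipschitz for the `L¹` norm. -/
structure IsIncreasingLip (u : StepSpace D n → ℝ) : Prop where
  increasing : ∀ c ∈ dualCone (stepCone D n), ∀ x, u x ≤ u (x + c)
  lip : ∀ x w, u (x + w) ≤ u x + stepNorm1 w

theorem IsIncreasingLip.lipschitzWith (h : IsIncreasingLip u) : LipschitzWith 1 u := by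
  refine LipschitzWith.of_le_add fun x y => ?_
  have := h.lip y (x - y)
  rw [add_sub_cancel] at this
  rw [dist_eq_norm]
  linarith [stepNorm1_le (x - y)]

theorem isLipOn_stepValue (hξ : IsProperFn D ξb) (hL : LipschitzOnWith L ξb (psd D))
    (hu : IsIncreasingLip u) (S : Set (StepSpace D n)) : IsLipOn S (stepValue ξb n L u) := by
  obtain ⟨K, hK⟩ := (isGame_step hξ hL).exists_lipschitzOnWith_value hu.lipschitzWith
  exact ⟨K, hK.mono (prod_mono_right (subset_univ S))⟩

theorem isViscSub_stepValue (hξ : IsProperFn D ξb) (hL : LipschitzOnWith L ξb (psd D))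
    (hu : IsIncreasingLip u) : IsViscSub (stepCone D n) (stepNonlin ξb n) (stepValue ξb n L u) :=
  (isGame_step hξ hL).isViscSub_value hu.lipschitzWith isClosedCone_stepCone.closed
    isClosedCone_stepCone.convex stepCone_add_moves

theorem isViscSuper_stepValue (hξ : IsProperFn D ξb) (hL : LipschitzOnWith L ξb (psd D))
    (hu : IsIncreasingLip u) : IsViscSuper (stepCone D n) (stepNonlin ξb n) (stepValue ξb n L u) :=
  (isGame_step hξ hL).isViscSuper_value hu.lipschitzWith isClosedCone_stepCone.closed
    isClosedCone_stepCone.convex stepCone_add_moves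

theorem stepValue_zero (hξ : IsProperFn D ξb) (hL : LipschitzOnWith L ξb (psd D))
    (hu : IsIncreasingLip u) (x : StepSpace D n) : stepValue ξb n L u (0, x) = u x :=
  (isGame_step hξ hL).value_zero hu.lipschitzWith x

/-- The element with a single nonzero coordinate. -/
noncomputable def stepSingle (k : Fin n) (a : SymMat D) : StepSpace D n :=
  fun i => if i = k then a else 0

theorem inner_stepSingle (x : StepSpace D n) (k : Fin n) (a : SymMat D) :
    inner ℝ x (stepSingle k a) = (1 / (n : ℝ)) * inner ℝ (x k) a := by
  rw [inner_stepSpace, Finset.sum_eq_single k]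
  · rw [stepSingle, if_pos rfl]
  · intro i _ hik
    rw [stepSingle, if_neg hik, inner_zero_right, mul_zero]
  · simp

theorem stepNorm1_stepSingle (k : Fin n) (a : SymMat D) :
    stepNorm1 (stepSingle k a) = (1 / (n : ℝ)) * ‖a‖ := by
  rw [stepNorm1, Finset.sum_eq_single k]
  · rw [stepSingle, if_pos rfl]
  · intro i _ hik
    rw [stepSingle, if_neg hik, norm_zero, mul_zero]
  · simp

/-- The first bound is the bipolar criterion. The second, tested on the single coordinate `g k`,
gives `‖g k‖ ^ 2 ≤ ‖g k‖`: this is how the `L¹` Lipschitz constant 1 matches the ball of norm 1 on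
which regularizations agree. -/
theorem mem_stepCone_of_inner_bounds {g : StepSpace D n}
    (h0 : ∀ c ∈ dualCone (stepCone D n), 0 ≤ inner ℝ g c)
    (h1 : ∀ w, inner ℝ g w ≤ stepNorm1 w) : g ∈ stepCone D n ∧ ∀ k, ‖g k‖ ≤ 1 := by
  have hn := pnat_cast_pos n
  refine ⟨isClosedCone_stepCone.mem_of_forall_dualCone h0, fun k => ?_⟩
  have h2 := h1 (stepSingle k (g k))
  rw [inner_stepSingle, stepNorm1_stepSingle] at h2
  have h3 := le_of_mul_le_mul_left h2 (by positivity)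
  rw [real_inner_self_eq_norm_sq] at h3
  nlinarith [norm_nonneg (g k)]

theorem stepNonlin_congr (hξ : IsProperFn D ξb) (hL : LipschitzOnWith L ξb (psd D))
    (hξ' : IsProperFn D ξb') (hL' : LipschitzOnWith L' ξb' (psd D))
    (hc : ∀ a ∈ psd D, ‖a‖ ≤ 1 → ξb a = ξb' a) {g : StepSpace D n}
    (hg : g ∈ stepCone D n ∧ ∀ k, ‖g k‖ ≤ 1) : stepNonlin ξb n g = stepNonlin ξb' n g := by
  rw [stepNonlin_eq, stepNonlin_eq,
    (isConeFunctional_step hξ hL).coneExt_eq isClosedCone_stepCone hg.1,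
    (isConeFunctional_step hξ' hL').coneExt_eq isClosedCone_stepCone hg.1]
  exact Finset.sum_congr rfl fun k _ => by rw [hc _ (hg.1.1 k) (hg.2 k)]

theorem stepValue_le_add_of_dual (hξ : IsProperFn D ξb) (hL : LipschitzOnWith L ξb (psd D))
    (hu : IsIncreasingLip u) {t : ℝ} (ht : 0 ≤ t) {c : StepSpace D n}
    (hc : c ∈ dualCone (stepCone D n)) (x : StepSpace D n) :
    stepValue ξb n L u (t, x) ≤ stepValue ξb n L u (t, x + c) := by
  have := (isGame_step hξ hL).value_le_add hu.lipschitzWith (w := -c) (c := 0) (fun x => by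
    have := hu.increasing c hc (x + -c)
    rw [neg_add_cancel_right] at this
    linarith) ht (x + c)
  rw [add_neg_cancel_right, add_zero] at this
  exact this

theorem stepValue_add_le (hξ : IsProperFn D ξb) (hL : LipschitzOnWith L ξb (psd D))
    (hu : IsIncreasingLip u) {t : ℝ} (ht : 0 ≤ t) (w x : StepSpace D n) :
    stepValue ξb n L u (t, x + w) ≤ stepValue ξb n L u (t, x) + stepNorm1 w :=
  (isGame_step hξ hL).value_le_add hu.lipschitzWith (fun x => hu.lip x w) ht x

theorem le_stepValue_add (hξ : IsProperFn D ξb) (hL : LipschitzOnWith L ξb (psd D))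
    (hu : IsIncreasingLip u) {t : ℝ} (ht : 0 ≤ t) (w x : StepSpace D n) :
    stepValue ξb n L u (t, x) - stepNorm1 w ≤ stepValue ξb n L u (t, x + w) := by
  have h1 := stepValue_add_le hξ hL hu ht (-w) (x + w)
  rw [add_neg_cancel_right] at h1
  have h2 : stepNorm1 (-w) = stepNorm1 w := by
    rw [← neg_one_smul ℝ w, stepNorm1_smul, abs_neg, abs_one, one_mul]
  linarith

theorem gradient_mem_of_isLocalMaxOn (hξ : IsProperFn D ξb) (hL : LipschitzOnWith L ξb (psd D))
    (hu : IsIncreasingLip u) {φ φt : ℝ × StepSpace D n → ℝ}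
    {φx : ℝ × StepSpace D n → StepSpace D n} (hφ : IsSmoothTest univ φ φt φx)
    {p : ℝ × StepSpace D n} (hp : 0 < p.1)
    (hm : IsLocalMaxOn (fun q => stepValue ξb n L u q - φ q) (Ioi (0 : ℝ) ×ˢ univ) p) :
    φx p ∈ stepCone D n ∧ ∀ k, ‖φx p k‖ ≤ 1 := by
  refine mem_stepCone_of_inner_bounds (fun c hc => ?_) fun w => ?_
  · refine le_inner_of_isLocalMaxOn hφ hp hm fun h hh => ?_
    rw [mul_zero, add_zero]
    exact stepValue_le_add_of_dual hξ hL hu hp.le (dualCone_smul hc hh.le) p.2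
  · have h1 := le_inner_of_isLocalMaxOn hφ hp hm (w := -w) (c := -stepNorm1 w) fun h hh => by
      have h2 := le_stepValue_add hξ hL hu hp.le (h • -w) p.2
      rw [smul_neg, ← neg_smul, stepNorm1_smul, abs_neg, abs_of_pos hh] at h2
      rw [smul_neg, ← neg_smul]
      have h3 : stepValue ξb n L u (p.1, p.2) = stepValue ξb n L u p := rfl
      linarith
    rw [inner_neg_right] at h1
    linarith

theorem gradient_mem_of_isLocalMinOn (hξ : IsProperFn D ξb) (hL : LipschitzOnWith L ξb (psd D))
    (hu : IsIncreasingLip u) {φ φt : ℝ × StepSpace D n → ℝ}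
    {φx : ℝ × StepSpace D n → StepSpace D n} (hφ : IsSmoothTest univ φ φt φx)
    {p : ℝ × StepSpace D n} (hp : 0 < p.1)
    (hm : IsLocalMinOn (fun q => stepValue ξb n L u q - φ q) (Ioi (0 : ℝ) ×ˢ univ) p) :
    φx p ∈ stepCone D n ∧ ∀ k, ‖φx p k‖ ≤ 1 := by
  have hm' : IsLocalMaxOn (fun q => -stepValue ξb n L u q - -φ q) (Ioi (0 : ℝ) ×ˢ univ) p := by
    refine hm.neg.mono fun q hq => ?_
    linarith
  refine mem_stepCone_of_inner_bounds (fun c hc => ?_) fun w => ?_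
  · have h1 := le_inner_of_isLocalMaxOn hφ.neg hp hm' (w := -c) (c := 0) fun h hh => by
      have h2 := stepValue_le_add_of_dual hξ hL hu hp.le (dualCone_smul hc hh.le) (p.2 + h • -c)
      rw [smul_neg, neg_add_cancel_right] at h2
      rw [smul_neg]
      have h3 : stepValue ξb n L u (p.1, p.2) = stepValue ξb n L u p := rfl
      linarith
    rwa [inner_neg_neg] at h1
  · have h1 := le_inner_of_isLocalMaxOn hφ.neg hp hm' (w := w) (c := -stepNorm1 w) fun h hh => by
      have h2 := stepValue_add_le hξ hL hu hp.le (h • w) p.2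
      rw [stepNorm1_smul, abs_of_pos hh] at h2
      have h3 : stepValue ξb n L u (p.1, p.2) = stepValue ξb n L u p := rfl
      linarith
    rw [inner_neg_left] at h1
    linarith

/-- The value does not depend on the regularization. -/
theorem stepValue_congr (hξ : IsProperFn D ξb) (hL : LipschitzOnWith L ξb (psd D))
    (hξ' : IsProperFn D ξb') (hL' : LipschitzOnWith L' ξb' (psd D))
    (hc : ∀ a ∈ psd D, ‖a‖ ≤ 1 → ξb a = ξb' a) (hu : IsIncreasingLip u) {t : ℝ} (ht : 0 ≤ t)
    (x : StepSpace D n) : stepValue ξb n L u (t, x) = stepValue ξb' n L' u (t, x) := by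
  have hG := isGame_step (n := n) hξ hL
  have hG' := isGame_step (n := n) hξ' hL'
  have hl := isLipOn_stepValue hξ hL hu univ
  have hl' := isLipOn_stepValue hξ' hL' hu univ
  -- The comparison takes place on the whole space: at boundary points of the cone, some directions
  -- needed to locate test gradients would be unavailable.
  have hsub := hG.isViscSub_value hu.lipschitzWith isClosed_univ convex_univ
    fun _ _ _ _ _ _ => mem_univ _
  have hsuper := hG.isViscSuper_value hu.lipschitzWith isClosed_univ convex_univ
    fun _ _ _ _ _ _ => mem_univ _
  have hsub' := hG'.isViscSub_value hu.lipschitzWith isClosed_univ convex_univ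
    fun _ _ _ _ _ _ => mem_univ _
  have hsuper' := hG'.isViscSuper_value hu.lipschitzWith isClosed_univ convex_univ
    fun _ _ _ _ _ _ => mem_univ _
  have h1 : IsViscSub univ (stepNonlin ξb' n) (stepValue ξb n L u) := by
    refine ⟨hsub.1, fun p hp φ φt φx hφ hm => ?_⟩
    rw [← stepNonlin_congr hξ hL hξ' hL' hc (gradient_mem_of_isLocalMaxOn hξ hL hu hφ hp.1 hm)]
    exact hsub.2 p hp φ φt φx hφ hm
  have h2 : IsViscSuper univ (stepNonlin ξb' n) (stepValue ξb n L u) := by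
    refine ⟨hsuper.1, fun p hp φ φt φx hφ hm => ?_⟩
    rw [← stepNonlin_congr hξ hL hξ' hL' hc (gradient_mem_of_isLocalMinOn hξ hL hu hφ hp.1 hm)]
    exact hsuper.2 p hp φ φt φx hφ hm
  have h0 : ∀ x ∈ (univ : Set (StepSpace D n)), stepValue ξb n L u (0, x)
      = stepValue ξb' n L' u (0, x) := fun x _ => by
    rw [stepValue_zero hξ hL hu, stepValue_zero hξ' hL' hu]
  apply le_antisymm
  · exact le_of_isViscSub_of_isViscSuper isClosed_univ convex_univ univ_nonempty
      hG'.abs_apply_sub_le hl hl' h1 hsuper' (fun x hx => (h0 x hx).le) (t, x) ⟨ht, trivial⟩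
  · exact le_of_isViscSub_of_isViscSuper isClosed_univ convex_univ univ_nonempty
      hG'.abs_apply_sub_le hl' hl hsub' h2 (fun x hx => (h0 x hx).ge) (t, x) ⟨ht, trivial⟩

/-- The lower and upper values agree. -/
theorem neg_reflect_value_le (hξ : IsProperFn D ξb) (hL : LipschitzOnWith L ξb (psd D))
    (hu : IsIncreasingLip u) {t : ℝ} (ht : 0 ≤ t) {x : StepSpace D n} (hx : x ∈ stepCone D n) :
    -gameValue (reflect (stepNonlin ξb n)) (stepMoves D n L) (fun x => -u x) (t, x)
      ≤ stepValue ξb n L u (t, x) := by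
  have hG := (isGame_step (n := n) hξ hL).reflected
  have hu' : LipschitzWith 1 fun x => -u x := hu.lipschitzWith.neg
  obtain ⟨K, hK⟩ := hG.exists_lipschitzOnWith_value hu'
  -- Minus the value of the reflected game solves the original equation with the same initial
  -- condition, so comparison orders the two values.
  have h1 := (isViscSuper_stepValue hξ hL hu).isSubAdm_neg fun _ _ => True
  have h2 := (hG.isViscSuper_value hu' isClosedCone_stepCone.closed
    isClosedCone_stepCone.convex stepCone_add_moves).isSubAdm_neg fun _ _ => True
  rw [reflect_reflect] at h2
  have hneg : IsLipOn (stepCone D n) fun q =>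
      -gameValue (reflect (stepNonlin ξb n)) (stepMoves D n L) (fun x => -u x) q :=
    ⟨K, LipschitzOnWith.of_dist_le_mul fun a ha b hb => by
      rw [dist_neg_neg]
      exact hK.dist_le_mul a ⟨ha.1, trivial⟩ b ⟨hb.1, trivial⟩⟩
  refine le_of_isSubAdm (N := fun _ _ => True) isClosedCone_stepCone.closed
    isClosedCone_stepCone.convex isClosedCone_stepCone.zero_mem
    (fun _ _ _ _ _ _ _ _ _ _ _ _ => trivial) (isGame_step hξ hL).abs_apply_sub_le hneg
    (isLipOn_stepValue hξ hL hu _) h2 h1 (fun x _ => ?_) (t, x) ⟨ht, hx⟩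
  rw [hG.value_zero hu', stepValue_zero hξ hL hu, neg_neg]

end StepValue

/-! ### Convergence to the value on paths -/

section PathValue

variable {D : ℕ} {n : ℕ+} {ξb ξb' : SymMat D → ℝ} {L L' M : NNReal} {ψ : PathSpace D → ℝ}

/-- The admissible directions of the game on paths. -/
def pathMoves (D : ℕ) (L : NNReal) : Set (PathSpace D) := pathCone D ∩ {z | ‖z‖ ≤ L}

theorem isGame_path (hξ : IsProperFn D ξb) (hL : LipschitzOnWith L ξb (psd D)) :
    IsGame (pathNonlin ξb) (pathMoves D L) L :=
  (isConeFunctional_path hξ hL).isGame isClosedCone_pathCone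

theorem pathCone_add_moves : ∀ x ∈ pathCone D, ∀ z ∈ pathMoves D L, ∀ h : ℝ, 0 ≤ h →
    x + h • z ∈ pathCone D := fun x hx z hz h hh =>
  isClosedCone_pathCone.add_mem x hx _ (isClosedCone_pathCone.smul_mem h hh z hz.1)

theorem isSubgame_step (hξ : IsProperFn D ξb) (hL : LipschitzOnWith L ξb (psd D)) :
    IsSubgame (pathNonlin ξb) (pathMoves D L) (stepNonlin ξb n) (stepMoves D n L) (stepLift n)
      (projMap D n) where
  adjoint := inner_stepLift
  mapsTo z hz := ⟨stepProj_mem hz.1, (isAdjointOf_liftMap.norm_le z).trans hz.2⟩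
  restrict := pathNonlin_stepLift hξ hL

/-- The value of the game on paths. -/
noncomputable def pathValue (ξb : SymMat D → ℝ) (L : NNReal) (ψ : PathSpace D → ℝ) :
    ℝ × PathSpace D → ℝ := gameValue (pathNonlin ξb) (pathMoves D L) ψ

/-- The rate of approximation by step functions. -/
noncomputable def approxRate (D : ℕ) (n : ℕ+) : ℝ := (‖idMat D‖ + 2) * √(1 / n)

theorem approxRate_nonneg : 0 ≤ approxRate D n := by unfold approxRate; positivity

theorem tendsto_approxRate : Tendsto (approxRate D) atTop (𝓝 0) := by
  have h1 : Tendsto (fun n : ℕ+ => √(1 / (n : ℝ))) atTop (𝓝 √0) := by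
    refine (Real.continuous_sqrt.tendsto 0).comp ?_
    exact tendsto_one_div_atTop_nhds_zero_nat.comp (f := fun n : ℕ+ => (n : ℕ))
      tendsto_PNat_val_atTop_atTop
  have h2 := h1.const_mul (‖idMat D‖ + 2)
  rwa [Real.sqrt_zero, mul_zero] at h2

/-- Families of finite-dimensional initial conditions compatible with `ψ`. -/
structure IsApproxData (ψ : PathSpace D → ℝ) (u : ∀ n, StepSpace D n → ℝ) : Prop where
  lipschitz : LipschitzWith 1 ψ
  isIncreasingLip : ∀ n, IsIncreasingLip (u n)
  eq_lift : ∀ n, ∀ x ∈ stepCone D n, u n x = ψ (stepLift n x)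
  le : ∀ n, ∀ μ ∈ pathCone D, u n (stepProj n μ) ≤ ψ μ
  ge : ∀ n, ∀ μ ∈ pathCone D, ψ μ ≤ u n (stepProj n μ) + approxRate D n * ‖μ‖

variable {u : ∀ n, StepSpace D n → ℝ}

theorem stepValue_le_pathValue (hξ : IsProperFn D ξb) (hL : LipschitzOnWith L ξb (psd D))
    (hd : IsApproxData ψ u) {t : ℝ} (ht : 0 ≤ t) {μ : PathSpace D} (hμ : μ ∈ pathCone D) :
    stepValue ξb n L (u n) (t, stepProj n μ) ≤ pathValue ξb L ψ (t, μ) :=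
  (isSubgame_step hξ hL).value_le (isGame_path hξ hL) (isGame_step hξ hL) hd.lipschitz
    (hd.isIncreasingLip n).lipschitzWith pathCone_add_moves (hd.le n) ht hμ

theorem pathValue_le_stepValue (hξ : IsProperFn D ξb) (hL : LipschitzOnWith L ξb (psd D))
    (hd : IsApproxData ψ u) {t : ℝ} (ht : 0 ≤ t) {μ : PathSpace D} (hμ : μ ∈ pathCone D) :
    pathValue ξb L ψ (t, μ)
      ≤ stepValue ξb n L (u n) (t, stepProj n μ) + approxRate D n * (‖μ‖ + t * L) := by
  have h1 := (isSubgame_step (n := n) hξ hL).value_le_neg_value (isGame_path hξ hL)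
    (isGame_step hξ hL) (v := fun x => -u n x) hd.lipschitz
    (hd.isIncreasingLip n).lipschitzWith.neg pathCone_add_moves (approxRate_nonneg (D := D) (n := n))
    (fun μ hμ => by rw [neg_neg]; exact hd.ge n μ hμ) ht hμ
  have h2 := neg_reflect_value_le hξ hL (hd.isIncreasingLip n) ht (stepProj_mem (n := n) hμ)
  exact h1.trans (add_le_add_left h2 _)

theorem tendsto_stepValue (hξ : IsProperFn D ξb) (hL : LipschitzOnWith L ξb (psd D))
    (hd : IsApproxData ψ u) {t : ℝ} (ht : 0 ≤ t) {μ : PathSpace D} (hμ : μ ∈ pathCone D) :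
    Tendsto (fun n : ℕ+ => stepValue ξb n L (u n) (t, stepProj n μ)) atTop
      (𝓝 (pathValue ξb L ψ (t, μ))) := by
  refine tendsto_of_tendsto_of_tendsto_of_le_of_le
    (g := fun n => pathValue ξb L ψ (t, μ) - approxRate D n * (‖μ‖ + t * L)) ?_
    tendsto_const_nhds (fun n => ?_) fun n => stepValue_le_pathValue hξ hL hd ht hμ
  · have := (tendsto_approxRate (D := D)).mul_const (‖μ‖ + t * L) |>.const_sub
      (pathValue ξb L ψ (t, μ))
    rwa [zero_mul, sub_zero] at this
  · exact sub_le_iff_le_add.2 (pathValue_le_stepValue hξ hL hd ht hμ)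

theorem isLipOn_pathValue (hξ : IsProperFn D ξb) (hL : LipschitzOnWith L ξb (psd D))
    (hψ : LipschitzWith M ψ) (S : Set (PathSpace D)) : IsLipOn S (pathValue ξb L ψ) := by
  obtain ⟨K, hK⟩ := (isGame_path hξ hL).exists_lipschitzOnWith_value hψ
  exact ⟨K, hK.mono (prod_mono_right (subset_univ S))⟩

theorem IsLipOn.continuousOn {E : Type*} [NormedAddCommGroup E] {S : Set E} {f : ℝ × E → ℝ}
    (h : IsLipOn S f) : ContinuousOn f (Ici (0 : ℝ) ×ˢ S) :=
  let ⟨_, hK⟩ := h; hK.continuousOn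

theorem pathValue_zero (hξ : IsProperFn D ξb) (hL : LipschitzOnWith L ξb (psd D))
    (hψ : LipschitzWith M ψ) (μ : PathSpace D) : pathValue ξb L ψ (0, μ) = ψ μ :=
  (isGame_path hξ hL).value_zero hψ μ

/-- The independence is inherited from the step values, whose limits are unique. -/
theorem pathValue_congr (hξ : IsProperFn D ξb) (hL : LipschitzOnWith L ξb (psd D))
    (hξ' : IsProperFn D ξb') (hL' : LipschitzOnWith L' ξb' (psd D))
    (hc : ∀ a ∈ psd D, ‖a‖ ≤ 1 → ξb a = ξb' a) (hd : IsApproxData ψ u) {t : ℝ} (ht : 0 ≤ t)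
    {μ : PathSpace D} (hμ : μ ∈ pathCone D) :
    pathValue ξb L ψ (t, μ) = pathValue ξb' L' ψ (t, μ) := by
  refine tendsto_nhds_unique (tendsto_stepValue hξ hL hd ht hμ) ?_
  simp_rw [fun n => stepValue_congr hξ hL hξ' hL' hc (hd.isIncreasingLip n) ht]
  exact tendsto_stepValue hξ' hL' hd ht hμ

theorem le_limit_of_isLocalMaxOn {H : PathSpace D → ℝ}
    (hH : ∀ q q', |H q - H q'| ≤ L * ‖q - q'‖) {v : ∀ n, ℝ × StepSpace D n → ℝ}
    (hvcont : ∀ n, ContinuousOn (v n) (Ici (0 : ℝ) ×ˢ stepCone D n))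
    (hv : ∀ n, IsSubAdm (stepCone D n) (fun _ _ => True) (fun b => H (liftMap D n b)) (v n))
    {f : ℝ × PathSpace D → ℝ}
    (hvf : ∀ (n : ℕ+) (t : ℝ), 0 ≤ t → ∀ x ∈ stepCone D n,
      v n (t, x) ≤ f (t, liftMap D n x) + approxRate D n * (‖x‖ + t * L))
    (hconv : ∀ t : ℝ, 0 ≤ t → ∀ μ ∈ pathCone D,
      Tendsto (fun n : ℕ+ => v n (t, stepProj n μ)) atTop (𝓝 (f (t, μ))))
    {φ φt : ℝ × PathSpace D → ℝ} {φx : ℝ × PathSpace D → PathSpace D}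
    (hφ : IsSmoothTest (pathCone D) φ φt φx) {q : ℝ × PathSpace D}
    (hq : q ∈ Ioi (0 : ℝ) ×ˢ pathCone D)
    (hmax : IsLocalMaxOn (fun q => f q - φ q) (Ioi (0 : ℝ) ×ˢ pathCone D) q) :
    φt q ≤ H (φx q) := by
  have h1 : ∀ n, IsAdjointOf (liftMap D n) (projMap D n) := fun _ => isAdjointOf_liftMap
  have h2 : ∀ κ, Tendsto (fun n => liftMap D n (projMap D n κ)) (atTop : Filter ℕ+) (𝓝 κ) :=
    tendsto_lift_proj
  have h3 : ∀ n, IsClosed (stepCone D n) := fun _ => isClosedCone_stepCone.closed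
  have h4 : ∀ n, MapsTo (liftMap D n) (stepCone D n) (pathCone D) := fun _ _ hx => stepLift_mem hx
  have h5 : ∀ n, MapsTo (projMap D n) (pathCone D) (stepCone D n) := fun _ _ hx => stepProj_mem hx
  exact le_of_isLocalMaxOn_of_approx h1 h2 h3 h4 h5 hH hvcont hv tendsto_approxRate hvf hconv hφ
    hq hmax

theorem isViscSub_pathValue (hξ : IsProperFn D ξb) (hL : LipschitzOnWith L ξb (psd D))
    (hd : IsApproxData ψ u) : IsViscSub (pathCone D) (pathNonlin ξb) (pathValue ξb L ψ) := by
  refine ⟨(isLipOn_pathValue hξ hL hd.lipschitz _).continuousOn, fun p hp φ φt φx hφ hm => ?_⟩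
  have hsub : ∀ n, IsSubAdm (stepCone D n) (fun _ _ => True)
      (fun b => pathNonlin ξb (liftMap D n b)) (stepValue ξb n L (u n)) := fun n => by
    simp only [liftMap_apply, pathNonlin_stepLift hξ hL]
    exact (isViscSub_stepValue hξ hL (hd.isIncreasingLip n)).isSubAdm _
  have hle : ∀ (n : ℕ+) (t : ℝ), 0 ≤ t → ∀ x ∈ stepCone D n, stepValue ξb n L (u n) (t, x)
      ≤ pathValue ξb L ψ (t, liftMap D n x) + approxRate D n * (‖x‖ + t * L) := by
    intro n t ht x hx
    have h1 := stepValue_le_pathValue (n := n) hξ hL hd ht (stepLift_mem hx)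
    rw [stepProj_stepLift] at h1
    have h2 : 0 ≤ approxRate D n * (‖x‖ + t * L) :=
      mul_nonneg approxRate_nonneg (add_nonneg (norm_nonneg _) (mul_nonneg ht L.2))
    rw [liftMap_apply]
    linarith
  have := le_limit_of_isLocalMaxOn (isGame_path hξ hL).abs_apply_sub_le
    (fun n => (isLipOn_stepValue hξ hL (hd.isIncreasingLip n) _).continuousOn) hsub hle
    (fun t ht μ hμ => tendsto_stepValue hξ hL hd ht hμ) hφ hp hm
  linarith

theorem isViscSuper_pathValue (hξ : IsProperFn D ξb) (hL : LipschitzOnWith L ξb (psd D))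
    (hd : IsApproxData ψ u) : IsViscSuper (pathCone D) (pathNonlin ξb) (pathValue ξb L ψ) := by
  refine ⟨(isLipOn_pathValue hξ hL hd.lipschitz _).continuousOn, fun p hp φ φt φx hφ hm => ?_⟩
  have hsub : ∀ n, IsSubAdm (stepCone D n) (fun _ _ => True)
      (fun b => reflect (pathNonlin ξb) (liftMap D n b))
      (fun q => -stepValue ξb n L (u n) q) := fun n => by
    have h1 : (fun b => reflect (pathNonlin ξb) (liftMap D n b)) = reflect (stepNonlin ξb n) := by
      funext b
      rw [reflect, reflect, ← LinearIsometry.map_neg, liftMap_apply, pathNonlin_stepLift hξ hL]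
    rw [h1]
    exact (isViscSuper_stepValue hξ hL (hd.isIncreasingLip n)).isSubAdm_neg _
  -- For subsolutions the corresponding bound needs no error term; here the approximation rate is
  -- essential.
  have hle : ∀ (n : ℕ+) (t : ℝ), 0 ≤ t → ∀ x ∈ stepCone D n, -stepValue ξb n L (u n) (t, x)
      ≤ -pathValue ξb L ψ (t, liftMap D n x) + approxRate D n * (‖x‖ + t * L) := by
    intro n t ht x hx
    have h1 := pathValue_le_stepValue (n := n) hξ hL hd ht (stepLift_mem hx)
    rw [stepProj_stepLift, ← liftMap_apply, LinearIsometry.norm_map] at h1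
    linarith
  have hm' : IsLocalMaxOn (fun q => -pathValue ξb L ψ q - -φ q) (Ioi (0 : ℝ) ×ˢ pathCone D) p := by
    refine hm.neg.mono fun q hq => ?_
    linarith
  have := le_limit_of_isLocalMaxOn (f := fun q => -pathValue ξb L ψ q)
    (isGame_path hξ hL).reflected.abs_apply_sub_le
    (fun n => (isLipOn_stepValue hξ hL (hd.isIncreasingLip n) _).continuousOn.neg) hsub hle
    (fun t ht μ hμ => (tendsto_stepValue hξ hL hd ht hμ).neg) hφ.neg hp hm'
  simp only [reflect, neg_neg] at this
  linarith

end PathValue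

/-! ### Initial conditions and uniqueness of the Neumann solutions -/

section Main

variable {D : ℕ} {n : ℕ+} {ξ : Mat D → ℝ} {ξb ξb' : SymMat D → ℝ} {L : NNReal}
  {ψ ψ' : PathSpace D → ℝ}

theorem exists_approxData (hψincr : IncreasingAlong (dualCone (pathCone D)) (pathCone D) ψ)
    (hψlip : ∀ μ ∈ pathCone D, ∀ ν ∈ pathCone D,
      |ψ μ - ψ ν| ≤ ∫ s in Ico (0 : ℝ) 1, ‖μ s - ν s‖) :
    ∃ (ψ' : PathSpace D → ℝ) (u : ∀ n, StepSpace D n → ℝ),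
      (∀ μ ∈ pathCone D, ψ' μ = ψ μ) ∧ IsApproxData ψ' u := by
  have hint : ∀ μ ν : PathSpace D, ∫ s in Ico (0 : ℝ) 1, ‖μ s - ν s‖
      = ∫ s in Ico (0 : ℝ) 1, ‖(μ - ν) s‖ := fun μ ν => by
    refine integral_congr_ae ?_
    filter_upwards [Lp.coeFn_sub μ ν] with s hs
    rw [hs, Pi.sub_apply]
  have hlip2 : LipschitzOnWith 1 ψ (pathCone D) := LipschitzOnWith.of_dist_le_mul fun μ hμ ν hν => by
    rw [Real.dist_eq, dist_eq_norm μ, NNReal.coe_one, one_mul]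
    refine (hψlip μ hμ ν hν).trans ?_
    rw [hint]
    exact integral_norm_le _
  -- On paths any Lipschitz extension works, because trajectories from the cone stay in it. Only the
  -- extensions on step functions must also be increasing.
  obtain ⟨ψ', hψ', heq⟩ := hlip2.extend_real
  have hex : ∀ n : ℕ+, ∃ u : StepSpace D n → ℝ, (∀ x ∈ stepCone D n, u x = ψ (stepLift n x)) ∧
      (∀ c ∈ dualCone (stepCone D n), ∀ x, u x ≤ u (x + c)) ∧
      ∀ x w, u (x + w) ≤ u x + stepNorm1 w := fun n => by
    refine exists_increasing_extension (fun x hx y hy hxy => ?_) fun x hx y hy => ?_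
    · refine hψincr _ (stepLift_mem hx) _ (stepLift_mem hy) ?_
      have := stepLift_mem_dualCone hxy
      rwa [← liftMap_apply, LinearIsometry.map_sub] at this
    · refine (hψlip _ (stepLift_mem hx) _ (stepLift_mem hy)).trans (le_of_eq ?_)
      rw [hint, ← liftMap_apply, ← liftMap_apply, ← LinearIsometry.map_sub, liftMap_apply]
      exact integral_comp_stepLift (fun a => ‖a‖) (x - y)
  choose u hu using hex
  have hval : ∀ n, ∀ μ ∈ pathCone D, u n (stepProj n μ) = ψ (stepLift n (stepProj n μ)) :=
    fun n μ hμ => (hu n).1 _ (stepProj_mem hμ)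
  refine ⟨ψ', u, fun μ hμ => (heq hμ).symm, hψ', fun n => ⟨(hu n).2.1, (hu n).2.2⟩,
    fun n x hx => ?_, fun n μ hμ => ?_, fun n μ hμ => ?_⟩
  · rw [← heq (stepLift_mem hx)]
    exact (hu n).1 x hx
  · rw [← heq hμ, hval n μ hμ]
    exact hψincr _ hμ _ (stepLift_mem (stepProj_mem hμ)) (sub_lift_proj_mem_dualCone hμ)
  · rw [← heq hμ, hval n μ hμ]
    have h1 := (le_abs_self _).trans (hψlip _ hμ _ (stepLift_mem (stepProj_mem (n := n) hμ)))
    have h2 := integral_norm_sub_lift_proj_le (n := n) hμ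
    rw [approxRate]
    linarith

theorem IsRegularization.eq_on_ball (h : IsRegularization ξ ξb) (h' : IsRegularization ξ ξb') :
    ∀ a ∈ psd D, ‖a‖ ≤ 1 → ξb a = ξb' a := fun a ha ha1 => by
  rw [h.coincide a ha ha1, h'.coincide a ha ha1]

variable {u : ∀ n, StepSpace D n → ℝ}

theorem isNeumannSol_stepValue (hξ : IsProperFn D ξb) (hL : LipschitzOnWith L ξb (psd D))
    (hd : IsApproxData ψ' u) (hψ : ∀ μ ∈ pathCone D, ψ' μ = ψ μ) :
    IsNeumannSol ξb ψ n (stepValue ξb n L (u n)) :=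
  ⟨(isViscSub_stepValue hξ hL (hd.isIncreasingLip n)).isNeumannSub,
    (isViscSuper_stepValue hξ hL (hd.isIncreasingLip n)).isNeumannSuper,
    isLipOn_stepValue hξ hL (hd.isIncreasingLip n) _, fun x hx => by
      rw [stepValue_zero hξ hL (hd.isIncreasingLip n), hd.eq_lift n x hx, hψ _ (stepLift_mem hx)]⟩

theorem IsNeumannSol.le (hξ : IsProperFn D ξb) (hL : LipschitzOnWith L ξb (psd D))
    {v w : ℝ × StepSpace D n → ℝ} (hv : IsNeumannSol ξb ψ n v) (hw : IsNeumannSol ξb ψ n w) :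
    ∀ p ∈ Ici (0 : ℝ) ×ˢ stepCone D n, v p ≤ w p :=
  le_of_isNeumannSub_of_isNeumannSuper isClosedCone_stepCone.closed isClosedCone_stepCone.convex
    stepCone_nonempty_interior (isGame_step hξ hL).abs_apply_sub_le hv.2.2.1 hw.2.2.1 hv.1 hw.2.1
    fun x hx => by rw [hv.2.2.2 x hx, hw.2.2.2 x hx]

theorem IsNeumannSol.eqOn (hξ : IsProperFn D ξb) (hL : LipschitzOnWith L ξb (psd D))
    {v w : ℝ × StepSpace D n → ℝ} (hv : IsNeumannSol ξb ψ n v) (hw : IsNeumannSol ξb ψ n w) :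
    EqOn v w (Ici (0 : ℝ) ×ˢ stepCone D n) := fun p hp =>
  le_antisymm (hv.le hξ hL hw p hp) (hw.le hξ hL hv p hp)

end Main

end SpinHJ

open SpinHJ
theorem mainTheorem10 (D : ℕ) (hD : 0 < D)
    (ξ : Mat D → ℝ) (hξ : LocallyLipschitz ξ)
    (hξproper : IsProperFn D (fun a : SymMat D => ξ (a : Mat D)))
    (ψ : PathSpace D → ℝ)
    (hψincr : IncreasingAlong (dualCone (pathCone D)) (pathCone D) ψ)
    (hψlip : ∀ μ ∈ pathCone D, ∀ ν ∈ pathCone D,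
      |ψ μ - ψ ν| ≤ ∫ s in Ico (0 : ℝ) 1, ‖μ s - ν s‖) :
    ∃ f : ℝ × PathSpace D → ℝ,
      -- `f` is the unique Lipschitz viscosity solution with initial condition `ψ`
      (IsLipViscSol ξ ψ f ∧
        ∀ g : ℝ × PathSpace D → ℝ, IsLipViscSol ξ ψ g → EqOn g f (Ici (0 : ℝ) ×ˢ pathCone D)) ∧
      -- for every regularization, the Neumann approximations are well defined, their lifts have
      -- a pointwise limit, and this limit is `f`
      ∀ ξb : SymMat D → ℝ, IsRegularization ξ ξb →
        (∀ n : ℕ+, ∃ u : ℝ × StepSpace D n → ℝ, IsNeumannSol ξb ψ n u ∧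
          ∀ v : ℝ × StepSpace D n → ℝ, IsNeumannSol ξb ψ n v →
            EqOn v u (Ici (0 : ℝ) ×ˢ stepCone D n)) ∧
        IsNeumannLimit ξb ψ f ∧
        ∀ g : ℝ × PathSpace D → ℝ, IsNeumannLimit ξb ψ g →
          EqOn g f (Ici (0 : ℝ) ×ˢ pathCone D) := by
  obtain ⟨ψ', u, hψ', hd⟩ := exists_approxData hψincr hψlip
  obtain ⟨ξ₀, h₀⟩ := exists_isRegularization hξ hξproper
  obtain ⟨L₀, hL₀⟩ := h₀.lipschitz
  have hcongr : ∀ ξb : SymMat D → ℝ, IsRegularization ξ ξb → ∀ L : NNReal,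
      LipschitzOnWith L ξb (psd D) → ∀ p ∈ Ici (0 : ℝ) ×ˢ pathCone D,
      pathValue ξb L ψ' p = pathValue ξ₀ L₀ ψ' p := fun ξb h L hL p hp =>
    pathValue_congr h.proper hL h₀.proper hL₀ (h.eq_on_ball h₀) hd hp.1 hp.2
  have hzero : ∀ ξb : SymMat D → ℝ, IsRegularization ξ ξb → ∀ L : NNReal,
      LipschitzOnWith L ξb (psd D) → ∀ μ ∈ pathCone D, pathValue ξb L ψ' (0, μ) = ψ μ :=
    fun ξb h L hL μ hμ => by rw [pathValue_zero h.proper hL hd.lipschitz, hψ' μ hμ]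
  have hlim : ∀ ξb : SymMat D → ℝ, IsRegularization ξ ξb → ∀ L : NNReal,
      LipschitzOnWith L ξb (psd D) → ∀ t : ℝ, 0 ≤ t → ∀ μ ∈ pathCone D,
      Tendsto (fun n : ℕ+ => stepValue ξb n L (u n) (t, stepProj n μ)) atTop
        (𝓝 (pathValue ξ₀ L₀ ψ' (t, μ))) := fun ξb h L hL t ht μ hμ => by
    rw [← hcongr ξb h L hL (t, μ) ⟨ht, hμ⟩]
    exact tendsto_stepValue h.proper hL hd ht hμ
  refine ⟨pathValue ξ₀ L₀ ψ', ⟨⟨⟨⟨ξ₀, h₀, isViscSub_pathValue h₀.proper hL₀ hd⟩,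
    ⟨ξ₀, h₀, isViscSuper_pathValue h₀.proper hL₀ hd⟩⟩, isLipOn_pathValue h₀.proper hL₀ hd.lipschitz _,
    hzero ξ₀ h₀ L₀ hL₀⟩, ?_⟩, fun ξb h => ?_⟩
  · rintro g ⟨⟨⟨ξ₁, h₁, hsub⟩, ⟨ξ₂, h₂, hsuper⟩⟩, hglip, hg0⟩ p hp
    obtain ⟨L₁, hL₁⟩ := h₁.lipschitz
    obtain ⟨L₂, hL₂⟩ := h₂.lipschitz
    have hC := isClosedCone_pathCone (D := D)
    have hne : (pathCone D).Nonempty := ⟨0, zero_mem_pathCone⟩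
    -- `g` may be a subsolution and a supersolution for different regularizations. Each bound
    -- compares it with the value for the matching one, and all these values coincide.
    apply le_antisymm
    · rw [← hcongr ξ₁ h₁ L₁ hL₁ p hp]
      exact le_of_isViscSub_of_isViscSuper hC.closed hC.convex hne (isGame_path h₁.proper hL₁).abs_apply_sub_le hglip
        (isLipOn_pathValue h₁.proper hL₁ hd.lipschitz _) hsub
        (isViscSuper_pathValue h₁.proper hL₁ hd)
        (fun μ hμ => by rw [hg0 μ hμ, hzero ξ₁ h₁ L₁ hL₁ μ hμ]) p hp
    · rw [← hcongr ξ₂ h₂ L₂ hL₂ p hp]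
      exact le_of_isViscSub_of_isViscSuper hC.closed hC.convex hne (isGame_path h₂.proper hL₂).abs_apply_sub_le
        (isLipOn_pathValue h₂.proper hL₂ hd.lipschitz _) hglip
        (isViscSub_pathValue h₂.proper hL₂ hd) hsuper
        (fun μ hμ => by rw [hg0 μ hμ, hzero ξ₂ h₂ L₂ hL₂ μ hμ]) p hp
  · obtain ⟨L, hL⟩ := h.lipschitz
    have hsol : ∀ n, IsNeumannSol ξb ψ n (stepValue ξb n L (u n)) := fun n =>
      isNeumannSol_stepValue h.proper hL hd hψ'
    refine ⟨fun n => ⟨_, hsol n, fun v hv => hv.eqOn h.proper hL (hsol n)⟩,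
      ⟨_, hsol, hlim ξb h L hL⟩, ?_⟩
    rintro g ⟨w, hw, hwlim⟩ ⟨t, μ⟩ ⟨ht, hμ⟩
    refine tendsto_nhds_unique (hwlim t ht μ hμ) ((hlim ξb h L hL t ht μ hμ).congr fun n => ?_)
    -- Any choice of Neumann solutions agrees with the step values at the projected points, so the
    -- limit does not depend on it.
    exact ((hw n).eqOn h.proper hL (hsol n) ⟨ht, stepProj_mem hμ⟩).symm
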